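/- Let $k$ be a field of characteristic $0$. All operads are symmetric dg operads over $k$, i.e. operads $P=(P(n))_{n\ge 0}$ in ($\mathbb Z$-graded, unbounded) cochain complexes of $k$-vector spaces; a quasi-isomorphism is a morphism inducing isomorphisms on the cohomology of $P(n)$ for every $n$. **Non-unitary case.** Let $P$ be a dg operad for which $P=\Gamma(M)$ as a graded operad, where $\Gamma$ is the free operad functor and $M(0)=M(1)=0$. An arity $n$ principal extension ($n\ge 2$) of $P$ is a dg operad $P\sqcup_d\Gamma(E)$ which as a graded operad is $\Gamma(M\oplus E)=P\sqcup\Gamma(E)$, with $E$ a graded $\Sigma_n$-module placed in arity $n$, and whose differential extends that of $P$ and restricts on $E$ to a $\Sigma_n$-equivariant map $d:E\to ZP(n)$ of degree $+1$. A *non-unitary Sullivan minimal operad* is the colimit of a sequence $I_0\to P_2\to P_3\to\cdots$, where $I_0$ is the initial operad ($I_0(1)=k$, $I_0(n)=0$ for $n\neq 1$) and each $P_n$ is an arity $n$ principal extension of the preceding term. Morphisms are morphisms of dg operads. **Unitary case.** Here one considers dg operads with a distinguished degree $0$ cocycle $1\in P(0)$, and all morphisms preserve it. Such an operad is unitary if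 $P(0)=k\cdot 1\cong k$. A unitary arity $n$ principal extension ($n\ge 2$) of a unitary $P$ is a unitary dg operad $P\sqcup^\delta_d\Gamma(E)$ whose truncation (arity $0$ replaced by $0$) is, as a graded operad, the coproduct of the truncation of $P$ with $\Gamma(E)$, with differential given on $E$ by a $\Sigma_n$-equivariant map $d:E\to ZP(n)$ of degree $+1$ and with restriction operations $x\mapsto x\circ_i 1$ given on $E$ by maps $\delta_i:E\to P(n-1)$, $1\le i\le n$. A *unitary Sullivan minimal operad* is the colimit of a sequence $I_+\to P_2\to P_3\to\cdots$, where $I_+$ is the initial unitary operad ($I_+(0)=I_+(1)=k$, $I_+(n)=0$ for $n\ge2$) and each $P_n$ is a unitary arity $n$ principal extension of the preceding term. An operad $P$ has a *unitary multiplication* if there is a morphism $\mathrm{Ass}_+\to P$ from the operad of unital associative algebras, i.e. a degree $0$ cocycle $m\in P(2)$ with $m\circ_1m=m\circ_2m$ and $m\circ_11=\mathrm{id}=m\circ_21$. In both cases, a *Sullivan minimal model* of $P$ is a quasi-isomorphism $\varphi:P_\infty\to P$ with $P_\infty$ a Sullivan minimal operad. Two morphisms $f,g:P\to Q$ are homotopic,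 $f\simeq g$, if there is a morphism $H:P\to Q[t,dt]=Q\otimes k[t,dt]$ (with distinguished element $1\otimes 1$ in the unitary case) whose evaluations at $t=0$ and $t=1$ are $f$ and $g$. **Theorem.** (a) Let $P$ be a dg operad and let $\varphi:P_\infty\to P$ and $\varphi':P'_\infty\to P$ be two Sullivan minimal models, either both non-unitary, or both unitary, where in the unitary case $P$ is assumed to have a unitary multiplication. Then there is an isomorphism $\psi:P_\infty\to P'_\infty$ with $\varphi'\psi\simeq\varphi$, and it is unique up to homotopy: every morphism $\chi:P_\infty\to P'_\infty$ with $\varphi'\chi\simeq\varphi$ satisfies $\chi\simeq\psi$. (b) Every quasi-isomorphism $\rho:P_\infty\to P'_\infty$ between Sullivan minimal operads, both non-unitary or both unitary, is an isomorphism. -/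

import Mathlib

open scoped TensorProduct Polynomial

universe u

noncomputable section

/-! ## Graded operads and dg operads

Everything lives over a field `k`. The space of operations with `n` inputs and of degree `p` is
`X n p`. Inputs are numbered `0, …, n - 1`. Composition products and differentials take the arity
and the degree of their value as separate indices together with an equation, so that the axioms need
no transport along equalities. -/

/-- The place, among the inputs of `x ∘ᵢ y`, of the input `j ≠ i` of `x`, where `y` has `m` inputs.
(The input `b` of `y` gets the place `i + b`.) -/
def outerPos (m i j : ℕ) : ℕ := if j < i then j else j + m - 1

/-- A (symmetric) operad in `ℤ`-graded vector spaces over `k`, in terms of partial composition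
products `∘ᵢ`, with the Koszul sign rule. Symmetric groups act on the right. -/
structure GOperad (k : Type u) [Field k] where
  X : ℕ → ℤ → Type u
  [grp : ∀ n p, AddCommGroup (X n p)]
  [mod : ∀ n p, Module k (X n p)]
  /-- `act σ x` is `x · σ`. -/
  act : ∀ {n : ℕ} {p : ℤ}, Equiv.Perm (Fin n) → X n p →ₗ[k] X n p
  /-- `comp i _ _ x y` is `x ∘ᵢ y`. -/
  comp : ∀ {l m n : ℕ} {p q r : ℤ}, Fin l → n + 1 = l + m → p + q = r →
    X l p →ₗ[k] X m q →ₗ[k] X n r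
  /-- The identity operation. -/
  one : X 1 0
  act_one : ∀ {n : ℕ} {p : ℤ} (x : X n p), act 1 x = x
  act_mul : ∀ {n : ℕ} {p : ℤ} (σ τ : Equiv.Perm (Fin n)) (x : X n p),
    act (σ * τ) x = act τ (act σ x)
  /-- `(x · σ) ∘ᵢ (y · τ) = (x ∘_{σ i} y) · ρ`, where `ρ` is the permutation of the inputs of the
  composite that permutes the inputs of `x` by `σ` and those of `y` by `τ`. -/
  comp_act : ∀ {l m n : ℕ} {p q r : ℤ} (i : Fin l) (hn : n + 1 = l + m) (hr : p + q = r)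
    (σ : Equiv.Perm (Fin l)) (τ : Equiv.Perm (Fin m)) (ρ : Equiv.Perm (Fin n)),
    (∀ (j : Fin l) (a : Fin n), j ≠ i → (a : ℕ) = outerPos m i j →
      (ρ a : ℕ) = outerPos m (σ i) (σ j)) →
    (∀ (b : Fin m) (a : Fin n), (a : ℕ) = i + b → (ρ a : ℕ) = σ i + τ b) →
    ∀ (x : X l p) (y : X m q),
      comp i hn hr (act σ x) (act τ y) = act ρ (comp (σ i) hn hr x y)
  comp_one : ∀ {n : ℕ} {p : ℤ} (i : Fin n) (hn : n + 1 = n + 1) (hp : p + 0 = p) (x : X n p),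
    comp i hn hp x one = x
  one_comp : ∀ {n : ℕ} {p : ℤ} (i : Fin 1) (hn : n + 1 = 1 + n) (hp : 0 + p = p) (x : X n p),
    comp i hn hp one x = x
  /-- `(x ∘ᵢ y) ∘_{i + j} z = x ∘ᵢ (y ∘ⱼ z)`. -/
  assoc_seq : ∀ {l m n u v w : ℕ} {p q r a b c : ℤ} (i : Fin l) (j : Fin m) (t : Fin u)
    (hu : u + 1 = l + m) (hw : w + 1 = u + n) (hv : v + 1 = m + n) (hw' : w + 1 = l + v)
    (ha : p + q = a) (hc : a + r = c) (hb : q + r = b) (hc' : p + b = c),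
    (t : ℕ) = i + j → ∀ (x : X l p) (y : X m q) (z : X n r),
      comp t hw hc (comp i hu ha x y) z = comp i hw' hc' x (comp j hv hb y z)
  /-- `(x ∘ᵢ y) ∘_{j + m - 1} z = (-1)^{|y| |z|} (x ∘ⱼ z) ∘ᵢ y` for `i < j`, where `y` has `m`
  inputs. -/
  assoc_par : ∀ {l m n u v w : ℕ} {p q r a b c : ℤ} (i j : Fin l) (t : Fin u) (s : Fin v)
    (hu : u + 1 = l + m) (hw : w + 1 = u + n) (hv : v + 1 = l + n) (hw' : w + 1 = v + m)
    (ha : p + q = a) (hc : a + r = c) (hb : p + r = b) (hc' : b + q = c),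
    i < j → (t : ℕ) + 1 = j + m → (s : ℕ) = i → ∀ (x : X l p) (y : X m q) (z : X n r),
      comp t hw hc (comp i hu ha x y) z
        = (q * r).negOnePow • comp s hw' hc' (comp j hv hb x z) y

attribute [instance] GOperad.grp GOperad.mod

/-- A dg operad over `k`: an operad in cochain complexes (differential of degree `+1`). -/
structure DGOperad (k : Type u) [Field k] extends GOperad k where
  d : ∀ {n : ℕ} {p q : ℤ}, p + 1 = q → X n p →ₗ[k] X n q
  d_d : ∀ {n : ℕ} {p q r : ℤ} (h : p + 1 = q) (h' : q + 1 = r) (x : X n p), d h' (d h x) = 0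
  d_act : ∀ {n : ℕ} {p q : ℤ} (h : p + 1 = q) (σ : Equiv.Perm (Fin n)) (x : X n p),
    d h (act σ x) = act σ (d h x)
  d_one : ∀ {q : ℤ} (h : 0 + 1 = q), d h one = 0
  /-- `∂(x ∘ᵢ y) = ∂x ∘ᵢ y + (-1)^{|x|} x ∘ᵢ ∂y`. -/
  d_comp : ∀ {l m n : ℕ} {p q r p' q' r' : ℤ} (i : Fin l) (hn : n + 1 = l + m)
    (hr : p + q = r) (hp' : p + 1 = p') (hq' : q + 1 = q') (hr' : r + 1 = r')
    (h₁ : p' + q = r') (h₂ : p + q' = r') (x : X l p) (y : X m q),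
    d hr' (comp i hn hr x y)
      = comp i hn h₁ (d hp' x) y + p.negOnePow • comp i hn h₂ x (d hq' y)

/-- A dg operad with a distinguished nullary operation `1 ∈ P(0)`, a cocycle of degree `0`.
`P(0)` is not required to be one-dimensional; see `UDGOperad.IsUnitary`. -/
structure UDGOperad (k : Type u) [Field k] extends DGOperad k where
  pt : X 0 0
  d_pt : ∀ {q : ℤ} (h : 0 + 1 = q), d h pt = 0

/-! ## Morphisms -/

/-- Morphisms of graded operads (of degree `0`). -/
@[ext]
structure GHom {k : Type u} [Field k] (P Q : GOperad k) where
  toFun : ∀ (n : ℕ) (p : ℤ), P.X n p →ₗ[k] Q.X n p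
  map_act : ∀ {n : ℕ} {p : ℤ} (σ : Equiv.Perm (Fin n)) (x : P.X n p),
    toFun n p (P.act σ x) = Q.act σ (toFun n p x)
  map_one : toFun 1 0 P.one = Q.one
  map_comp : ∀ {l m n : ℕ} {p q r : ℤ} (i : Fin l) (hn : n + 1 = l + m) (hr : p + q = r)
    (x : P.X l p) (y : P.X m q),
    toFun n r (P.comp i hn hr x y) = Q.comp i hn hr (toFun l p x) (toFun m q y)

/-- Morphisms of dg operads. -/
@[ext]
structure DGHom {k : Type u} [Field k] (P Q : DGOperad k) extends
    GHom P.toGOperad Q.toGOperad where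
  map_d : ∀ {n : ℕ} {p q : ℤ} (h : p + 1 = q) (x : P.X n p),
    toFun n q (P.d h x) = Q.d h (toFun n p x)

/-- Morphisms of dg operads preserving the distinguished nullary operations. -/
@[ext]
structure UHom {k : Type u} [Field k] (P Q : UDGOperad k) extends
    DGHom P.toDGOperad Q.toDGOperad where
  map_pt : toFun 0 0 P.pt = Q.pt

section Hom

variable {k : Type u} [Field k]

/-- Composition `g ∘ f` of morphisms of graded operads. -/
def GHom.comp {P Q R : GOperad k} (g : GHom Q R) (f : GHom P Q) : GHom P R where
  toFun n p := g.toFun n p ∘ₗ f.toFun n p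
  map_act σ x := by simp [f.map_act, g.map_act]
  map_one := by simp [f.map_one, g.map_one]
  map_comp i hn hr x y := by simp [f.map_comp, g.map_comp]

/-- Composition `g ∘ f` of morphisms of dg operads. -/
def DGHom.comp {P Q R : DGOperad k} (g : DGHom Q R) (f : DGHom P Q) : DGHom P R where
  toGHom := g.toGHom.comp f.toGHom
  map_d h x := by simp [GHom.comp, f.map_d, g.map_d]

/-- Composition `g ∘ f` of unit-preserving morphisms. -/
def UHom.comp {P Q R : UDGOperad k} (g : UHom Q R) (f : UHom P Q) : UHom P R where
  toDGHom := g.toDGHom.comp f.toDGHom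
  map_pt := by simp [DGHom.comp, GHom.comp, f.map_pt, g.map_pt]

/-- The identity morphism of a graded operad. -/
def GHom.id (P : GOperad k) : GHom P P where
  toFun _ _ := LinearMap.id
  map_act _ _ := rfl
  map_one := rfl
  map_comp _ _ _ _ _ := rfl

/-- The identity morphism of a dg operad. -/
def DGHom.id (P : DGOperad k) : DGHom P P where
  toGHom := GHom.id P.toGOperad
  map_d _ _ := rfl

/-- The identity morphism of a dg operad with distinguished nullary operation. -/
def UHom.id (P : UDGOperad k) : UHom P P where
  toDGHom := DGHom.id P.toDGOperad
  map_pt := rfl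

/-- Isomorphisms of dg operads. -/
def DGHom.IsIso {P Q : DGOperad k} (f : DGHom P Q) : Prop :=
  ∃ g : DGHom Q P, g.comp f = DGHom.id P ∧ f.comp g = DGHom.id Q

/-- Isomorphisms of dg operads with distinguished nullary operation. -/
def UHom.IsIso {P Q : UDGOperad k} (f : UHom P Q) : Prop :=
  ∃ g : UHom Q P, g.comp f = UHom.id P ∧ f.comp g = UHom.id Q

/-! ## Cohomology and quasi-isomorphisms -/

/-- The cocycles of `P(n)` in degree `p`. -/
def DGOperad.cocycles (P : DGOperad k) (n : ℕ) (p : ℤ) : Submodule k (P.X n p) :=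
  LinearMap.ker (P.d (n := n) (p := p) rfl)

/-- The coboundaries of `P(n)` in degree `p`. -/
def DGOperad.coboundaries (P : DGOperad k) (n : ℕ) (p : ℤ) : Submodule k (P.X n p) :=
  LinearMap.range (P.d (n := n) (sub_add_cancel p 1))

/-- The cohomology of `P(n)` in degree `p`. -/
abbrev DGOperad.H (P : DGOperad k) (n : ℕ) (p : ℤ) : Type u :=
  P.cocycles n p ⧸ (P.coboundaries n p).comap (P.cocycles n p).subtype

/-- The map induced on cocycles. -/
def DGHom.mapCocycles {P Q : DGOperad k} (f : DGHom P Q) (n : ℕ) (p : ℤ) :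
    P.cocycles n p →ₗ[k] Q.cocycles n p :=
  (f.toFun n p).restrict fun x hx => by
    have hx' : P.d (n := n) rfl x = 0 := hx
    change Q.d rfl (f.toFun n p x) = 0
    rw [← f.map_d, hx', map_zero]

/-- The map induced on cohomology. -/
def DGHom.mapH {P Q : DGOperad k} (f : DGHom P Q) (n : ℕ) (p : ℤ) : P.H n p →ₗ[k] Q.H n p :=
  Submodule.mapQ _ _ (f.mapCocycles n p) fun x hx => by
    obtain ⟨y, hy⟩ := hx
    exact ⟨f.toFun n _ y, by rw [← f.map_d, hy]; rfl⟩

/-- Quasi-isomorphisms of dg operads. -/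
def DGHom.IsQuis {P Q : DGOperad k} (f : DGHom P Q) : Prop :=
  ∀ (n : ℕ) (p : ℤ), Function.Bijective (f.mapH n p)

end Hom

/-! ## The path operad `P[t,dt] = P ⊗ k[t,dt]` and homotopies -/

section Path

variable {k : Type u} [Field k]

/-- The identification of `P(n)` in degree `p` with `P(n)` in degree `q` when `p = q`. -/
def GOperad.castDeg (P : GOperad k) {n : ℕ} {p q : ℤ} (h : p = q) : P.X n p →ₗ[k] P.X n q :=
  h ▸ LinearMap.id

/-- The bilinear extension of `∘ᵢ` to polynomials with coefficients in `P`: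
`(x ⊗ f) ∘ᵢ (y ⊗ g) = (x ∘ᵢ y) ⊗ f g`. -/
def GOperad.tcomp (P : GOperad k) {l m n : ℕ} {p q r : ℤ} (i : Fin l) (hn : n + 1 = l + m)
    (hr : p + q = r) :
    P.X l p ⊗[k] k[X] →ₗ[k] P.X m q ⊗[k] k[X] →ₗ[k] P.X n r ⊗[k] k[X] :=
  TensorProduct.map₂ (P.comp i hn hr) (LinearMap.mul k k[X])

@[simp]
theorem GOperad.tcomp_tmul (P : GOperad k) {l m n : ℕ} {p q r : ℤ} (i : Fin l)
    (hn : n + 1 = l + m) (hr : p + q = r) (x : P.X l p) (y : P.X m q) (f g : k[X]) :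
    P.tcomp i hn hr (x ⊗ₜ f) (y ⊗ₜ g) = P.comp i hn hr x y ⊗ₜ (f * g) := by
  simp [GOperad.tcomp]

theorem GOperad.tcomp_seq (P : GOperad k) {l m n u v w : ℕ} {p q r a b c : ℤ} (i : Fin l)
    (j : Fin m) (t : Fin u)
    (hu : u + 1 = l + m) (hw : w + 1 = u + n) (hv : v + 1 = m + n) (hw' : w + 1 = l + v)
    (ha : p + q = a) (hc : a + r = c) (hb : q + r = b) (hc' : p + b = c)
    (ht : (t : ℕ) = i + j) (x : P.X l p ⊗[k] k[X]) (y : P.X m q ⊗[k] k[X])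
    (z : P.X n r ⊗[k] k[X]) :
    P.tcomp t hw hc (P.tcomp i hu ha x y) z = P.tcomp i hw' hc' x (P.tcomp j hv hb y z) := by
  induction x with
  | zero => simp
  | add x₁ x₂ h₁ h₂ => simp only [map_add, LinearMap.add_apply, h₁, h₂]
  | tmul x f =>
    induction y with
    | zero => simp
    | add y₁ y₂ h₁ h₂ => simp only [map_add, LinearMap.add_apply, h₁, h₂]
    | tmul y g =>
      induction z with
      | zero => simp
      | add z₁ z₂ h₁ h₂ => simp only [map_add, h₁, h₂]
      | tmul z h =>
        simp [P.assoc_seq i j t hu hw hv hw' ha hc hb hc' ht, mul_assoc]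

theorem GOperad.tcomp_par (P : GOperad k) {l m n u v w : ℕ} {p q r a b c : ℤ} (i j : Fin l)
    (t : Fin u) (s : Fin v)
    (hu : u + 1 = l + m) (hw : w + 1 = u + n) (hv : v + 1 = l + n) (hw' : w + 1 = v + m)
    (ha : p + q = a) (hc : a + r = c) (hb : p + r = b) (hc' : b + q = c)
    (hij : i < j) (ht : (t : ℕ) + 1 = j + m) (hs : (s : ℕ) = i)
    (x : P.X l p ⊗[k] k[X]) (y : P.X m q ⊗[k] k[X]) (z : P.X n r ⊗[k] k[X]) :
    P.tcomp t hw hc (P.tcomp i hu ha x y) z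
      = (q * r).negOnePow • P.tcomp s hw' hc' (P.tcomp j hv hb x z) y := by
  induction x with
  | zero => simp
  | add x₁ x₂ h₁ h₂ => simp only [map_add, LinearMap.add_apply, smul_add, h₁, h₂]
  | tmul x f =>
    induction y with
    | zero => simp
    | add y₁ y₂ h₁ h₂ => simp only [map_add, LinearMap.add_apply, smul_add, h₁, h₂]
    | tmul y g =>
      induction z with
      | zero => simp
      | add z₁ z₂ h₁ h₂ => simp only [map_add, LinearMap.add_apply, smul_add, h₁, h₂]
      | tmul z h =>
        simp only [GOperad.tcomp_tmul,
          P.assoc_par i j t s hu hw hv hw' ha hc hb hc' hij ht hs, mul_right_comm f g h]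
        rcases Int.even_or_odd (q * r) with e | e <;>
          simp [Int.negOnePow_even _, Int.negOnePow_odd _, e, TensorProduct.neg_tmul]

theorem GOperad.tcomp_act (P : GOperad k) {l m n : ℕ} {p q r : ℤ} (i : Fin l)
    (hn : n + 1 = l + m) (hr : p + q = r)
    (σ : Equiv.Perm (Fin l)) (τ : Equiv.Perm (Fin m)) (ρ : Equiv.Perm (Fin n))
    (h₁ : ∀ (j : Fin l) (a : Fin n), j ≠ i → (a : ℕ) = outerPos m i j →
      (ρ a : ℕ) = outerPos m (σ i) (σ j))
    (h₂ : ∀ (b : Fin m) (a : Fin n), (a : ℕ) = i + b → (ρ a : ℕ) = σ i + τ b)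
    (x : P.X l p ⊗[k] k[X]) (y : P.X m q ⊗[k] k[X]) :
    P.tcomp i hn hr ((P.act σ).rTensor k[X] x) ((P.act τ).rTensor k[X] y)
      = (P.act ρ).rTensor k[X] (P.tcomp (σ i) hn hr x y) := by
  induction x with
  | zero => simp
  | add x₁ x₂ h₁ h₂ => simp only [map_add, LinearMap.add_apply, h₁, h₂]
  | tmul x f =>
    induction y with
    | zero => simp
    | add y₁ y₂ h₁ h₂ => simp only [map_add, h₁, h₂]
    | tmul y g => simp [P.comp_act i hn hr σ τ ρ h₁ h₂]

theorem GOperad.tcomp_one (P : GOperad k) {n : ℕ} {p : ℤ} (i : Fin n) (hn : n + 1 = n + 1)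
    (hp : p + 0 = p) (x : P.X n p ⊗[k] k[X]) : P.tcomp i hn hp x (P.one ⊗ₜ 1) = x := by
  induction x with
  | zero => simp
  | add x₁ x₂ h₁ h₂ => simp only [map_add, LinearMap.add_apply, h₁, h₂]
  | tmul x f => simp [P.comp_one]

theorem GOperad.one_tcomp (P : GOperad k) {n : ℕ} {p : ℤ} (i : Fin 1) (hn : n + 1 = 1 + n)
    (hp : 0 + p = p) (x : P.X n p ⊗[k] k[X]) : P.tcomp i hn hp (P.one ⊗ₜ 1) x = x := by
  induction x with
  | zero => simp
  | add x₁ x₂ h₁ h₂ => simp only [map_add, h₁, h₂]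
  | tmul x f => simp [P.one_comp]

theorem map_sign_smul {M N : Type*} [AddCommGroup M] [AddCommGroup N] [Module k M] [Module k N]
    (f : M →ₗ[k] N) (e : ℤˣ) (x : M) : f (e • x) = e • f x := by
  simp [Units.smul_def]

theorem sign_smul_apply {M N : Type*} [AddCommGroup M] [AddCommGroup N] [Module k M] [Module k N]
    (f : M →ₗ[k] N) (e : ℤˣ) (x : M) : (e • f) x = e • f x := by
  simp [Units.smul_def]

/-- The composition product of `P[t,dt]`, see `GOperad.path`. -/
def GOperad.pathComp (P : GOperad k) {l m n : ℕ} {p q r : ℤ} (i : Fin l) (hn : n + 1 = l + m)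
    (hr : p + q = r) :
    (P.X l p ⊗[k] k[X]) × (P.X l (p - 1) ⊗[k] k[X]) →ₗ[k]
      (P.X m q ⊗[k] k[X]) × (P.X m (q - 1) ⊗[k] k[X]) →ₗ[k]
        (P.X n r ⊗[k] k[X]) × (P.X n (r - 1) ⊗[k] k[X]) :=
  LinearMap.mk₂ k
    (fun x y => (P.tcomp i hn hr x.1 y.1,
      P.tcomp i hn (by omega) x.1 y.2 + q.negOnePow • P.tcomp i hn (by omega) x.2 y.1))
    (fun x x' y => by
      ext1
      · simp
      · simp; abel)
    (fun c x y => by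
      ext1 <;> simp [smul_comm c])
    (fun x y y' => by
      ext1
      · simp
      · simp; abel)
    (fun c x y => by
      ext1 <;> simp [smul_comm c])

theorem GOperad.pathComp_fst (P : GOperad k) {l m n : ℕ} {p q r : ℤ} (i : Fin l)
    (hn : n + 1 = l + m) (hr : p + q = r) (x : (P.X l p ⊗[k] k[X]) × (P.X l (p - 1) ⊗[k] k[X]))
    (y : (P.X m q ⊗[k] k[X]) × (P.X m (q - 1) ⊗[k] k[X])) :
    (P.pathComp i hn hr x y).1 = P.tcomp i hn hr x.1 y.1 := rfl

theorem GOperad.pathComp_snd (P : GOperad k) {l m n : ℕ} {p q r : ℤ} (i : Fin l)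
    (hn : n + 1 = l + m) (hr : p + q = r) (x : (P.X l p ⊗[k] k[X]) × (P.X l (p - 1) ⊗[k] k[X]))
    (y : (P.X m q ⊗[k] k[X]) × (P.X m (q - 1) ⊗[k] k[X])) :
    (P.pathComp i hn hr x y).2 = P.tcomp i hn (by omega) x.1 y.2
      + q.negOnePow • P.tcomp i hn (by omega) x.2 y.1 := rfl

/-- The graded operad underlying `P[t,dt] = P ⊗ k[t,dt]`. An element of arity `n` and degree `p` is
a pair `(x₁, x₂)`, standing for `x₁ + x₂ dt`, where `x₁` and `x₂` are polynomials in `t` with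
coefficients in `P(n)` in degrees `p` and `p - 1`. With the rule
`(ω ⊗ a) ∘ᵢ (η ⊗ b) = (-1)^{|a| |η|} (ω ∘ᵢ η) ⊗ a b` one has
`(x₁ + x₂ dt) ∘ᵢ (y₁ + y₂ dt) = x₁ ∘ᵢ y₁ + (x₁ ∘ᵢ y₂ + (-1)^{|y|} x₂ ∘ᵢ y₁) dt`. -/
def GOperad.path (P : GOperad k) : GOperad k where
  X n p := (P.X n p ⊗[k] k[X]) × (P.X n (p - 1) ⊗[k] k[X])
  act σ := LinearMap.prodMap ((P.act σ).rTensor k[X]) ((P.act σ).rTensor k[X])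
  comp i hn hr := P.pathComp i hn hr
  one := (P.one ⊗ₜ 1, 0)
  act_one x := by
    have h : ∀ {n : ℕ} {p : ℤ}, P.act (1 : Equiv.Perm (Fin n)) = (LinearMap.id : P.X n p →ₗ[k] _) :=
      by intro n p; ext x; exact P.act_one x
    simp [h]
  act_mul {n p} σ τ x := by
    have h : ∀ {p : ℤ}, (P.act (σ * τ) : P.X n p →ₗ[k] _) = P.act τ ∘ₗ P.act σ := by
      intro p; ext x; exact P.act_mul σ τ x
    simp [h, LinearMap.rTensor_comp]
  comp_act i hn hr σ τ ρ h₁ h₂ x y := by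
    ext1
    · exact P.tcomp_act i hn hr σ τ ρ h₁ h₂ x.1 y.1
    · simp only [pathComp_snd, LinearMap.prodMap_apply, P.tcomp_act i hn _ σ τ ρ h₁ h₂, map_add,
        map_sign_smul]
  comp_one i hn hp x := by
    ext1
    · exact P.tcomp_one i hn hp x.1
    · refine (P.pathComp_snd i hn hp x _).trans ?_
      simp [P.tcomp_one]
  one_comp i hn hp x := by
    ext1
    · exact P.one_tcomp i hn hp x.1
    · refine (P.pathComp_snd i hn hp _ x).trans ?_
      simp [P.one_tcomp]
  assoc_seq := by
    intro l m n u v w p q r a b c i j t hu hw hv hw' ha hc hb hc' ht x y z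
    ext1
    · exact P.tcomp_seq i j t hu hw hv hw' ha hc hb hc' ht x.1 y.1 z.1
    · have e₁ := P.tcomp_seq (p := p) (q := q) (r := r - 1) (a := a) (b := b - 1) (c := c - 1)
        i j t hu hw hv hw' ha (by omega) (by omega) (by omega) ht x.1 y.1 z.2
      have e₂ := P.tcomp_seq (p := p) (q := q - 1) (r := r) (a := a - 1) (b := b - 1) (c := c - 1)
        i j t hu hw hv hw' (by omega) (by omega) (by omega) (by omega) ht x.1 y.2 z.1
      have e₃ := P.tcomp_seq (p := p - 1) (q := q) (r := r) (a := a - 1) (b := b) (c := c - 1)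
        i j t hu hw hv hw' (by omega) (by omega) (by omega) (by omega) ht x.2 y.1 z.1
      simp only [pathComp_fst, pathComp_snd, map_add, LinearMap.add_apply, e₁, e₂, e₃,
        map_sign_smul, sign_smul_apply, smul_add, add_assoc]
      have eb : b.negOnePow = r.negOnePow * q.negOnePow := by
        rw [← hb, Int.negOnePow_add, mul_comm]
      rw [smul_smul, eb]
  assoc_par := by
    intro l m n u v w p q r a b c i j t s hu hw hv hw' ha hc hb hc' hij ht hs x y z
    ext1
    · rw [Prod.smul_fst]
      exact P.tcomp_par i j t s hu hw hv hw' ha hc hb hc' hij ht hs x.1 y.1 z.1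
    · have e₁ := P.tcomp_par (p := p) (q := q) (r := r - 1) (a := a) (b := b - 1) (c := c - 1)
        i j t s hu hw hv hw' ha (by omega) (by omega) (by omega) hij ht hs x.1 y.1 z.2
      have e₂ := P.tcomp_par (p := p) (q := q - 1) (r := r) (a := a - 1) (b := b) (c := c - 1)
        i j t s hu hw hv hw' (by omega) (by omega) (by omega) (by omega) hij ht hs x.1 y.2 z.1
      have e₃ := P.tcomp_par (p := p - 1) (q := q) (r := r) (a := a - 1) (b := b - 1) (c := c - 1)
        i j t s hu hw hv hw' (by omega) (by omega) (by omega) (by omega) hij ht hs x.2 y.1 z.1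
      rw [Prod.smul_snd]
      simp only [pathComp_fst, pathComp_snd, map_add, LinearMap.add_apply, e₁, e₂, e₃,
        map_sign_smul, sign_smul_apply, smul_add]
      rw [mul_sub, sub_mul, mul_one, one_mul, Int.negOnePow_sub, Int.negOnePow_sub]
      generalize (q * r).negOnePow = α
      generalize q.negOnePow = β
      generalize r.negOnePow = γ
      rcases Int.units_eq_one_or α with rfl | rfl <;> rcases Int.units_eq_one_or β with rfl | rfl <;>
        rcases Int.units_eq_one_or γ with rfl | rfl <;> simp <;> abel

/-- The differential of `P`, extended `k[t]`-linearly. -/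
def DGOperad.td (P : DGOperad k) {n : ℕ} {p q : ℤ} (h : p + 1 = q) :
    P.X n p ⊗[k] k[X] →ₗ[k] P.X n q ⊗[k] k[X] :=
  (P.d h).rTensor k[X]

/-- The derivative with respect to `t` of polynomials with coefficients in `P`. -/
def GOperad.tderiv (P : GOperad k) {n : ℕ} {p q : ℤ} (h : p = q) :
    P.X n p ⊗[k] k[X] →ₗ[k] P.X n q ⊗[k] k[X] :=
  TensorProduct.map (P.castDeg h) Polynomial.derivative

theorem DGOperad.td_tcomp (P : DGOperad k) {l m n : ℕ} {p q r p' q' r' : ℤ} (i : Fin l)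
    (hn : n + 1 = l + m) (hr : p + q = r) (hp' : p + 1 = p') (hq' : q + 1 = q')
    (hr' : r + 1 = r') (h₁ : p' + q = r') (h₂ : p + q' = r')
    (x : P.X l p ⊗[k] k[X]) (y : P.X m q ⊗[k] k[X]) :
    P.td hr' (P.tcomp i hn hr x y)
      = P.tcomp i hn h₁ (P.td hp' x) y + p.negOnePow • P.tcomp i hn h₂ x (P.td hq' y) := by
  induction x with
  | zero => simp
  | add x₁ x₂ h₁ h₂ => simp only [map_add, LinearMap.add_apply, smul_add, h₁, h₂]; abel
  | tmul x f =>
    induction y with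
    | zero => simp
    | add y₁ y₂ h₁ h₂ => simp only [map_add, smul_add, h₁, h₂]; abel
    | tmul y g =>
      simp only [DGOperad.td, GOperad.tcomp_tmul, LinearMap.rTensor_tmul,
        P.d_comp i hn hr hp' hq' hr' h₁ h₂, TensorProduct.add_tmul]
      rcases Int.even_or_odd p with e | e <;>
        simp [Int.negOnePow_even _, Int.negOnePow_odd _, e, TensorProduct.neg_tmul]

theorem GOperad.tderiv_tcomp (P : GOperad k) {l m n : ℕ} {p q r p' q' r' : ℤ} (i : Fin l)
    (hn : n + 1 = l + m) (hr : p + q = r) (hp' : p = p') (hq' : q = q')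
    (hr' : r = r') (h₁ : p' + q = r') (h₂ : p + q' = r')
    (x : P.X l p ⊗[k] k[X]) (y : P.X m q ⊗[k] k[X]) :
    P.tderiv hr' (P.tcomp i hn hr x y)
      = P.tcomp i hn h₁ (P.tderiv hp' x) y + P.tcomp i hn h₂ x (P.tderiv hq' y) := by
  subst hp' hq' hr'
  induction x with
  | zero => simp
  | add x₁ x₂ h₁ h₂ => simp only [map_add, LinearMap.add_apply, h₁, h₂]; abel
  | tmul x f =>
    induction y with
    | zero => simp
    | add y₁ y₂ h₁ h₂ => simp only [map_add, h₁, h₂]; abel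
    | tmul y g =>
      simp [GOperad.tderiv, GOperad.castDeg, Polynomial.derivative_mul, TensorProduct.tmul_add]

theorem DGOperad.td_td (P : DGOperad k) {n : ℕ} {p q r : ℤ} (h : p + 1 = q) (h' : q + 1 = r)
    (x : P.X n p ⊗[k] k[X]) : P.td h' (P.td h x) = 0 := by
  induction x with
  | zero => simp
  | add x₁ x₂ h₁ h₂ => simp only [map_add, h₁, h₂, add_zero]
  | tmul x f => simp [DGOperad.td, P.d_d]

theorem DGOperad.td_tderiv (P : DGOperad k) {n : ℕ} {p q p' q' : ℤ} (h : p + 1 = q) (hp : p = p')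
    (hq : q = q') (h' : p' + 1 = q') (x : P.X n p ⊗[k] k[X]) :
    P.td h' (P.tderiv hp x) = P.tderiv hq (P.td h x) := by
  subst hp hq
  induction x with
  | zero => simp
  | add x₁ x₂ h₁ h₂ => simp only [map_add, h₁, h₂]
  | tmul x f => simp [DGOperad.td, GOperad.tderiv, GOperad.castDeg]

theorem DGOperad.td_act (P : DGOperad k) {n : ℕ} {p q : ℤ} (h : p + 1 = q)
    (σ : Equiv.Perm (Fin n)) (x : P.X n p ⊗[k] k[X]) :
    P.td h ((P.act σ).rTensor k[X] x) = (P.act σ).rTensor k[X] (P.td h x) := by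
  induction x with
  | zero => simp
  | add x₁ x₂ h₁ h₂ => simp only [map_add, h₁, h₂]
  | tmul x f => simp [DGOperad.td, P.d_act]

theorem GOperad.tderiv_act (P : GOperad k) {n : ℕ} {p q : ℤ} (h : p = q)
    (σ : Equiv.Perm (Fin n)) (x : P.X n p ⊗[k] k[X]) :
    P.tderiv h ((P.act σ).rTensor k[X] x) = (P.act σ).rTensor k[X] (P.tderiv h x) := by
  subst h
  induction x with
  | zero => simp
  | add x₁ x₂ h₁ h₂ => simp only [map_add, h₁, h₂]
  | tmul x f => simp [GOperad.tderiv, GOperad.castDeg]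

/-- The differential of `P[t,dt]`, see `DGOperad.path`. -/
def DGOperad.pathD (P : DGOperad k) {n : ℕ} {p q : ℤ} (h : p + 1 = q) :
    (P.X n p ⊗[k] k[X]) × (P.X n (p - 1) ⊗[k] k[X]) →ₗ[k]
      (P.X n q ⊗[k] k[X]) × (P.X n (q - 1) ⊗[k] k[X]) :=
  LinearMap.prod (P.td h ∘ₗ LinearMap.fst k _ _)
    (p.negOnePow • (P.tderiv (by omega) ∘ₗ LinearMap.fst k _ _)
      + P.td (by omega) ∘ₗ LinearMap.snd k _ _)

theorem DGOperad.pathD_fst (P : DGOperad k) {n : ℕ} {p q : ℤ} (h : p + 1 = q)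
    (x : (P.X n p ⊗[k] k[X]) × (P.X n (p - 1) ⊗[k] k[X])) :
    (P.pathD h x).1 = P.td h x.1 := rfl

theorem DGOperad.pathD_snd (P : DGOperad k) {n : ℕ} {p q : ℤ} (h : p + 1 = q)
    (x : (P.X n p ⊗[k] k[X]) × (P.X n (p - 1) ⊗[k] k[X])) :
    (P.pathD h x).2 = p.negOnePow • P.tderiv (by omega) x.1 + P.td (by omega) x.2 := rfl

theorem DGOperad.pathD_pathD (P : DGOperad k) {n : ℕ} {p q r : ℤ} (h : p + 1 = q)
    (h' : q + 1 = r) (x : (P.X n p ⊗[k] k[X]) × (P.X n (p - 1) ⊗[k] k[X])) :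
    P.pathD h' (P.pathD h x) = 0 := by
  refine Prod.ext (P.td_td h h' x.1) ?_
  have s₁ : q.negOnePow = -p.negOnePow := by rw [← h, Int.negOnePow_succ]
  rw [pathD_snd, pathD_fst, pathD_snd, map_add, map_sign_smul, P.td_td,
    P.td_tderiv h (by omega) (show q = r - 1 by omega), s₁]
  simp

theorem DGOperad.pathD_act (P : DGOperad k) {n : ℕ} {p q : ℤ} (h : p + 1 = q)
    (σ : Equiv.Perm (Fin n)) (x : (P.X n p ⊗[k] k[X]) × (P.X n (p - 1) ⊗[k] k[X])) :
    P.pathD h (LinearMap.prodMap ((P.act σ).rTensor k[X]) ((P.act σ).rTensor k[X]) x)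
      = LinearMap.prodMap ((P.act σ).rTensor k[X]) ((P.act σ).rTensor k[X]) (P.pathD h x) := by
  refine Prod.ext (P.td_act h σ x.1) ?_
  simp only [pathD_snd, LinearMap.prodMap_apply, P.td_act, P.tderiv_act, map_add, map_sign_smul]

theorem DGOperad.pathD_one (P : DGOperad k) {q : ℤ} (h : 0 + 1 = q) {n : ℕ} (x : P.X n 0)
    (hx : P.d h x = 0) : P.pathD h (x ⊗ₜ 1, 0) = 0 := by
  refine Prod.ext ?_ ?_
  · rw [pathD_fst]
    simp [td, hx]
  · rw [pathD_snd]
    simp [GOperad.tderiv]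

theorem DGOperad.pathD_pathComp (P : DGOperad k) {l m n : ℕ} {p q r p' q' r' : ℤ} (i : Fin l)
    (hn : n + 1 = l + m) (hr : p + q = r) (hp' : p + 1 = p') (hq' : q + 1 = q')
    (hr' : r + 1 = r') (h₁ : p' + q = r') (h₂ : p + q' = r')
    (x : (P.X l p ⊗[k] k[X]) × (P.X l (p - 1) ⊗[k] k[X]))
    (y : (P.X m q ⊗[k] k[X]) × (P.X m (q - 1) ⊗[k] k[X])) :
    P.pathD hr' (P.pathComp i hn hr x y) = P.pathComp i hn h₁ (P.pathD hp' x) y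
      + p.negOnePow • P.pathComp i hn h₂ x (P.pathD hq' y) := by
  refine Prod.ext (P.td_tcomp i hn hr hp' hq' hr' h₁ h₂ x.1 y.1) ?_
  rw [Prod.snd_add, Prod.smul_snd]
  have e₁ := P.tderiv_tcomp (p' := p' - 1) (q' := q' - 1) (r' := r' - 1) i hn hr (by omega)
    (by omega) (by omega) (by omega) (by omega) x.1 y.1
  have e₂ := P.td_tcomp (q := q - 1) (q' := q' - 1) (r := r - 1) (r' := r' - 1) i hn (by omega)
    hp' (by omega) (by omega) (by omega) (by omega) x.1 y.2
  have e₃ := P.td_tcomp (p := p - 1) (p' := p' - 1) (r := r - 1) (r' := r' - 1) i hn (by omega)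
    (by omega) hq' (by omega) (by omega) (by omega) x.2 y.1
  have s₁ : r.negOnePow = p.negOnePow * q.negOnePow := by rw [← hr, Int.negOnePow_add]
  have s₂ : q'.negOnePow = -q.negOnePow := by rw [← hq', Int.negOnePow_succ]
  have s₃ : (p - 1).negOnePow = -p.negOnePow := by
    rw [Int.negOnePow_sub]; simp
  simp only [P.pathComp_fst, P.pathComp_snd, pathD_fst, pathD_snd, map_add, map_sign_smul,
    LinearMap.add_apply, sign_smul_apply, e₁, e₂, e₃, s₁, s₂, s₃]
  generalize p.negOnePow = α
  generalize q.negOnePow = β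
  rcases Int.units_eq_one_or α with rfl | rfl <;>
    rcases Int.units_eq_one_or β with rfl | rfl <;> simp <;> abel

/-- The path operad `P[t,dt] = P ⊗ k[t,dt]`, with
`∂(x₁ + x₂ dt) = ∂x₁ + ((-1)^{|x₁|} dx₁/dt + ∂x₂) dt`. -/
def DGOperad.path (P : DGOperad k) : DGOperad k where
  toGOperad := P.toGOperad.path
  d h := P.pathD h
  d_d h h' x := P.pathD_pathD h h' x
  d_act h σ x := P.pathD_act h σ x
  d_one h := P.pathD_one h P.one (P.d_one h)
  d_comp i hn hr hp' hq' hr' h₁ h₂ x y := P.pathD_pathComp i hn hr hp' hq' hr' h₁ h₂ x y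

/-- The path operad of a dg operad with distinguished nullary operation `1`, with distinguished
nullary operation `1 ⊗ 1`. -/
def UDGOperad.path (P : UDGOperad k) : UDGOperad k where
  toDGOperad := P.toDGOperad.path
  pt := (P.pt ⊗ₜ 1, 0)
  d_pt h := P.pathD_one h P.pt (P.d_pt h)

/-- Evaluation at `t = c` of polynomials with coefficients in `M`. -/
def evalPoly (M : Type u) [AddCommGroup M] [Module k M] (c : k) : M ⊗[k] k[X] →ₗ[k] M :=
  (TensorProduct.rid k M).toLinearMap ∘ₗ (Polynomial.leval c).lTensor M

@[simp]
theorem evalPoly_tmul {M : Type u} [AddCommGroup M] [Module k M] (c : k) (x : M) (f : k[X]) :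
    evalPoly M c (x ⊗ₜ f) = f.eval c • x := by
  simp [evalPoly]

/-- The evaluation `P[t,dt] → P` at `t = c`, `dt = 0`. -/
def DGOperad.ev (P : DGOperad k) (c : k) : DGHom P.path P where
  toFun n p := evalPoly (P.X n p) c ∘ₗ LinearMap.fst k _ _
  map_act {n p} σ x := by
    change evalPoly _ c ((P.act σ).rTensor k[X] x.1) = P.act σ (evalPoly _ c x.1)
    generalize x.1 = y
    induction y with
    | zero => simp
    | add x₁ x₂ h₁ h₂ => simp only [map_add, h₁, h₂]
    | tmul x f => simp
  map_one := by
    change evalPoly _ c (P.one ⊗ₜ 1) = P.one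
    simp
  map_comp {l m n p q r} i hn hr x y := by
    change evalPoly _ c (P.tcomp i hn hr x.1 y.1)
      = P.comp i hn hr (evalPoly _ c x.1) (evalPoly _ c y.1)
    generalize x.1 = x
    generalize y.1 = y
    induction x with
    | zero => simp
    | add x₁ x₂ h₁ h₂ => simp only [map_add, LinearMap.add_apply, h₁, h₂]
    | tmul x f =>
      induction y with
      | zero => simp
      | add y₁ y₂ h₁ h₂ => simp only [map_add, h₁, h₂]
      | tmul y g => simp [smul_smul, mul_comm]
  map_d {n p q} h x := by
    change evalPoly _ c (P.td h x.1) = P.d h (evalPoly _ c x.1)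
    generalize x.1 = y
    induction y with
    | zero => simp
    | add x₁ x₂ h₁ h₂ => simp only [map_add, h₁, h₂]
    | tmul x f => simp [DGOperad.td]

/-- The evaluation `P[t,dt] → P` at `t = c`, `dt = 0`, for operads with distinguished nullary
operation. -/
def UDGOperad.ev (P : UDGOperad k) (c : k) : UHom P.path P where
  toDGHom := P.toDGOperad.ev c
  map_pt := by
    change evalPoly _ c (P.pt ⊗ₜ 1) = P.pt
    simp

/-- `f ≃ g`: there is a homotopy from `f` to `g`, that is, a morphism of dg operads
`H : P → Q[t,dt]` with `δ⁰ H = f` and `δ¹ H = g`, where `δᶜ` is the evaluation at `t = c`. -/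
def DGHom.Homotopic {P Q : DGOperad k} (f g : DGHom P Q) : Prop :=
  ∃ H : DGHom P Q.path, (Q.ev 0).comp H = f ∧ (Q.ev 1).comp H = g

/-- `f ≃ g` for unit-preserving morphisms; the homotopy `P → Q[t,dt]` preserves the units, too. -/
def UHom.Homotopic {P Q : UDGOperad k} (f g : UHom P Q) : Prop :=
  ∃ H : UHom P Q.path, (Q.ev 0).comp H = f ∧ (Q.ev 1).comp H = g

end Path

/-! ## Free extensions of graded operads -/

section Free

variable {k : Type u} [Field k]

/-- A graded `Σₙ`-module: a `ℤ`-graded vector space with a right action of the symmetric group. -/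
structure GRep (k : Type u) [Field k] (n : ℕ) where
  X : ℤ → Type u
  [grp : ∀ p, AddCommGroup (X p)]
  [mod : ∀ p, Module k (X p)]
  act : ∀ {p : ℤ}, Equiv.Perm (Fin n) → X p →ₗ[k] X p
  act_one : ∀ {p : ℤ} (x : X p), act 1 x = x
  act_mul : ∀ {p : ℤ} (σ τ : Equiv.Perm (Fin n)) (x : X p), act (σ * τ) x = act τ (act σ x)

attribute [instance] GRep.grp GRep.mod

/-- Morphisms of graded `Σₙ`-modules `E → Q(n)`, of degree `0`. -/
@[ext]
structure GenMap {n : ℕ} (E : GRep k n) (Q : GOperad k) where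
  toFun : ∀ p : ℤ, E.X p →ₗ[k] Q.X n p
  map_act : ∀ {p : ℤ} (σ : Equiv.Perm (Fin n)) (e : E.X p),
    toFun p (E.act σ e) = Q.act σ (toFun p e)

/-- The restriction `E → P'(n) → Q(n)` of a morphism `ψ : P' → Q` of graded operads. -/
def GHom.restrict {n : ℕ} {E : GRep k n} {P' Q : GOperad k} (ψ : GHom P' Q) (j : GenMap E P') :
    GenMap E Q where
  toFun p := ψ.toFun n p ∘ₗ j.toFun p
  map_act σ e := by simp [j.map_act, ψ.map_act]

/-- `P' = P ⊔ Γ(E)` as a graded operad, via `ι : P → P'` and `j : E → P'(n)`, where `Γ(E)` is the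
free operad on the graded `Σₙ`-module `E`, put in arity `n`: morphisms `P' → Q` are the same as
pairs of a morphism `P → Q` and a morphism of graded `Σₙ`-modules `E → Q(n)`.
If `P = Γ(M)` is free, this says that `P' = Γ(M ⊕ E)`. -/
def IsFreeExtension {n : ℕ} {E : GRep k n} {P P' : GOperad k} (ι : GHom P P')
    (j : GenMap E P') : Prop :=
  ∀ (Q : GOperad.{u} k) (φ : GHom P Q) (f : GenMap E Q),
    ∃! ψ : GHom P' Q, ψ.comp ι = φ ∧ ψ.restrict j = f

end Free

/-! ## The truncation of an operad -/

section Trunc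

variable {k : Type u} [Field k]

/-- The subspace of `P(n)` that is zero for `n = 0`, and everything for `n > 0`. -/
def GOperad.truncSub (P : GOperad k) (n : ℕ) (p : ℤ) : Submodule k (P.X n p) where
  carrier := {x | n = 0 → x = 0}
  add_mem' hx hy h := by rw [hx h, hy h, add_zero]
  zero_mem' _ := rfl
  smul_mem' c x hx h := by rw [hx h, smul_zero]

theorem GOperad.comp_mem_truncSub (P : GOperad k) {l m n : ℕ} {p q r : ℤ} (i : Fin l)
    (hn : n + 1 = l + m) (hr : p + q = r) (x : P.truncSub l p) (y : P.truncSub m q) :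
    P.comp i hn hr x y ∈ P.truncSub n r := by
  intro h
  have hm : m = 0 := by have := i.2; omega
  rw [y.2 hm, map_zero]

/-- The truncation `τP`: the non-unitary graded operad with `τP(0) = 0` and `τP(n) = P(n)` for
`n > 0`, with the composition products of `P`. -/
def GOperad.trunc (P : GOperad k) : GOperad k where
  X n p := P.truncSub n p
  act σ := (P.act σ).restrict fun x hx h => by rw [hx h, map_zero]
  comp i hn hr := LinearMap.mk₂ k
    (fun x y => ⟨P.comp i hn hr x y, P.comp_mem_truncSub i hn hr x y⟩)
    (fun _ _ _ => Subtype.ext (by simp))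
    (fun _ _ _ => Subtype.ext (by simp))
    (fun _ _ _ => Subtype.ext (by simp))
    (fun _ _ _ => Subtype.ext (by simp))
  one := ⟨P.one, fun h => absurd h one_ne_zero⟩
  act_one x := Subtype.ext (P.act_one x.1)
  act_mul σ τ x := Subtype.ext (P.act_mul σ τ x.1)
  comp_act i hn hr σ τ ρ h₁ h₂ x y := Subtype.ext (P.comp_act i hn hr σ τ ρ h₁ h₂ x.1 y.1)
  comp_one i hn hp x := Subtype.ext (P.comp_one i hn hp x.1)
  one_comp i hn hp x := Subtype.ext (P.one_comp i hn hp x.1)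
  assoc_seq i j t hu hw hv hw' ha hc hb hc' ht x y z :=
    Subtype.ext (P.assoc_seq i j t hu hw hv hw' ha hc hb hc' ht x.1 y.1 z.1)
  assoc_par i j t s hu hw hv hw' ha hc hb hc' hij ht hs x y z :=
    Subtype.ext ((P.assoc_par i j t s hu hw hv hw' ha hc hb hc' hij ht hs x.1 y.1 z.1).trans
      (by simp [Units.smul_def]))

/-- The morphism `τf : τP → τQ` induced by `f : P → Q`. -/
def GHom.trunc {P Q : GOperad k} (f : GHom P Q) : GHom P.trunc Q.trunc where
  toFun n p := (f.toFun n p).restrict fun x hx h => by rw [hx h, map_zero]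
  map_act σ x := Subtype.ext (f.map_act σ x.1)
  map_one := Subtype.ext f.map_one
  map_comp i hn hr x y := Subtype.ext (f.map_comp i hn hr x.1 y.1)

/-- A morphism `E → P(n)`, with `n > 0`, regarded as a morphism `E → τP(n)`. -/
def GenMap.trunc {n : ℕ} {E : GRep k n} {P : GOperad k} (j : GenMap E P) (hn : n ≠ 0) :
    GenMap E P.trunc where
  toFun p := (j.toFun p).codRestrict _ fun _ h => absurd h hn
  map_act σ e := Subtype.ext (j.map_act σ e)

end Trunc

/-! ## Principal extensions and Sullivan minimal operads -/

section Sullivan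

variable {k : Type u} [Field k]

/-- `P'` is an arity `n` principal extension `P ⊔_d Γ(E)` of the dg operad `P` (non-unitary
case). -/
structure PrincipalExtension (n : ℕ) (P P' : DGOperad k) where
  two_le : 2 ≤ n
  E : GRep k n
  ι : DGHom P P'
  /-- The inclusion of the generators. -/
  inc : GenMap E P'.toGOperad
  free : IsFreeExtension ι.toGHom inc
  /-- The map `d : E → ZP(n)` of degree `+1`. -/
  attach : ∀ {p q : ℤ}, p + 1 = q → E.X p →ₗ[k] P.X n q
  attach_act : ∀ {p q : ℤ} (h : p + 1 = q) (σ : Equiv.Perm (Fin n)) (e : E.X p),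
    attach h (E.act σ e) = P.act σ (attach h e)
  d_attach : ∀ {p q r : ℤ} (h : p + 1 = q) (h' : q + 1 = r) (e : E.X p), P.d h' (attach h e) = 0
  /-- On `E`, the differential of `P'` is `d`. -/
  d_inc : ∀ {p q : ℤ} (h : p + 1 = q) (e : E.X p),
    P'.d h (inc.toFun p e) = ι.toFun n q (attach h e)

/-- The restriction operation (face map) `δᵢ x = x ∘ᵢ 1 ∈ P(n)`, for `x ∈ P(n + 1)`. -/
def UDGOperad.face (P : UDGOperad k) {n m : ℕ} {p : ℤ} (i : Fin n) (h : m + 1 = n) :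
    P.X n p →ₗ[k] P.X m p :=
  (P.comp i (h.trans (add_zero n).symm) (add_zero p)).flip P.pt

/-- `P` is unitary: `P(0) = k`, spanned by the distinguished nullary operation `1`. -/
def UDGOperad.IsUnitary (P : UDGOperad k) : Prop :=
  Function.Bijective (fun c : k => c • P.pt) ∧ ∀ p : ℤ, p ≠ 0 → Subsingleton (P.X 0 p)

/-- `P'` is a unitary arity `n` principal extension `P ⊔_d^δ Γ(E)` of the unitary dg operad `P`:
it is unitary and, in positive arities, obtained from `P` by freely adding the generators `E`, with
prescribed differential `d` and prescribed restriction operations `δᵢ` on `E`. (As `ι` is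
injective, the relations between `d`, the `δᵢ`, the `Λ`-structure of `P` and the action of the
symmetric group that the prescribed data have to satisfy hold because they hold in `P'`.) -/
structure UnitaryPrincipalExtension (n : ℕ) (P P' : UDGOperad k) where
  two_le : 2 ≤ n
  E : GRep k n
  ι : UHom P P'
  unitary : P'.IsUnitary
  /-- The inclusion of the generators. -/
  inc : GenMap E P'.toGOperad
  free : IsFreeExtension ι.toGHom.trunc (inc.trunc (by omega))
  /-- The map `d : E → ZP(n)` of degree `+1`. -/
  attach : ∀ {p q : ℤ}, p + 1 = q → E.X p →ₗ[k] P.X n q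
  attach_act : ∀ {p q : ℤ} (h : p + 1 = q) (σ : Equiv.Perm (Fin n)) (e : E.X p),
    attach h (E.act σ e) = P.act σ (attach h e)
  d_attach : ∀ {p q r : ℤ} (h : p + 1 = q) (h' : q + 1 = r) (e : E.X p), P.d h' (attach h e) = 0
  /-- On `E`, the differential of `P'` is `d`. -/
  d_inc : ∀ {p q : ℤ} (h : p + 1 = q) (e : E.X p),
    P'.d h (inc.toFun p e) = ι.toFun n q (attach h e)
  /-- The maps `δᵢ : E → P(n - 1)`. -/
  δ : ∀ {m : ℕ} {p : ℤ}, Fin n → m + 1 = n → E.X p →ₗ[k] P.X m p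
  /-- `δᵢ d = ∂ δᵢ`. -/
  δ_attach : ∀ {m : ℕ} {p q : ℤ} (h : p + 1 = q) (i : Fin n) (hm : m + 1 = n) (e : E.X p),
    P.face i hm (attach h e) = P.d h (δ i hm e)
  /-- On `E`, the restriction operations of `P'` are the `δᵢ`. -/
  face_inc : ∀ {m : ℕ} {p : ℤ} (i : Fin n) (hm : m + 1 = n) (e : E.X p),
    P'.face i hm (inc.toFun p e) = ι.toFun m p (δ i hm e)

/-- `P` is the initial dg operad `I₀`: `P(1) = k`, spanned by the identity, and `P(n) = 0` for
`n ≠ 1`. -/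
def DGOperad.IsInitial (P : DGOperad k) : Prop :=
  Function.Bijective (fun c : k => c • P.one) ∧
    ∀ (n : ℕ) (p : ℤ), (n, p) ≠ (1, 0) → Subsingleton (P.X n p)

/-- `P` is the initial unitary dg operad `I₊`: `P(0) = k` and `P(1) = k`, spanned by the
distinguished nullary operation and by the identity, and `P(n) = 0` for `n ≥ 2`. -/
def UDGOperad.IsInitial (P : UDGOperad k) : Prop :=
  P.IsUnitary ∧ Function.Bijective (fun c : k => c • P.one) ∧
    ∀ (n : ℕ) (p : ℤ), n ≠ 0 → (n, p) ≠ (1, 0) → Subsingleton (P.X n p)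

/-- A presentation of the dg operad `S` as a (non-unitary) Sullivan minimal operad: `S` is the
colimit of a sequence `I₀ = P₁ → P₂ → P₃ → ⋯` in which `Pₙ = Pₙ₋₁ ⊔_d Γ(E(n))` is an arity `n`
principal extension; here `Pₙ` is `stage (n - 1)`. All transition morphisms are injective and
colimits of sequences are computed arity- and degreewise, so the colimit is the union of the
`Pₙ`. -/
structure MinimalPresentation (S : DGOperad k) where
  stage : ℕ → DGOperad.{u} k
  initial : (stage 0).IsInitial
  ext : ∀ s, PrincipalExtension (s + 2) (stage s) (stage (s + 1))
  incl : ∀ s, DGHom (stage s) S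
  incl_comp : ∀ s, (incl (s + 1)).comp (ext s).ι = incl s
  injective : ∀ (s n : ℕ) (p : ℤ), Function.Injective ((incl s).toFun n p)
  exhaustive : ∀ (n : ℕ) (p : ℤ) (x : S.X n p), ∃ s y, (incl s).toFun n p y = x

/-- A presentation of `S` as a unitary Sullivan minimal operad, as in `MinimalPresentation`, but
starting from `I₊` and with unitary principal extensions. -/
structure UnitaryMinimalPresentation (S : UDGOperad k) where
  stage : ℕ → UDGOperad.{u} k
  initial : (stage 0).IsInitial
  ext : ∀ s, UnitaryPrincipalExtension (s + 2) (stage s) (stage (s + 1))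
  incl : ∀ s, UHom (stage s) S
  incl_comp : ∀ s, (incl (s + 1)).comp (ext s).ι = incl s
  injective : ∀ (s n : ℕ) (p : ℤ), Function.Injective ((incl s).toFun n p)
  exhaustive : ∀ (n : ℕ) (p : ℤ) (x : S.X n p), ∃ s y, (incl s).toFun n p y = x

/-- `S` is a (non-unitary) Sullivan minimal operad. -/
def DGOperad.IsSullivanMinimal (S : DGOperad k) : Prop := Nonempty (MinimalPresentation S)

/-- `S` is a unitary Sullivan minimal operad. -/
def UDGOperad.IsSullivanMinimal (S : UDGOperad k) : Prop :=
  Nonempty (UnitaryMinimalPresentation S)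

/-- `φ : S → P` is a (non-unitary) Sullivan minimal model of `P`. -/
def DGHom.IsMinimalModel {S P : DGOperad k} (φ : DGHom S P) : Prop :=
  S.IsSullivanMinimal ∧ φ.IsQuis

/-- `φ : S → P` is a unitary Sullivan minimal model of `P`. -/
def UHom.IsMinimalModel {S P : UDGOperad k} (φ : UHom S P) : Prop :=
  S.IsSullivanMinimal ∧ φ.toDGHom.IsQuis

/-- `P` is an operad with unitary multiplication: there is a morphism `Ass₊ → P` from the operad of
unital associative algebras that sends `1 ∈ Ass₊(0)` to the distinguished nullary operation of `P`.
Such a morphism amounts to a cocycle `m ∈ P(2)` of degree `0` with `m ∘₁ m = m ∘₂ m` and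
`m ∘₁ 1 = id = m ∘₂ 1`. -/
def UDGOperad.HasUnitaryMultiplication (P : UDGOperad k) : Prop :=
  ∃ m : P.X 2 0, P.d (zero_add 1) m = 0 ∧
    P.comp (0 : Fin 2) (show 3 + 1 = 2 + 2 from rfl) (add_zero 0) m m
      = P.comp (1 : Fin 2) (show 3 + 1 = 2 + 2 from rfl) (add_zero 0) m m ∧
    P.face (0 : Fin 2) (show 1 + 1 = 2 from rfl) m = P.one ∧
    P.face (1 : Fin 2) (show 1 + 1 = 2 from rfl) m = P.one

end Sullivan

end

/-!
Sullivan minimal operads are cofibrant, and they are minimal; the theorem combines the two facts. A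
dg operad without distinguished nullary operation is regarded as one with distinguished operation
`0`, for which all restriction operations vanish. This makes the non-unitary case an instance of the
same arguments as the unitary one, and `Filtration` isolates the structure that both kinds of
minimal operads share: a tower of graded operads `G s`, each a free extension of the preceding one,
with differentials and restrictions of the new generators in the preceding stage.

**Generation.** The universal property shows that a free extension `P ⊔ Γ(E)` has no proper
suboperad that contains `P` and `E` (`IsFreeExtension.mem_of_sub`). Hence properties that define
suboperads can be checked on generators, and `G (s + 1)` agrees with `G s` below arity `s + 2`,
where only generators are added.

**Lifting.** A minimal operad lifts along every surjective morphism `π : M → P` with acyclic kernel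
(`Filtration.exists_lift`). A new generator `e` has to be sent to an operation of `M` with given
differential, given restrictions and given image in `P`. One first matches the image, then the
restrictions, then uses acyclicity of the kernel. Matching the restrictions is where the unitary
multiplication enters: composition with `m` provides the degeneracies and an extra degeneracy of an
augmented simplicial vector space with the restrictions as face operations, so that all boundaries
of simplices can be filled (`UDGOperad.exists_filling`). Since `m` is a cocycle of degree zero,
fillings of cocycles are cocycles. Only the unit relations of `m` matter, and these
can be lifted strictly to minimal models (`Filtration.exists_isUnital`), unlike associativity. The
solutions are made equivariant by averaging over the symmetric group.

**Existence and uniqueness of `ψ`.** For a quasi-isomorphism `φ' : S' → P`, the mapping path operad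
`S' ×_P P[t,dt]` is trivially fibered over `P`, by integration in `k[t,dt]`
(`UDGOperad.exists_path_primitive`). A lift of `φ` is a morphism `ψ` together with a homotopy
`φ' ψ ≃ φ`. Two such lifts are homotopic: with `M` the mapping path operad, the operad of paths in
`M` that are constant over `P` is trivially fibered over the operad `M ×_P M` of their end points.

**Minimality.** The morphism `ψ` is a quasi-isomorphism, and a quasi-isomorphism `ρ` between minimal
operads is bijective (`Filtration.isIso_of_isQuis`): if `ρ` is an isomorphism on the stages `s`,
then, as the differential in arity `s + 2` takes values in the stage `s`, it is bijective in arity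
`s + 2` by a diagram chase, and the universal property of free extensions yields the inverse on the
stage `s + 1`.
-/

noncomputable section

variable {k : Type u} [Field k]

/-! ### Suboperads and generation of free extensions -/

/-- A graded suboperad: a family of subspaces that contains the identity operation and is closed
under the symmetric groups and the composition products. -/
structure GOperad.Sub (P : GOperad k) where
  carrier : ∀ (n : ℕ) (p : ℤ), Submodule k (P.X n p)
  act_mem : ∀ {n : ℕ} {p : ℤ} (σ : Equiv.Perm (Fin n)) {x : P.X n p}, x ∈ carrier n p →
    P.act σ x ∈ carrier n p
  one_mem : P.one ∈ carrier 1 0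
  comp_mem : ∀ {l m n : ℕ} {p q r : ℤ} (i : Fin l) (hn : n + 1 = l + m) (hr : p + q = r)
    {x : P.X l p} {y : P.X m q}, x ∈ carrier l p → y ∈ carrier m q →
      P.comp i hn hr x y ∈ carrier n r

/-- A suboperad as an operad. -/
def GOperad.Sub.toGOperad {P : GOperad k} (R : P.Sub) : GOperad k where
  X n p := R.carrier n p
  act σ := (P.act σ).restrict fun _ hx => R.act_mem σ hx
  comp i hn hr := LinearMap.mk₂ k
    (fun x y => ⟨P.comp i hn hr x y, R.comp_mem i hn hr x.2 y.2⟩)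
    (fun _ _ _ => Subtype.ext (by simp))
    (fun _ _ _ => Subtype.ext (by simp))
    (fun _ _ _ => Subtype.ext (by simp))
    (fun _ _ _ => Subtype.ext (by simp))
  one := ⟨P.one, R.one_mem⟩
  act_one x := Subtype.ext (P.act_one x.1)
  act_mul σ τ x := Subtype.ext (P.act_mul σ τ x.1)
  comp_act i hn hr σ τ ρ h₁ h₂ x y := Subtype.ext (P.comp_act i hn hr σ τ ρ h₁ h₂ x.1 y.1)
  comp_one i hn hp x := Subtype.ext (P.comp_one i hn hp x.1)
  one_comp i hn hp x := Subtype.ext (P.one_comp i hn hp x.1)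
  assoc_seq i j t hu hw hv hw' ha hc hb hc' ht x y z :=
    Subtype.ext (P.assoc_seq i j t hu hw hv hw' ha hc hb hc' ht x.1 y.1 z.1)
  assoc_par i j t s hu hw hv hw' ha hc hb hc' hij ht hs x y z :=
    Subtype.ext ((P.assoc_par i j t s hu hw hv hw' ha hc hb hc' hij ht hs x.1 y.1 z.1).trans
      (by simp [Units.smul_def]))

/-- The inclusion of a suboperad. -/
def GOperad.Sub.incl {P : GOperad k} (R : P.Sub) : GHom R.toGOperad P where
  toFun n p := (R.carrier n p).subtype
  map_act _ _ := rfl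
  map_one := rfl
  map_comp _ _ _ _ _ := rfl

theorem IsFreeExtension.hom_ext {n : ℕ} {E : GRep k n} {P P' : GOperad.{u} k} {ι : GHom P P'}
    {j : GenMap E P'} (h : IsFreeExtension ι j) {Q : GOperad.{u} k} {f g : GHom P' Q}
    (h₁ : ∀ m p x, f.toFun m p (ι.toFun m p x) = g.toFun m p (ι.toFun m p x))
    (h₂ : ∀ p e, f.toFun n p (j.toFun p e) = g.toFun n p (j.toFun p e)) : f = g := by
  refine (h Q (g.comp ι) (g.restrict j)).unique ⟨?_, ?_⟩ ⟨rfl, rfl⟩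
  · ext m p x; exact h₁ m p x
  · ext p e; exact h₂ p e

/-- A free extension `P ⊔ Γ(E)` is generated by `P` and `E`: by the universal property, the
inclusion of a suboperad that contains both has a section. -/
theorem IsFreeExtension.mem_of_sub {n : ℕ} {E : GRep k n} {P P' : GOperad.{u} k} {ι : GHom P P'}
    {j : GenMap E P'} (h : IsFreeExtension ι j) (R : P'.Sub)
    (h₁ : ∀ m p x, ι.toFun m p x ∈ R.carrier m p) (h₂ : ∀ p e, j.toFun p e ∈ R.carrier n p)
    (m : ℕ) (p : ℤ) (x : P'.X m p) : x ∈ R.carrier m p := by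
  obtain ⟨ψ, ⟨e₁, e₂⟩, -⟩ := h R.toGOperad
    { toFun := fun m p => (ι.toFun m p).codRestrict _ (h₁ m p)
      map_act := fun σ x => Subtype.ext (ι.map_act σ x)
      map_one := Subtype.ext ι.map_one
      map_comp := fun i hn hr x y => Subtype.ext (ι.map_comp i hn hr x y) }
    { toFun := fun p => (j.toFun p).codRestrict _ (h₂ p)
      map_act := fun σ x => Subtype.ext (j.map_act σ x) }
  have key : R.incl.comp ψ = GHom.id P' := by
    refine h.hom_ext (fun m p x => ?_) (fun p e => ?_)
    · have := congrArg (fun f => (GHom.toFun f m p x)) e₁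
      exact congrArg Subtype.val this
    · have := congrArg (fun f => (GenMap.toFun f p e)) e₂
      exact congrArg Subtype.val this
  have := congrArg (fun f => GHom.toFun f m p x) key
  change (ψ.toFun m p x).1 = x at this
  rw [← this]
  exact (ψ.toFun m p x).2

/-- A graded operad `P` is reduced if `P(0) = 0` and `P(1)` is spanned by the identity operation. -/
structure GOperad.IsReduced (P : GOperad k) : Prop where
  nullary : ∀ (p : ℤ) (x : P.X 0 p), x = 0
  unary : ∀ x : P.X 1 0, ∃ c : k, x = c • P.one
  unary_eq_zero : ∀ (p : ℤ) (x : P.X 1 p), p ≠ 0 → x = 0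

/-- In a reduced operad, closure under composition needs to be checked for operations of arity at
least two only. -/
def GOperad.IsReduced.sub {P : GOperad k} (hP : P.IsReduced)
    (carrier : ∀ (n : ℕ) (p : ℤ), Submodule k (P.X n p))
    (act_mem : ∀ {n : ℕ} {p : ℤ} (σ : Equiv.Perm (Fin n)) {x : P.X n p}, x ∈ carrier n p →
      P.act σ x ∈ carrier n p)
    (one_mem : P.one ∈ carrier 1 0)
    (comp_mem : ∀ {l m n : ℕ} {p q r : ℤ} (i : Fin l) (hn : n + 1 = l + m) (hr : p + q = r)
      {x : P.X l p} {y : P.X m q}, 2 ≤ l → 2 ≤ m → x ∈ carrier l p → y ∈ carrier m q →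
      P.comp i hn hr x y ∈ carrier n r) : P.Sub where
  carrier := carrier
  act_mem := act_mem
  one_mem := one_mem
  comp_mem {l m n p q r} i hn hr x y hx hy := by
    match m, y with
    | 0, y => rw [hP.nullary q y, map_zero]; exact zero_mem _
    | 1, y =>
      by_cases hq : q = 0
      · subst hq
        obtain ⟨c, rfl⟩ := hP.unary y
        obtain rfl : n = l := by omega
        obtain rfl : p = r := by omega
        rw [map_smul, P.comp_one]
        exact (carrier _ _).smul_mem c hx
      · rw [hP.unary_eq_zero q y hq, map_zero]; exact zero_mem _
    | m + 2, y =>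
      match l, x with
      | 0, x => exact i.elim0
      | 1, x =>
        by_cases hp : p = 0
        · subst hp
          obtain ⟨c, rfl⟩ := hP.unary x
          obtain rfl : n = m + 2 := by omega
          obtain rfl : q = r := by omega
          rw [map_smul, LinearMap.smul_apply, P.one_comp]
          exact (carrier _ _).smul_mem c hy
        · rw [hP.unary_eq_zero p x hp, map_zero, LinearMap.zero_apply]; exact zero_mem _
      | l + 2, x => exact comp_mem i hn hr (by omega) (by omega) hx hy

theorem GHom.range_act {P Q : GOperad k} (f : GHom P Q) {n : ℕ} {p : ℤ} (σ : Equiv.Perm (Fin n))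
    {x : Q.X n p} (hx : x ∈ LinearMap.range (f.toFun n p)) :
    Q.act σ x ∈ LinearMap.range (f.toFun n p) := by
  obtain ⟨a, rfl⟩ := hx
  exact ⟨P.act σ a, f.map_act σ a⟩

/-- Below the arity of the new generators, a free extension of a reduced operad adds nothing. -/
theorem IsFreeExtension.surjective_of_lt {n : ℕ} {E : GRep k n} {P P' : GOperad.{u} k}
    {ι : GHom P P'} {j : GenMap E P'} (h : IsFreeExtension ι j) (hP : P.IsReduced)
    {m : ℕ} (hm : m < n) {p : ℤ} (x : P'.X m p) : ∃ a, ι.toFun m p a = x := by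
  let R : P'.Sub :=
    { carrier := fun m p => if m < n then LinearMap.range (ι.toFun m p) else ⊤
      act_mem := by
        intro m p σ x hx
        split_ifs at hx ⊢
        · exact ι.range_act σ hx
        · trivial
      one_mem := by
        split_ifs
        · exact ⟨P.one, ι.map_one⟩
        · trivial
      comp_mem := by
        intro l m r p q s i hn hr x y hx hy
        have hl := i.2
        by_cases hrn : r < n
        · rw [if_pos hrn]
          rw [if_pos (by omega)] at hy
          obtain ⟨b, rfl⟩ := hy
          rcases Nat.eq_zero_or_pos m with rfl | hm0
          · rw [hP.nullary _ b, map_zero, map_zero]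
            exact zero_mem _
          · rw [if_pos (by omega)] at hx
            obtain ⟨a, rfl⟩ := hx
            exact ⟨P.comp i hn hr a b, ι.map_comp i hn hr a b⟩
        · rw [if_neg hrn]; trivial }
  have := h.mem_of_sub R (fun m p x => ?_) (fun p e => ?_) m p x
  · change x ∈ (if m < n then LinearMap.range (ι.toFun m p) else ⊤) at this
    rw [if_pos hm] at this
    exact this
  · change _ ∈ (if m < n then LinearMap.range (ι.toFun m p) else ⊤)
    split_ifs
    · exact ⟨x, rfl⟩
    · trivial
  · change _ ∈ (if n < n then LinearMap.range (ι.toFun n p) else ⊤)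
    rw [if_neg (lt_irrefl n)]
    trivial

theorem IsFreeExtension.isReduced {n : ℕ} {E : GRep k n} {P P' : GOperad.{u} k}
    {ι : GHom P P'} {j : GenMap E P'} (h : IsFreeExtension ι j) (hP : P.IsReduced)
    (hn : 2 ≤ n) : P'.IsReduced where
  nullary p x := by
    obtain ⟨a, rfl⟩ := h.surjective_of_lt hP (by omega) x
    rw [hP.nullary p a, map_zero]
  unary x := by
    obtain ⟨a, rfl⟩ := h.surjective_of_lt hP (by omega) x
    obtain ⟨c, rfl⟩ := hP.unary a
    exact ⟨c, by rw [map_smul, ι.map_one]⟩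
  unary_eq_zero p x hp := by
    obtain ⟨a, rfl⟩ := h.surjective_of_lt hP (by omega) x
    rw [hP.unary_eq_zero p a hp, map_zero]

/-- In the arity of the new generators, a free extension of a reduced operad adds the generators
and nothing else. -/
theorem IsFreeExtension.exists_eq_add {n : ℕ} {E : GRep k n} {P P' : GOperad.{u} k}
    {ι : GHom P P'} {j : GenMap E P'} (h : IsFreeExtension ι j) (hP : P.IsReduced)
    (hn : 2 ≤ n) {p : ℤ} (x : P'.X n p) : ∃ a e, x = ι.toFun n p a + j.toFun p e := by
  let C : ∀ (m : ℕ) (p : ℤ), Submodule k (P'.X m p) := fun m p =>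
    if e : n = m then e ▸ (LinearMap.range (ι.toFun n p) ⊔ LinearMap.range (j.toFun p)) else ⊤
  have hC : ∀ p, C n p = LinearMap.range (ι.toFun n p) ⊔ LinearMap.range (j.toFun p) :=
    fun p => dif_pos rfl
  have hC' : ∀ m p, n ≠ m → C m p = ⊤ := fun m p hm => dif_neg hm
  have hι : ∀ m p x, ι.toFun m p x ∈ C m p := by
    intro m p x
    by_cases e : n = m
    · subst e
      rw [hC]
      exact Submodule.mem_sup_left ⟨x, rfl⟩
    · rw [hC' m p e]; trivial
  have act_mem : ∀ {m : ℕ} {p : ℤ} (σ : Equiv.Perm (Fin m)) {x : P'.X m p}, x ∈ C m p →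
      P'.act σ x ∈ C m p := by
    intro m p σ x hx
    by_cases e : n = m
    · subst e
      rw [hC] at hx ⊢
      obtain ⟨_, ⟨a, rfl⟩, _, ⟨b, rfl⟩, rfl⟩ := Submodule.mem_sup.1 hx
      rw [map_add, ← ι.map_act, ← j.map_act]
      exact Submodule.add_mem_sup ⟨_, rfl⟩ ⟨_, rfl⟩
    · rw [hC' m p e]; trivial
  have := h.mem_of_sub ((h.isReduced hP hn).sub C act_mem (by rw [← ι.map_one]; exact hι _ _ _) ?_)
    hι (fun p e => ?_) n p x
  · change x ∈ C n p at this
    rw [hC] at this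
    obtain ⟨_, ⟨a, rfl⟩, _, ⟨b, rfl⟩, rfl⟩ := Submodule.mem_sup.1 this
    exact ⟨a, b, rfl⟩
  · intro l m r p q s i hr hs x y hl hm hx hy
    by_cases e : n = r
    · subst e
      obtain ⟨a, rfl⟩ := h.surjective_of_lt hP (by omega) x
      obtain ⟨b, rfl⟩ := h.surjective_of_lt hP (by omega) y
      rw [← ι.map_comp]
      exact hι _ _ _
    · rw [hC' _ _ e]; trivial
  · change _ ∈ C n p
    rw [hC]
    exact Submodule.mem_sup_right ⟨e, rfl⟩

/-! ### Restriction operations and their matching problem -/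

theorem UDGOperad.face_apply (P : UDGOperad k) {n m : ℕ} {p : ℤ} (i : Fin n) (h : m + 1 = n)
    (x : P.X n p) : P.face i h x = P.comp i (h.trans (add_zero n).symm) (add_zero p) x P.pt := rfl

theorem UHom.map_face {P Q : UDGOperad k} (f : UHom P Q) {n m : ℕ} {p : ℤ} (i : Fin n)
    (h : m + 1 = n) (x : P.X n p) :
    f.toFun m p (P.face i h x) = Q.face i h (f.toFun n p x) := by
  rw [P.face_apply, f.map_comp, f.map_pt, Q.face_apply]

theorem UDGOperad.d_face (P : UDGOperad k) {n m : ℕ} {p q : ℤ} (i : Fin n) (h : m + 1 = n)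
    (hq : p + 1 = q) (x : P.X n p) : P.d hq (P.face i h x) = P.face i h (P.d hq x) := by
  rw [P.face_apply, P.d_comp i _ (add_zero p) hq (zero_add 1) hq (add_zero q) hq, P.d_pt, map_zero,
    smul_zero, add_zero, P.face_apply]

theorem UDGOperad.face_of_pt_eq_zero (P : UDGOperad k) (hP : P.pt = 0) {n m : ℕ} {p : ℤ}
    (i : Fin n) (h : m + 1 = n) (x : P.X n p) : P.face i h x = 0 := by
  rw [P.face_apply, hP, map_zero]

/-- The restriction of `x ∘ᵢ y` at an input of `y`. The two lemmas that follow treat the inputs of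
`x` after and before the `i`-th one. -/
theorem UDGOperad.face_comp_inner (P : UDGOperad k) {l m m' n n' : ℕ} {p q r : ℤ} (i : Fin l)
    (b : Fin m) (t : Fin n) (hn : n + 1 = l + m) (hr : p + q = r) (h : n' + 1 = n)
    (hm : m' + 1 = m) (hn' : n' + 1 = l + m') (ht : (t : ℕ) = i + b) (x : P.X l p) (y : P.X m q) :
    P.face t h (P.comp i hn hr x y) = P.comp i hn' hr x (P.face b hm y) :=
  P.assoc_seq i b t hn (h.trans (add_zero n).symm) (hm.trans (add_zero m).symm) hn' hr
    (add_zero r) (add_zero q) hr ht x y P.pt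

theorem UDGOperad.face_comp_after (P : UDGOperad k) {l l' m n n' : ℕ} {p q r : ℤ} (i j : Fin l)
    (i' : Fin l') (t : Fin n) (hn : n + 1 = l + m) (hr : p + q = r) (h : n' + 1 = n)
    (hl : l' + 1 = l) (hn' : n' + 1 = l' + m) (hij : i < j) (ht : (t : ℕ) + 1 = j + m)
    (hi' : (i' : ℕ) = i) (x : P.X l p) (y : P.X m q) :
    P.face t h (P.comp i hn hr x y) = P.comp i' hn' hr (P.face j hl x) y := by
  have := P.assoc_par i j t i' hn (h.trans (add_zero n).symm) (hl.trans (add_zero l).symm) hn' hr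
    (add_zero r) (add_zero p) hr hij ht hi' x y P.pt
  rwa [mul_zero, Int.negOnePow_zero, one_smul] at this

theorem UDGOperad.face_comp_before (P : UDGOperad k) {l l' m n n' : ℕ} {p q r : ℤ} (i j : Fin l)
    (i' : Fin l') (t : Fin n) (hn : n + 1 = l + m) (hr : p + q = r) (h : n' + 1 = n)
    (hl : l' + 1 = l) (hn' : n' + 1 = l' + m) (hij : j < i) (ht : (t : ℕ) = j)
    (hi' : (i' : ℕ) + 1 = i) (x : P.X l p) (y : P.X m q) :
    P.face t h (P.comp i hn hr x y) = P.comp i' hn' hr (P.face j hl x) y := by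
  have := P.assoc_par j i i' t (hl.trans (add_zero l).symm) hn' hn (h.trans (add_zero n).symm)
    (add_zero p) hr hr (add_zero r) hij hi' ht x P.pt y
  rw [zero_mul, Int.negOnePow_zero, one_smul] at this
  exact this.symm

theorem UDGOperad.face_one (P : UDGOperad k) (i : Fin 1) : P.face i rfl P.one = P.pt := by
  rw [P.face_apply, P.one_comp]

/-- The simplicial identity for the restriction operations. -/
theorem UDGOperad.face_face (P : UDGOperad k) {n : ℕ} {p : ℤ} (i j : Fin (n + 2))
    (a b : Fin (n + 1)) (ha : (a : ℕ) = i) (hb : (b : ℕ) + 1 = j) (hij : i < j)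
    (x : P.X (n + 2) p) : P.face a rfl (P.face j rfl x) = P.face b rfl (P.face i rfl x) := by
  have := P.assoc_par (l := n + 2) (m := 0) (n := 0) (u := n + 1) (v := n + 1) (w := n)
    (p := p) (q := 0) (r := 0) (a := p) (b := p) (c := p) i j b a rfl rfl rfl rfl
    (add_zero p) (add_zero p) (add_zero p) (add_zero p) hij (by simpa using hb) ha x P.pt P.pt
  rw [mul_zero, Int.negOnePow_zero, one_smul] at this
  exact this.symm

/-- Restriction operations are compatible with the symmetric groups. -/
theorem exists_face_act {n : ℕ} (τ : Equiv.Perm (Fin (n + 1))) (i : Fin (n + 1)) :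
    ∃ ρ : Equiv.Perm (Fin n), ∀ (P : UDGOperad.{u} k) (p : ℤ) (x : P.X (n + 1) p),
      P.face i rfl (P.act τ x) = P.act ρ (P.face (τ i) rfl x) := by
  have hpos : ∀ (i : Fin (n + 1)) (j : {j : Fin (n + 1) // j ≠ i}),
      (((finSuccAboveEquiv i).symm j : Fin n) : ℕ) = outerPos 0 i j := by
    intro i j
    obtain ⟨a, rfl⟩ := (finSuccAboveEquiv i).surjective j
    rw [Equiv.symm_apply_apply, finSuccAboveEquiv_apply]
    simp only [outerPos, Fin.succAbove]
    split_ifs <;> simp_all [Fin.lt_def]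
    omega
  -- `ρ` is the bijection between the complements of `i` and `τ i` that `τ` induces.
  let e : {j : Fin (n + 1) // j ≠ i} ≃ {j : Fin (n + 1) // j ≠ τ i} :=
    τ.subtypeEquiv fun a => by simp
  let ρ : Equiv.Perm (Fin n) :=
    ((finSuccAboveEquiv i).trans e).trans (finSuccAboveEquiv (τ i)).symm
  refine ⟨ρ, fun P p x => ?_⟩
  have := P.comp_act (l := n + 1) (m := 0) (n := n) i rfl (add_zero p) τ 1 ρ ?_ ?_ x P.pt
  · rw [P.act_one] at this
    exact this
  · intro j a hj ha
    have : a = (finSuccAboveEquiv i).symm ⟨j, hj⟩ := Fin.ext (by rw [hpos]; exact ha)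
    subst this
    have h2 := hpos (τ i) (e ⟨j, hj⟩)
    rw [show ((e ⟨j, hj⟩ : {j // j ≠ τ i}) : Fin (n + 1)) = τ j from rfl] at h2
    rw [← h2]
    simp [ρ]
  · intro b
    exact b.elim0

/-- A closed operation `m ∈ P(2)` of degree `0` for which the distinguished nullary operation is a
two-sided unit. Associativity is not required, so this is invariant under quasi-isomorphisms. -/
def UDGOperad.IsUnital (P : UDGOperad k) (m : P.X 2 0) : Prop :=
  P.d (zero_add 1) m = 0 ∧
    P.face (0 : Fin 2) (show 1 + 1 = 2 from rfl) m = P.one ∧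
    P.face (1 : Fin 2) (show 1 + 1 = 2 from rfl) m = P.one

theorem UDGOperad.face_comp_self (P : UDGOperad k) {m : P.X 2 0} (hm : P.IsUnital m) {n : ℕ} {p : ℤ}
    (i : Fin (n + 1)) (t : Fin (n + 2)) (ht : (t : ℕ) = i) (x : P.X (n + 1) p) :
    P.face t rfl (P.comp i (show n + 2 + 1 = (n + 1) + 2 from rfl) (add_zero p) x m) = x := by
  rw [P.face_comp_inner i 0 t _ _ rfl rfl rfl (by simpa using ht), hm.2.1, P.comp_one]

theorem UDGOperad.face_last_comp (P : UDGOperad k) {m : P.X 2 0} (hm : P.IsUnital m) {n : ℕ}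
    {p : ℤ} (t : Fin (n + 2)) (ht : (t : ℕ) = n + 1) (x : P.X (n + 1) p) :
    P.face t rfl (P.comp 0 (show n + 2 + 1 = 2 + (n + 1) by omega) (zero_add p) m x) = x := by
  rw [P.face_comp_after 0 1 0 t _ _ rfl rfl (by omega) (by decide)
    (by rw [ht, Fin.val_one]; omega) rfl, hm.2.2, P.one_comp]

/-- The boundary of a simplex can be filled: in the presence of a unital multiplication `m`,
operations `w i` that satisfy the simplicial identities are the restrictions of one operation. The
degeneracies are `x ↦ x ∘ₖ m`; together with `x ↦ m ∘₁ x`, which adds a new last input, they make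
it possible to correct the restrictions one after the other. All steps stay within any family of
subspaces that is closed under these operations. -/
theorem UDGOperad.exists_filling (P : UDGOperad k) {m : P.X 2 0} (hm : P.IsUnital m)
    (A : ∀ (n : ℕ) (p : ℤ), Submodule k (P.X n p))
    (hface : ∀ {n : ℕ} {p : ℤ} (i : Fin (n + 1)) {x : P.X (n + 1) p}, x ∈ A (n + 1) p →
      P.face i rfl x ∈ A n p)
    (hr : ∀ {n : ℕ} {p : ℤ} (i : Fin (n + 1)) {x : P.X (n + 1) p}, x ∈ A (n + 1) p →
      P.comp i (show n + 2 + 1 = (n + 1) + 2 from rfl) (add_zero p) x m ∈ A (n + 2) p)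
    (hl : ∀ {n : ℕ} {p : ℤ} {x : P.X (n + 1) p}, x ∈ A (n + 1) p →
      P.comp 0 (show n + 2 + 1 = 2 + (n + 1) by omega) (zero_add p) m x ∈ A (n + 2) p)
    {n : ℕ} {p : ℤ} (w : Fin (n + 2) → P.X (n + 1) p) (hw : ∀ i, w i ∈ A (n + 1) p)
    (hw' : ∀ (i j : Fin (n + 2)) (a b : Fin (n + 1)), (a : ℕ) = i → (b : ℕ) + 1 = j → i < j →
      P.face a rfl (w j) = P.face b rfl (w i)) :
    ∃ x ∈ A (n + 2) p, ∀ i, P.face i rfl x = w i := by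
  have key : ∀ c : ℕ, ∃ x ∈ A (n + 2) p, ∀ i : Fin (n + 2), (i : ℕ) < c →
      P.face i rfl x = w i := by
    intro c
    induction c with
    | zero => exact ⟨0, zero_mem _, fun i hi => absurd hi (Nat.not_lt_zero _)⟩
    | succ c ih =>
      obtain ⟨x, hx, hxw⟩ := ih
      by_cases hc : c < n + 2
      swap
      · exact ⟨x, hx, fun i hi => hxw i (by omega)⟩
      let j : Fin (n + 2) := ⟨c, hc⟩
      let v := w j - P.face j rfl x
      have hv : v ∈ A (n + 1) p := sub_mem (hw j) (hface j hx)
      have hv0 : ∀ a : Fin (n + 1), (a : ℕ) < c → P.face a rfl v = 0 := by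
        intro a ha
        let i : Fin (n + 2) := a.castSucc
        let b : Fin (n + 1) := ⟨c - 1, by omega⟩
        have hb : (b : ℕ) + 1 = j := by simp only [b, j]; omega
        rw [map_sub, hw' i j a b rfl hb ha, P.face_face i j a b rfl hb ha, hxw i ha, sub_self]
      obtain ⟨y, hy, hyj, hyi⟩ : ∃ y ∈ A (n + 2) p, P.face j rfl y = v ∧
          ∀ i : Fin (n + 2), (i : ℕ) < c → P.face i rfl y = 0 := by
        by_cases hcn : c < n + 1
        · -- Restrictions below `c` of `v ∘_c m` are composites of restrictions of `v`.
          refine ⟨_, hr ⟨c, hcn⟩ hv, P.face_comp_self hm _ _ rfl _, fun i hi => ?_⟩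
          obtain _ | n := n
          · omega
          · rw [P.face_comp_before ⟨c, hcn⟩ ⟨i, by omega⟩ ⟨c - 1, by omega⟩ i _ _ rfl rfl rfl hi
              rfl (by simp only; omega), hv0 _ hi, map_zero, LinearMap.zero_apply]
        · refine ⟨_, hl hv, P.face_last_comp hm _ (by simp only [j]; omega) _,
            fun i hi => ?_⟩
          rw [P.face_comp_inner 0 ⟨i, by omega⟩ i _ _ rfl rfl (by omega) (by simp), hv0 _ hi,
            map_zero]
      refine ⟨x + y, add_mem hx hy, fun i hi => ?_⟩
      rcases Nat.lt_succ_iff_lt_or_eq.1 hi with h | h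
      · rw [map_add, hxw i h, hyi i h, add_zero]
      · obtain rfl : i = j := Fin.ext h
        rw [map_add, hyj, add_sub_cancel]
  obtain ⟨x, hx, h⟩ := key (n + 2)
  exact ⟨x, hx, fun i => h i i.2⟩

/-! ### Trivial fibrations -/

/-- A trivial fibration: a surjective morphism with acyclic kernel. -/
structure UHom.IsTrivialFibration {M P : UDGOperad k} (π : UHom M P) : Prop where
  surjective : ∀ (n : ℕ) (p : ℤ), Function.Surjective (π.toFun n p)
  acyclic : ∀ {n : ℕ} {p q : ℤ} (h : p + 1 = q) (z : M.X n q), M.d (rfl : q + 1 = q + 1) z = 0 →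
    π.toFun n q z = 0 → ∃ y : M.X n p, M.d h y = z ∧ π.toFun n p y = 0

/-- An operation can be lifted along a trivial fibration with prescribed differential and prescribed
restrictions. Without a unital multiplication this holds if all restrictions vanish. -/
theorem UHom.IsTrivialFibration.exists_lift {M P : UDGOperad k} {π : UHom M P}
    (hπ : π.IsTrivialFibration) {n : ℕ} {p q : ℤ} (h : p + 1 = q) (z : M.X (n + 2) q)
    (w : Fin (n + 2) → M.X (n + 1) p) (v : P.X (n + 2) p)
    (hM : (∃ m, M.IsUnital m) ∨ (M.pt = 0 ∧ ∀ i, w i = 0))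
    (hz : M.d (rfl : q + 1 = q + 1) z = 0)
    (hw : ∀ (i j : Fin (n + 2)) (a b : Fin (n + 1)), (a : ℕ) = i → (b : ℕ) + 1 = j → i < j →
      M.face a rfl (w j) = M.face b rfl (w i))
    (hzw : ∀ i, M.face i rfl z = M.d h (w i))
    (hzv : π.toFun _ _ z = P.d h v)
    (hwv : ∀ i, π.toFun _ _ (w i) = P.face i rfl v) :
    ∃ x : M.X (n + 2) p, M.d h x = z ∧ (∀ i, M.face i rfl x = w i) ∧ π.toFun _ _ x = v := by
  -- Fillings inside the kernel of `π`, closed if the data are.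
  have fill : ∀ w : Fin (n + 2) → M.X (n + 1) p,
      ((∃ m, M.IsUnital m) ∨ (M.pt = 0 ∧ ∀ i, w i = 0)) → (∀ i, π.toFun _ _ (w i) = 0) →
      (∀ (i j : Fin (n + 2)) (a b : Fin (n + 1)), (a : ℕ) = i → (b : ℕ) + 1 = j → i < j →
        M.face a rfl (w j) = M.face b rfl (w i)) →
      ∃ x : M.X (n + 2) p, π.toFun _ _ x = 0 ∧ (∀ i, M.face i rfl x = w i) ∧
        ((∀ i, M.d h (w i) = 0) → M.d h x = 0) := by
    intro w hM hw0 hw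
    rcases hM with ⟨m, hm⟩ | ⟨hpt, hw'⟩
    swap
    · exact ⟨0, map_zero _, fun i => by rw [map_zero, hw' i], fun _ => map_zero _⟩
    by_cases hd : ∀ i, M.d h (w i) = 0
    · obtain ⟨x, ⟨hx₁, hx₂⟩, hx⟩ := M.exists_filling hm
        (fun n p => LinearMap.ker (π.toFun n p) ⊓ LinearMap.ker (M.d (n := n) (rfl : p + 1 = p + 1)))
        (fun {n p} i x hx => ⟨by
            have := LinearMap.mem_ker.1 hx.1
            refine LinearMap.mem_ker.2 ?_
            rw [π.map_face, this, map_zero], by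
            have := LinearMap.mem_ker.1 hx.2
            refine LinearMap.mem_ker.2 ?_
            rw [M.d_face, this, map_zero]⟩)
        (fun {n p} i x hx => ⟨by
            have := LinearMap.mem_ker.1 hx.1
            refine LinearMap.mem_ker.2 ?_
            rw [π.map_comp, this, map_zero, LinearMap.zero_apply], by
            have := LinearMap.mem_ker.1 hx.2
            refine LinearMap.mem_ker.2 ?_
            rw [M.d_comp i _ (add_zero p) rfl (zero_add 1) rfl (add_zero _) rfl,
              this, hm.1, map_zero, LinearMap.zero_apply, map_zero, smul_zero, add_zero]⟩)
        (fun {n p} x hx => ⟨by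
            have := LinearMap.mem_ker.1 hx.1
            refine LinearMap.mem_ker.2 ?_
            rw [π.map_comp, this, map_zero], by
            have := LinearMap.mem_ker.1 hx.2
            refine LinearMap.mem_ker.2 ?_
            rw [M.d_comp 0 _ (zero_add p) (zero_add 1) rfl rfl (add_comm 1 p)
              (zero_add _), this, hm.1, map_zero, LinearMap.zero_apply, map_zero, smul_zero,
              add_zero]⟩)
        w (fun i => ⟨hw0 i, by subst h; exact hd i⟩) hw
      exact ⟨x, hx₁, hx, fun _ => by subst h; exact hx₂⟩
    · obtain ⟨x, hx₁, hx⟩ := M.exists_filling hm (fun n p => LinearMap.ker (π.toFun n p))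
        (fun {n p} i x hx => by
            have := LinearMap.mem_ker.1 hx
            refine LinearMap.mem_ker.2 ?_
            rw [π.map_face, this, map_zero])
        (fun {n p} i x hx => by
            have := LinearMap.mem_ker.1 hx
            refine LinearMap.mem_ker.2 ?_
            rw [π.map_comp, this, map_zero, LinearMap.zero_apply])
        (fun {n p} x hx => by
            have := LinearMap.mem_ker.1 hx
            refine LinearMap.mem_ker.2 ?_
            rw [π.map_comp, this, map_zero])
        w hw0 hw
      exact ⟨x, hx₁, hx, fun hd' => absurd hd' hd⟩
  obtain ⟨x₀, rfl⟩ := hπ.surjective _ _ v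
  obtain ⟨x₁, hx₁, hx₁w, -⟩ := fill (fun i => w i - M.face i rfl x₀)
    (hM.imp_right fun ⟨h₁, h₂⟩ => ⟨h₁, fun i => by
      rw [h₂ i, M.face_of_pt_eq_zero h₁, sub_zero]⟩)
    (fun i => by rw [map_sub, hwv, π.map_face, sub_self])
    (fun i j a b ha hb hij => by
      rw [map_sub, map_sub, hw i j a b ha hb hij, M.face_face i j a b ha hb hij])
  -- The defect of `x₀ + x₁` is a boundary `d y` in the kernel of `π`.
  obtain ⟨y, hy, hyπ⟩ := hπ.acyclic h (z - M.d h x₀ - M.d h x₁)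
    (by rw [map_sub, map_sub, hz, M.d_d, M.d_d, sub_zero, sub_zero])
    (by rw [map_sub, map_sub, hzv, π.map_d, π.map_d, hx₁, map_zero, sub_self, sub_zero])
  obtain ⟨y', hy', hy'w, hy'd⟩ := fill (fun i => M.face i rfl y)
    (hM.imp_right fun ⟨h₁, _⟩ => ⟨h₁, fun i => M.face_of_pt_eq_zero h₁ _ _ _⟩)
    (fun i => by rw [π.map_face, hyπ, map_zero])
    (fun i j a b ha hb hij => M.face_face i j a b ha hb hij y)
  have hy'd := hy'd fun i => by
    rw [M.d_face, hy, map_sub, map_sub, hzw, ← M.d_face, ← M.d_face, hx₁w, map_sub]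
    abel
  refine ⟨x₀ + x₁ + (y - y'), ?_, fun i => ?_, ?_⟩
  · rw [map_add, map_add, map_sub, hy, hy'd]
    abel
  · rw [map_add, map_add, map_sub, hx₁w, hy'w]
    abel
  · rw [map_add, map_add, map_sub, hx₁, hyπ, hy']
    abel

/-! ### Filtrations by free extensions -/

/-- The structure common to non-unitary and unitary Sullivan minimal operads `S`: the part of `S` in
positive arities is the union of graded operads `G s`, where `G 0` is the initial operad and
`G (s + 1)` is the free extension of `G s` by generators in arity `s + 2`, and the differential and
the restriction operations map these generators to `G s`. In arity zero, `S` is spanned by the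
distinguished operation, which is zero in the non-unitary case. -/
structure Filtration (S : UDGOperad k) where
  G : ℕ → GOperad.{u} k
  E : ∀ s, GRep k (s + 2)
  ι : ∀ s, GHom (G s) (G (s + 1))
  inc : ∀ s, GenMap (E s) (G (s + 1))
  free : ∀ s, IsFreeExtension (ι s) (inc s)
  incl : ∀ s, GHom (G s) S.toGOperad
  incl_ι : ∀ s n p x, (incl (s + 1)).toFun n p ((ι s).toFun n p x) = (incl s).toFun n p x
  injective : ∀ s n p, Function.Injective ((incl s).toFun n p)
  exhaustive : ∀ n p (x : S.X n p), n ≠ 0 → ∃ s y, (incl s).toFun n p y = x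
  reduced : (G 0).IsReduced
  one_ne_zero : (G 0).one ≠ 0
  eq_zero : ∀ n p (x : (G 0).X n p), 2 ≤ n → x = 0
  attach : ∀ s p, (E s).X p →ₗ[k] (G s).X (s + 2) (p + 1)
  d_inc : ∀ s p e, S.d rfl ((incl (s + 1)).toFun _ _ ((inc s).toFun p e))
    = (incl s).toFun _ _ (attach s p e)
  δ : ∀ s p, Fin (s + 2) → (E s).X p →ₗ[k] (G s).X (s + 1) p
  face_inc : ∀ s p i e, S.face i rfl ((incl (s + 1)).toFun _ _ ((inc s).toFun p e))
    = (incl s).toFun _ _ (δ s p i e)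
  nullary : ∀ x : S.X 0 0, ∃ c : k, x = c • S.pt
  nullary_eq_zero : ∀ p (x : S.X 0 p), p ≠ 0 → x = 0

namespace Filtration

variable {S : UDGOperad k} (F : Filtration S)

theorem isReduced (s : ℕ) : (F.G s).IsReduced := by
  induction s with
  | zero => exact F.reduced
  | succ s ih => exact (F.free s).isReduced ih (by omega)

theorem exists_incl_eq_of_le {s t : ℕ} (h : s ≤ t) {n : ℕ} {p : ℤ} (x : (F.G s).X n p) :
    ∃ y, (F.incl t).toFun n p y = (F.incl s).toFun n p x := by
  induction t, h using Nat.le_induction with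
  | base => exact ⟨x, rfl⟩
  | succ t h ih =>
    obtain ⟨y, hy⟩ := ih
    exact ⟨(F.ι t).toFun n p y, by rw [F.incl_ι, hy]⟩

/-- Operations of arity at most `s + 1` belong to the stage `s`. -/
theorem exists_incl_eq {s n : ℕ} (hn : n ≠ 0) (hs : n ≤ s + 1) {p : ℤ} (x : S.X n p) :
    ∃ y, (F.incl s).toFun n p y = x := by
  obtain ⟨t, y, rfl⟩ := F.exhaustive n p x hn
  rcases le_total t s with h | h
  · exact F.exists_incl_eq_of_le h y
  · induction t, h using Nat.le_induction with
    | base => exact ⟨y, rfl⟩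
    | succ t h ih =>
      obtain ⟨z, rfl⟩ := (F.free t).surjective_of_lt (F.isReduced t) (by omega) y
      rw [F.incl_ι]
      exact ih z

theorem unary (F : Filtration S) (x : S.X 1 0) : ∃ c : k, x = c • S.one := by
  obtain ⟨y, rfl⟩ := F.exists_incl_eq (s := 0) Nat.one_ne_zero le_rfl x
  obtain ⟨c, rfl⟩ := F.reduced.unary y
  exact ⟨c, by rw [map_smul, (F.incl 0).map_one]⟩

theorem unary_eq_zero (F : Filtration S) {p : ℤ} (hp : p ≠ 0) (x : S.X 1 p) : x = 0 := by
  obtain ⟨y, rfl⟩ := F.exists_incl_eq (s := 0) Nat.one_ne_zero le_rfl x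
  rw [F.reduced.unary_eq_zero p y hp, map_zero]

theorem initial_cases {C : ∀ n p, (F.G 0).X n p → Prop} (h0 : ∀ n p, C n p 0)
    (h1 : ∀ c : k, C 1 0 (c • (F.G 0).one)) (n : ℕ) (p : ℤ) (x : (F.G 0).X n p) : C n p x := by
  match n, x with
  | 0, x => rw [F.reduced.nullary p x]; exact h0 _ _
  | 1, x =>
    by_cases hp : p = 0
    · subst hp
      obtain ⟨c, rfl⟩ := F.reduced.unary x
      exact h1 c
    · rw [F.reduced.unary_eq_zero p x hp]; exact h0 _ _
  | n + 2, x => rw [F.eq_zero _ p x (by omega)]; exact h0 _ _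

end Filtration

theorem exists_linearMap_apply_eq {V W : Type*} [AddCommGroup V] [Module k V] [AddCommGroup W]
    [Module k W] (v : V) (w : W) (h : v = 0 → w = 0) : ∃ f : V →ₗ[k] W, f v = w := by
  by_cases hv : v = 0
  · exact ⟨0, by rw [h hv, LinearMap.zero_apply]⟩
  · obtain ⟨l, hl⟩ : ∃ l : Module.Dual k V, l v ≠ 0 := by
      by_contra! H
      exact hv ((Module.forall_dual_apply_eq_zero_iff k v).1 H)
    exact ⟨(l v)⁻¹ • l.smulRight w, by simp [smul_smul, inv_mul_cancel₀ hl]⟩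

/-- The first stage is an initial operad. -/
theorem Filtration.exists_hom {S : UDGOperad k} (F : Filtration S) (Q : GOperad.{u} k) :
    Nonempty (GHom (F.G 0) Q) := by
  obtain ⟨g, hg⟩ := exists_linearMap_apply_eq (k := k) (F.G 0).one Q.one
    fun h => absurd h F.one_ne_zero
  let T : ∀ n p, (F.G 0).X n p →ₗ[k] Q.X n p := fun n p =>
    if h : n = 1 ∧ p = 0 then h.1.symm ▸ h.2.symm ▸ g else 0
  have hT : T 1 0 (F.G 0).one = Q.one := hg
  refine ⟨⟨T, ?_, hT, ?_⟩⟩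
  · intro n p σ x
    revert σ
    refine F.initial_cases (C := fun n p x => ∀ σ, T n p ((F.G 0).act σ x) = Q.act σ (T n p x))
      (fun n p σ => by simp only [map_zero]) (fun c σ => ?_) n p x
    rw [Subsingleton.elim σ 1, GOperad.act_one, GOperad.act_one]
  · intro l m n p q r i hn hr x y
    revert n r i
    refine F.initial_cases (C := fun l p x => ∀ {n : ℕ} {r : ℤ} (i : Fin l) (hn : n + 1 = l + m)
      (hr : p + q = r), T n r ((F.G 0).comp i hn hr x y) = Q.comp i hn hr (T l p x) (T m q y))
      (fun l p n r i hn hr => by simp only [map_zero, LinearMap.zero_apply])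
      (fun c n r i hn hr => ?_) l p x
    obtain rfl : n = m := by omega
    obtain rfl : q = r := by omega
    rw [map_smul, map_smul, LinearMap.smul_apply, map_smul, map_smul, LinearMap.smul_apply, hT,
      GOperad.one_comp, GOperad.one_comp]

/-! ### Lifting along trivial fibrations -/

/-- In characteristic zero, linear maps `E → Q(n)` can be averaged over the symmetric group, which
preserves the values of all linear maps that take a common value on the translates. -/
theorem exists_average [CharZero k] {n : ℕ} (E : GRep.{u} k n) (Q : GOperad.{u} k)
    (g : ∀ p, E.X p →ₗ[k] Q.X n p) :
    ∃ s : GenMap E Q, ∀ (p : ℤ) (e : E.X p) (V : Type u) [AddCommGroup V] [Module k V]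
      (D : Q.X n p →ₗ[k] V) (c : V), (∀ σ, D (Q.act σ⁻¹ (g p (E.act σ e))) = c) →
        D (s.toFun p e) = c := by
  have hne : (Fintype.card (Equiv.Perm (Fin n)) : k) ≠ 0 :=
    Nat.cast_ne_zero.2 Fintype.card_ne_zero
  refine ⟨⟨fun p => (Fintype.card (Equiv.Perm (Fin n)) : k)⁻¹ •
    ∑ σ : Equiv.Perm (Fin n), Q.act σ⁻¹ ∘ₗ g p ∘ₗ E.act σ, ?_⟩, ?_⟩
  · intro p τ e
    simp only [LinearMap.smul_apply, LinearMap.sum_apply, LinearMap.comp_apply, map_smul, map_sum]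
    congr 1
    refine Fintype.sum_equiv (Equiv.mulLeft τ) _ _ fun σ => ?_
    rw [Equiv.coe_mulLeft, ← Q.act_mul, E.act_mul]
    congr 2
    group
  · intro p e V _ _ D c h
    simp only [LinearMap.smul_apply, LinearMap.sum_apply, LinearMap.comp_apply, map_smul, map_sum,
      h, Finset.sum_const, Finset.card_univ, ← Nat.cast_smul_eq_nsmul k, smul_smul,
      inv_mul_cancel₀ hne, one_smul]

/-- `f : G s → M` is a lift of the restriction of `φ : S → P` to `G s` along `π : M → P` which is
compatible with the differentials and the restriction operations. -/
structure Filtration.IsPartialLift {S M P : UDGOperad.{u} k} (F : Filtration S) (π : UHom M P)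
    (φ : UHom S P) (s : ℕ) (f : GHom (F.G s) M.toGOperad) : Prop where
  lift : ∀ n p x, π.toFun n p (f.toFun n p x) = φ.toFun n p ((F.incl s).toFun n p x)
  d : ∀ n p x, ∃ x', (F.incl s).toFun n (p + 1) x' = S.d rfl ((F.incl s).toFun n p x) ∧
    f.toFun n (p + 1) x' = M.d rfl (f.toFun n p x)
  face : ∀ {m n p} (i : Fin n) (h : m + 1 = n) (x : (F.G s).X n p), 2 ≤ n →
    ∃ x', (F.incl s).toFun m p x' = S.face i h ((F.incl s).toFun n p x) ∧
    f.toFun m p x' = M.face i h (f.toFun n p x)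

section Lifting

variable {S M P : UDGOperad.{u} k} {π : UHom M P} {φ : UHom S P}

theorem Filtration.exists_isPartialLift_zero (F : Filtration S) (π : UHom M P) (φ : UHom S P) :
    ∃ f, F.IsPartialLift π φ 0 f := by
  obtain ⟨f⟩ := F.exists_hom M.toGOperad
  refine ⟨f, ?_, ?_, ?_⟩
  · refine F.initial_cases (fun n p => by simp only [map_zero]) fun c => ?_
    rw [map_smul, map_smul, map_smul, map_smul, f.map_one, π.map_one, (F.incl 0).map_one, φ.map_one]
  · refine F.initial_cases (fun n p => ⟨0, by simp only [map_zero], by simp only [map_zero]⟩)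
      fun c => ⟨0, ?_, ?_⟩
    · rw [map_smul, (F.incl 0).map_one, map_smul, S.d_one, smul_zero, map_zero]
    · rw [map_smul, f.map_one, map_smul, M.d_one, smul_zero, map_zero]
  · intro m n p i h x hn
    rw [F.eq_zero n p x hn]
    exact ⟨0, by simp only [map_zero], by simp only [map_zero]⟩

/-- The lifting problem for one new generator is solvable. -/
theorem Filtration.IsPartialLift.exists_lift {F : Filtration S} {s : ℕ}
    {f : GHom (F.G s) M.toGOperad} (hf : F.IsPartialLift π φ s f) (hπ : π.IsTrivialFibration)
    (hpt : S.pt = 0 → M.pt = 0) (hM : S.pt = 0 ∨ ∃ m, M.IsUnital m) {p : ℤ} (e : (F.E s).X p) :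
    ∃ x : M.X (s + 2) p, M.d rfl x = f.toFun _ _ (F.attach s p e) ∧
      (∀ i, M.face i rfl x = f.toFun _ _ (F.δ s p i e)) ∧
      π.toFun _ _ x = φ.toFun _ _ ((F.incl (s + 1)).toFun _ _ ((F.inc s).toFun p e)) := by
  refine hπ.exists_lift rfl _ _ _ ?_ ?_ ?_ ?_ ?_ ?_
  · rcases hM with h | h
    · refine Or.inr ⟨hpt h, fun i => ?_⟩
      rw [F.injective s _ _ ((F.face_inc s p i e).symm.trans
        ((S.face_of_pt_eq_zero h _ _ _).trans (map_zero _).symm)), map_zero]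
    · exact Or.inl h
  · obtain ⟨x', h₁, h₂⟩ := hf.d _ _ (F.attach s p e)
    have h₃ : x' = 0 := F.injective s _ _ (by rw [h₁, ← F.d_inc, S.d_d, map_zero])
    rw [← h₂, h₃, map_zero]
  · intro i j a b ha hb hij
    obtain _ | s := s
    · -- In arity one, the restriction operations are determined by the identity operation.
      have hone : ∀ (y : (F.G 0).X 1 p) (c : Fin 1) (z : (F.G 0).X 1 p) (c' : Fin 1),
          S.face c rfl ((F.incl 0).toFun _ _ y) = S.face c' rfl ((F.incl 0).toFun _ _ z) →
          M.face c rfl (f.toFun _ _ y) = M.face c' rfl (f.toFun _ _ z) := by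
        intro y c z c' h
        by_cases hp : p = 0
        · subst hp
          obtain ⟨α, rfl⟩ := F.reduced.unary y
          obtain ⟨β, rfl⟩ := F.reduced.unary z
          simp only [map_smul, GHom.map_one, UDGOperad.face_one] at h ⊢
          by_cases h0 : S.pt = 0
          · rw [hpt h0, smul_zero, smul_zero]
          · rw [smul_left_injective k h0 h]
        · rw [F.reduced.unary_eq_zero p y hp, F.reduced.unary_eq_zero p z hp]
          simp only [map_zero]
      exact hone _ _ _ _ (by
        rw [← F.face_inc, ← F.face_inc, S.face_face i j a b ha hb hij])
    · obtain ⟨x', h₁, h₂⟩ := hf.face a rfl (F.δ (s + 1) p j e) (by omega)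
      obtain ⟨y', h₃, h₄⟩ := hf.face b rfl (F.δ (s + 1) p i e) (by omega)
      rw [← h₂, ← h₄]
      congr 1
      refine F.injective _ _ _ ?_
      rw [h₁, h₃, ← F.face_inc, ← F.face_inc, S.face_face i j a b ha hb hij]
  · intro i
    obtain ⟨x', h₁, h₂⟩ := hf.d _ _ (F.δ s p i e)
    obtain ⟨y', h₃, h₄⟩ := hf.face i rfl (F.attach s p e) (by omega)
    rw [← h₂, ← h₄]
    congr 1
    refine F.injective _ _ _ ?_
    rw [h₁, h₃, ← F.face_inc, ← F.d_inc, S.d_face]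
  · rw [hf.lift, ← F.d_inc, φ.map_d]
  · intro i
    rw [hf.lift, ← F.face_inc, φ.map_face]

/-- The new generators can be lifted linearly and equivariantly. -/
theorem Filtration.IsPartialLift.exists_genMap [CharZero k] {F : Filtration S} {s : ℕ}
    {f : GHom (F.G s) M.toGOperad} (hf : F.IsPartialLift π φ s f) (hπ : π.IsTrivialFibration)
    (hpt : S.pt = 0 → M.pt = 0) (hM : S.pt = 0 ∨ ∃ m, M.IsUnital m) :
    ∃ g : GenMap (F.E s) M.toGOperad, ∀ p e,
      M.d rfl (g.toFun p e) = f.toFun _ _ (F.attach s p e) ∧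
      (∀ i, M.face i rfl (g.toFun p e) = f.toFun _ _ (F.δ s p i e)) ∧
      π.toFun _ _ (g.toFun p e)
        = φ.toFun _ _ ((F.incl (s + 1)).toFun _ _ ((F.inc s).toFun p e)) := by
  have lin : ∀ p, ∃ g : (F.E s).X p →ₗ[k] M.X (s + 2) p, ∀ e,
      M.d rfl (g e) = f.toFun _ _ (F.attach s p e) ∧
      (∀ i, M.face i rfl (g e) = f.toFun _ _ (F.δ s p i e)) ∧
      π.toFun _ _ (g e) = φ.toFun _ _ ((F.incl (s + 1)).toFun _ _ ((F.inc s).toFun p e)) := by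
    intro p
    let D : M.X (s + 2) p →ₗ[k] M.X (s + 2) (p + 1) × (Fin (s + 2) → M.X (s + 1) p) ×
      P.X (s + 2) p := (M.d rfl).prod ((LinearMap.pi fun i => M.face i rfl).prod (π.toFun _ _))
    let c : (F.E s).X p →ₗ[k] M.X (s + 2) (p + 1) × (Fin (s + 2) → M.X (s + 1) p) ×
      P.X (s + 2) p := (f.toFun _ _ ∘ₗ F.attach s p).prod
        ((LinearMap.pi fun i => f.toFun _ _ ∘ₗ F.δ s p i).prod
          (φ.toFun _ _ ∘ₗ (F.incl (s + 1)).toFun _ _ ∘ₗ (F.inc s).toFun p))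
    have hc : ∀ e, c e ∈ LinearMap.range D := by
      intro e
      obtain ⟨x, h₁, h₂, h₃⟩ := hf.exists_lift hπ hpt hM e
      exact ⟨x, Prod.ext h₁ (Prod.ext (funext h₂) h₃)⟩
    obtain ⟨g, hg⟩ := Module.projective_lifting_property D.rangeRestrict
      (c.codRestrict _ hc) D.surjective_rangeRestrict
    refine ⟨g, fun e => ?_⟩
    have h : D (g e) = c e := congrArg Subtype.val (LinearMap.congr_fun hg e)
    have h' := congrArg Prod.snd h
    exact ⟨congrArg Prod.fst h, fun i => congrFun (congrArg Prod.fst h') i, congrArg Prod.snd h'⟩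
  choose g₀ hg₀ using lin
  obtain ⟨g, hg⟩ := exists_average (F.E s) M.toGOperad g₀
  refine ⟨g, fun p e => ⟨hg p e _ (M.d rfl) _ fun σ => ?_, fun i => hg p e _ (M.face i rfl) _
    fun σ => ?_, hg p e _ (π.toFun _ _) _ fun σ => ?_⟩⟩
  · rw [M.d_act, (hg₀ p _).1, ← f.map_act]
    congr 1
    refine F.injective _ _ _ ?_
    rw [GHom.map_act, ← F.d_inc, ← F.d_inc, GenMap.map_act, GHom.map_act, S.d_act, ← S.act_mul,
      mul_inv_cancel, S.act_one]
  · obtain ⟨ρ, hρ⟩ := exists_face_act (k := k) σ⁻¹ i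
    rw [hρ, (hg₀ p _).2.1, ← f.map_act]
    congr 1
    refine F.injective _ _ _ ?_
    rw [GHom.map_act, ← F.face_inc, ← hρ, ← F.face_inc, GenMap.map_act, GHom.map_act, ← S.act_mul,
      mul_inv_cancel, S.act_one]
  · rw [π.map_act, (hg₀ p _).2.2, GenMap.map_act, GHom.map_act, φ.map_act, ← P.act_mul,
      mul_inv_cancel, P.act_one]

/-- Partial lifts extend to the next stage: it suffices to lift the generators, since the conditions
on a partial lift define suboperads. -/
theorem Filtration.IsPartialLift.exists_extension [CharZero k] {F : Filtration S} {s : ℕ}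
    {f : GHom (F.G s) M.toGOperad} (hf : F.IsPartialLift π φ s f) (hπ : π.IsTrivialFibration)
    (hpt : S.pt = 0 → M.pt = 0) (hM : S.pt = 0 ∨ ∃ m, M.IsUnital m) :
    ∃ f', F.IsPartialLift π φ (s + 1) f' ∧
      ∀ n p x, f'.toFun n p ((F.ι s).toFun n p x) = f.toFun n p x := by
  obtain ⟨g, hg⟩ := hf.exists_genMap hπ hpt hM
  obtain ⟨f', ⟨h₁, h₂⟩, -⟩ := F.free s _ f g
  have hι : ∀ n p x, f'.toFun n p ((F.ι s).toFun n p x) = f.toFun n p x := fun n p x => by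
    rw [← h₁]; rfl
  have hinc : ∀ p e, f'.toFun _ p ((F.inc s).toFun p e) = g.toFun p e := fun p e => by
    rw [← h₂]; rfl
  refine ⟨f', ⟨?_, ?_, ?_⟩, hι⟩
  · have := (F.free s).hom_ext (f := π.toGHom.comp f') (g := φ.toGHom.comp (F.incl (s + 1)))
      (fun n p x => ?_) (fun p e => ?_)
    · intro n p x
      exact congrArg (fun h => GHom.toFun h n p x) this
    · change π.toFun _ _ (f'.toFun _ _ _) = φ.toFun _ _ ((F.incl (s + 1)).toFun _ _ _)
      rw [hι, hf.lift, F.incl_ι]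
    · change π.toFun _ _ (f'.toFun _ _ _) = φ.toFun _ _ ((F.incl (s + 1)).toFun _ _ _)
      rw [hinc, (hg p e).2.2]
  · let R : (F.G (s + 1)).Sub :=
      { carrier := fun n p =>
          { carrier := {x | ∃ x', (F.incl (s + 1)).toFun n (p + 1) x'
              = S.d rfl ((F.incl (s + 1)).toFun n p x) ∧
              f'.toFun n (p + 1) x' = M.d rfl (f'.toFun n p x)}
            add_mem' := by
              rintro x y ⟨x', hx, hx'⟩ ⟨y', hy, hy'⟩
              exact ⟨x' + y', by simp only [map_add, hx, hy], by simp only [map_add, hx', hy']⟩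
            zero_mem' := ⟨0, by simp only [map_zero], by simp only [map_zero]⟩
            smul_mem' := by
              rintro c x ⟨x', hx, hx'⟩
              exact ⟨c • x', by simp only [map_smul, hx], by simp only [map_smul, hx']⟩ }
        act_mem := by
          rintro n p σ x ⟨x', hx, hx'⟩
          exact ⟨(F.G (s + 1)).act σ x', by rw [GHom.map_act, GHom.map_act, hx, S.d_act],
            by rw [GHom.map_act, GHom.map_act, hx', M.d_act]⟩
        one_mem := ⟨0, by rw [GHom.map_one, S.d_one, map_zero],
          by rw [GHom.map_one, M.d_one, map_zero]⟩
        comp_mem := by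
          rintro l m n p q r i hn hr x y ⟨x', hx, hx'⟩ ⟨y', hy, hy'⟩
          have e₁ : p + 1 + q = r + 1 := by omega
          have e₂ : p + (q + 1) = r + 1 := by omega
          refine ⟨(F.G (s + 1)).comp i hn e₁ x' y
            + p.negOnePow • (F.G (s + 1)).comp i hn e₂ x y', ?_, ?_⟩
          · rw [map_add, map_sign_smul, GHom.map_comp, GHom.map_comp, GHom.map_comp, hx, hy,
              S.d_comp i hn hr rfl rfl rfl e₁ e₂]
          · rw [map_add, map_sign_smul, GHom.map_comp, GHom.map_comp, GHom.map_comp, hx', hy',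
              M.d_comp i hn hr rfl rfl rfl e₁ e₂] }
    refine (F.free s).mem_of_sub R (fun n p x => ?_) (fun p e => ?_)
    · obtain ⟨x', hx, hx'⟩ := hf.d n p x
      exact ⟨(F.ι s).toFun _ _ x', by rw [F.incl_ι, F.incl_ι, hx], by rw [hι, hι, hx']⟩
    · exact ⟨(F.ι s).toFun _ _ (F.attach s p e), by rw [F.incl_ι, F.d_inc],
        by rw [hι, hinc, (hg p e).1]⟩
  · let R : (F.G (s + 1)).Sub := (F.isReduced (s + 1)).sub
      (fun n p =>
        { carrier := {x | ∀ (m : ℕ) (i : Fin n) (h : m + 1 = n), 2 ≤ n →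
            ∃ x', (F.incl (s + 1)).toFun m p x' = S.face i h ((F.incl (s + 1)).toFun n p x) ∧
              f'.toFun m p x' = M.face i h (f'.toFun n p x)}
          add_mem' := by
            intro x y hx hy m i h hn
            obtain ⟨x', hx, hx'⟩ := hx m i h hn
            obtain ⟨y', hy, hy'⟩ := hy m i h hn
            exact ⟨x' + y', by simp only [map_add, hx, hy], by simp only [map_add, hx', hy']⟩
          zero_mem' := fun m i h _ => ⟨0, by simp only [map_zero], by simp only [map_zero]⟩
          smul_mem' := by
            intro c x hx m i h hn
            obtain ⟨x', hx, hx'⟩ := hx m i h hn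
            exact ⟨c • x', by simp only [map_smul, hx], by simp only [map_smul, hx']⟩ })
      (by
        intro n p σ x hx m i h hn
        subst h
        obtain ⟨x', hx, hx'⟩ := hx m (σ i) rfl hn
        obtain ⟨ρ, hρ⟩ := exists_face_act (k := k) σ i
        exact ⟨(F.G (s + 1)).act ρ x', by rw [GHom.map_act, GHom.map_act, hx, hρ],
          by rw [GHom.map_act, GHom.map_act, hx', hρ]⟩)
      (fun m i h hn => absurd hn (by omega))
      (by
        intro l m n p q r i hn hr x y hl hm hx hy n' t h hn2
        obtain ⟨l', rfl⟩ : ∃ l', l = l' + 1 := ⟨l - 1, by omega⟩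
        obtain ⟨m', rfl⟩ : ∃ m', m = m' + 1 := ⟨m - 1, by omega⟩
        have hi := i.2
        have ht := t.2
        rcases lt_or_ge (t : ℕ) i with hti | hti
        · obtain ⟨x', hx, hx'⟩ := hx l' ⟨t, by omega⟩ rfl hl
          refine ⟨(F.G (s + 1)).comp ⟨i - 1, by omega⟩ (by omega) hr x' y, ?_, ?_⟩
          · rw [GHom.map_comp, GHom.map_comp, hx, S.face_comp_before i ⟨t, by omega⟩
              ⟨i - 1, by omega⟩ t hn hr h rfl (by omega) hti rfl (by simp only; omega)]
          · rw [GHom.map_comp, GHom.map_comp, hx', M.face_comp_before i ⟨t, by omega⟩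
              ⟨i - 1, by omega⟩ t hn hr h rfl (by omega) hti rfl (by simp only; omega)]
        · rcases lt_or_ge (t : ℕ) (i + (m' + 1)) with htm | htm
          · obtain ⟨y', hy, hy'⟩ := hy m' ⟨t - i, by omega⟩ rfl hm
            refine ⟨(F.G (s + 1)).comp i (by omega) hr x y', ?_, ?_⟩
            · rw [GHom.map_comp, GHom.map_comp, hy, S.face_comp_inner i ⟨t - i, by omega⟩ t hn hr
                h rfl (by omega) (by simp only; omega)]
            · rw [GHom.map_comp, GHom.map_comp, hy', M.face_comp_inner i ⟨t - i, by omega⟩ t hn hr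
                h rfl (by omega) (by simp only; omega)]
          · have hij : i < ⟨t - m', by omega⟩ := Fin.lt_def.2 (by simp only; omega)
            obtain ⟨x', hx, hx'⟩ := hx l' ⟨t - m', by omega⟩ rfl hl
            refine ⟨(F.G (s + 1)).comp ⟨i, by omega⟩ (by omega) hr x' y, ?_, ?_⟩
            · rw [GHom.map_comp, GHom.map_comp, hx, S.face_comp_after i ⟨t - m', by omega⟩
                ⟨i, by omega⟩ t hn hr h rfl (by omega) hij (by simp only; omega) rfl]
            · rw [GHom.map_comp, GHom.map_comp, hx', M.face_comp_after i ⟨t - m', by omega⟩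
                ⟨i, by omega⟩ t hn hr h rfl (by omega) hij (by simp only; omega) rfl])
    intro m n p i h x hn
    refine (F.free s).mem_of_sub R (fun n p x m i h hn => ?_) (fun p e m i h hn => ?_) n p x m i h hn
    · obtain ⟨x', hx, hx'⟩ := hf.face i h x hn
      exact ⟨(F.ι s).toFun _ _ x', by rw [F.incl_ι, F.incl_ι, hx], by rw [hι, hι, hx']⟩
    · obtain rfl : m = s + 1 := by omega
      exact ⟨(F.ι s).toFun _ _ (F.δ s p i e), by rw [F.incl_ι, F.face_inc],
        by rw [hι, hinc, (hg p e).2.1]⟩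

/-- Sullivan minimal operads have the left lifting property with respect to trivial fibrations. In
the presence of a distinguished nullary operation, the trivial fibration has to carry a unital
multiplication. -/
theorem Filtration.exists_lift [CharZero k] (F : Filtration S) (hπ : π.IsTrivialFibration)
    (hpt : S.pt = 0 → M.pt = 0) (hM : S.pt = 0 ∨ ∃ m, M.IsUnital m) (φ : UHom S P) :
    ∃ f : UHom S M, π.comp f = φ := by
  let seq : ∀ s, {f // F.IsPartialLift π φ s f} := fun s =>
    Nat.rec ⟨_, (F.exists_isPartialLift_zero π φ).choose_spec⟩
      (fun s f => ⟨_, (f.2.exists_extension hπ hpt hM).choose_spec.1⟩) s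
  have hseq : ∀ s n p x, (seq (s + 1)).1.toFun n p ((F.ι s).toFun n p x)
      = (seq s).1.toFun n p x :=
    fun s => ((seq s).2.exists_extension hπ hpt hM).choose_spec.2
  have hle : ∀ {s t : ℕ}, s ≤ t → ∀ n p x, ∃ y, (F.incl t).toFun n p y = (F.incl s).toFun n p x ∧
      (seq t).1.toFun n p y = (seq s).1.toFun n p x := by
    intro s t hst n p x
    induction t, hst using Nat.le_induction with
    | base => exact ⟨x, rfl, rfl⟩
    | succ t _ ih =>
      obtain ⟨y, hy, hy'⟩ := ih
      exact ⟨(F.ι t).toFun n p y, by rw [F.incl_ι, hy], by rw [hseq, hy']⟩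
  have hex : ∀ n, n ≠ 0 → ∀ p x, ∃ s₀, ∀ s, s₀ ≤ s → ∃ y, (F.incl s).toFun n p y = x := by
    intro n hn p x
    obtain ⟨s, y, rfl⟩ := F.exhaustive n p x hn
    exact ⟨s, fun t hst => F.exists_incl_eq_of_le hst y⟩
  -- The stage `n` contains all operations of arity `n + 1`, which makes the union of the partial
  -- lifts linear without further argument.
  obtain ⟨T, hT, hT0⟩ : ∃ T : ∀ n p, S.X n p →ₗ[k] M.X n p,
      (∀ s n p y, n ≠ 0 → T n p ((F.incl s).toFun n p y) = (seq s).1.toFun n p y) ∧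
      T 0 0 S.pt = M.pt := by
    obtain ⟨g, hg⟩ := exists_linearMap_apply_eq (k := k) S.pt M.pt hpt
    let T : ∀ n p, S.X n p →ₗ[k] M.X n p := fun n => match n with
      | 0 => fun p => if h : p = 0 then h.symm ▸ g else 0
      | n + 1 => fun p => (seq n).1.toFun (n + 1) p ∘ₗ
        (LinearEquiv.ofBijective ((F.incl n).toFun (n + 1) p)
          ⟨F.injective n _ _, F.exists_incl_eq n.succ_ne_zero le_rfl⟩).symm.toLinearMap
    refine ⟨T, ?_, hg⟩
    intro s n p y hn
    obtain _ | n := n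
    · exact absurd rfl hn
    change (seq n).1.toFun (n + 1) p ((LinearEquiv.ofBijective ((F.incl n).toFun (n + 1) p)
          ⟨F.injective n _ _, F.exists_incl_eq n.succ_ne_zero le_rfl⟩).symm _) = _
    set z := (LinearEquiv.ofBijective ((F.incl n).toFun (n + 1) p)
          ⟨F.injective n _ _, F.exists_incl_eq n.succ_ne_zero le_rfl⟩).symm
          ((F.incl s).toFun (n + 1) p y) with hz
    have hz' : (F.incl n).toFun (n + 1) p z = (F.incl s).toFun (n + 1) p y :=
      LinearEquiv.apply_symm_apply (LinearEquiv.ofBijective ((F.incl n).toFun (n + 1) p) _) _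
    obtain ⟨a, ha, ha'⟩ := hle (le_max_left s n) _ _ y
    obtain ⟨b, hb, hb'⟩ := hle (le_max_right s n) _ _ z
    rw [← ha', ← hb', F.injective _ _ _ (hb.trans (hz'.trans ha.symm))]
  have hT1 : T 1 0 S.one = M.one := by
    rw [← (F.incl 0).map_one, hT _ _ _ _ Nat.one_ne_zero, GHom.map_one]
  refine ⟨⟨⟨⟨T, ?_, hT1, ?_⟩, ?_⟩, hT0⟩, ?_⟩
  · intro n p σ x
    rcases eq_or_ne n 0 with rfl | hn
    · rw [Subsingleton.elim σ 1, S.act_one, M.act_one]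
    · obtain ⟨s, y, rfl⟩ := F.exhaustive n p x hn
      rw [← GHom.map_act, hT _ _ _ _ hn, hT _ _ _ _ hn, GHom.map_act]
  · intro l m n p q r i hn hr x y
    have hl : l ≠ 0 := fun h => by subst h; exact i.elim0
    rcases eq_or_ne m 0 with rfl | hm
    · by_cases hq : q = 0
      swap
      · rw [F.nullary_eq_zero q y hq]
        simp only [map_zero]
      subst hq
      obtain ⟨c, rfl⟩ := F.nullary y
      obtain rfl : p = r := by omega
      obtain rfl : l = n + 1 := by omega
      simp only [map_smul]
      congr 1
      rw [hT0]
      rcases Nat.eq_zero_or_pos n with rfl | hn0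
      · by_cases hp : p = 0
        · subst hp
          obtain ⟨c, rfl⟩ := F.unary x
          change T 0 0 (S.comp (l := 1) i hn hr (c • S.one) S.pt)
            = M.comp (l := 1) i hn hr (T 1 0 (c • S.one)) M.pt
          simp only [map_smul, LinearMap.smul_apply, hT1, hT0, GOperad.one_comp]
        · rw [F.unary_eq_zero hp x]
          simp only [map_zero, LinearMap.zero_apply]
      · obtain ⟨s, a, rfl⟩ := F.exhaustive _ p x hl
        obtain ⟨a', ha, ha'⟩ := (seq s).2.face i rfl a (by omega)
        change T _ _ (S.face i rfl _) = M.face i rfl _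
        rw [← ha, hT _ _ _ _ (by omega), hT _ _ _ _ hl, ha']
    · obtain ⟨s₁, h₁⟩ := hex l hl p x
      obtain ⟨s₂, h₂⟩ := hex m hm q y
      obtain ⟨a, rfl⟩ := h₁ _ (le_max_left s₁ s₂)
      obtain ⟨b, rfl⟩ := h₂ _ (le_max_right s₁ s₂)
      rw [← GHom.map_comp, hT _ _ _ _ hl, hT _ _ _ _ hm, hT _ _ _ _ (by omega), GHom.map_comp]
  · intro n p q h x
    subst h
    rcases eq_or_ne n 0 with rfl | hn
    · by_cases hp : p = 0
      · subst hp
        obtain ⟨c, rfl⟩ := F.nullary x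
        simp only [map_smul, hT0, S.d_pt, M.d_pt, map_zero]
      · rw [F.nullary_eq_zero p x hp]
        simp only [map_zero]
    · obtain ⟨s, y, rfl⟩ := F.exhaustive n p x hn
      obtain ⟨y', hy, hy'⟩ := (seq s).2.d n p y
      rw [← hy, hT _ _ _ _ hn, hT _ _ _ _ hn, hy']
  · ext n p x
    change π.toFun _ _ (T n p x) = φ.toFun n p x
    rcases eq_or_ne n 0 with rfl | hn
    · by_cases hp : p = 0
      · subst hp
        obtain ⟨c, rfl⟩ := F.nullary x
        rw [map_smul, map_smul, map_smul, hT0, π.map_pt, φ.map_pt]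
      · rw [F.nullary_eq_zero p x hp]
        simp only [map_zero]
    · obtain ⟨s, y, rfl⟩ := F.exhaustive n p x hn
      rw [hT _ _ _ _ hn, (seq s).2.lift]

end Lifting

/-! ### Pullbacks and functoriality of path operads -/

section Pullback

variable {A B C D : UDGOperad.{u} k} (f : UHom A C) (g : UHom B C)

/-- The pairs of operations with the same image. -/
def pullbackSub (n : ℕ) (p : ℤ) : Submodule k (A.X n p × B.X n p) :=
  LinearMap.eqLocus (f.toFun n p ∘ₗ LinearMap.fst k _ _) (g.toFun n p ∘ₗ LinearMap.snd k _ _)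

theorem mem_pullbackSub {n : ℕ} {p : ℤ} {x : A.X n p × B.X n p} :
    x ∈ pullbackSub f g n p ↔ f.toFun n p x.1 = g.toFun n p x.2 := Iff.rfl

/-- The pullback `A ×_C B`. -/
def UDGOperad.pullback : UDGOperad k where
  X n p := pullbackSub f g n p
  act σ := (LinearMap.prodMap (A.act σ) (B.act σ)).restrict fun x hx => by
    rw [mem_pullbackSub] at hx ⊢
    simp only [LinearMap.prodMap_apply, GHom.map_act, hx]
  comp i hn hr := LinearMap.mk₂ k
    (fun x y => ⟨(A.comp i hn hr x.1.1 y.1.1, B.comp i hn hr x.1.2 y.1.2), by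
      rw [mem_pullbackSub, GHom.map_comp, GHom.map_comp, mem_pullbackSub _ _|>.1 x.2,
        mem_pullbackSub _ _|>.1 y.2]⟩)
    (fun _ _ _ => Subtype.ext (by simp))
    (fun _ _ _ => Subtype.ext (by simp))
    (fun _ _ _ => Subtype.ext (by simp))
    (fun _ _ _ => Subtype.ext (by simp))
  one := ⟨(A.one, B.one), by rw [mem_pullbackSub, GHom.map_one, GHom.map_one]⟩
  act_one x := Subtype.ext (Prod.ext (A.act_one _) (B.act_one _))
  act_mul σ τ x := Subtype.ext (Prod.ext (A.act_mul σ τ _) (B.act_mul σ τ _))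
  comp_act i hn hr σ τ ρ h₁ h₂ x y := Subtype.ext (Prod.ext (A.comp_act i hn hr σ τ ρ h₁ h₂ _ _)
    (B.comp_act i hn hr σ τ ρ h₁ h₂ _ _))
  comp_one i hn hp x := Subtype.ext (Prod.ext (A.comp_one i hn hp _) (B.comp_one i hn hp _))
  one_comp i hn hp x := Subtype.ext (Prod.ext (A.one_comp i hn hp _) (B.one_comp i hn hp _))
  assoc_seq i j t hu hw hv hw' ha hc hb hc' ht x y z := Subtype.ext (Prod.ext
    (A.assoc_seq i j t hu hw hv hw' ha hc hb hc' ht _ _ _)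
    (B.assoc_seq i j t hu hw hv hw' ha hc hb hc' ht _ _ _))
  assoc_par i j t s hu hw hv hw' ha hc hb hc' hij ht hs x y z := Subtype.ext (Prod.ext
    ((A.assoc_par i j t s hu hw hv hw' ha hc hb hc' hij ht hs _ _ _).trans
      (by simp [Units.smul_def]))
    ((B.assoc_par i j t s hu hw hv hw' ha hc hb hc' hij ht hs _ _ _).trans
      (by simp [Units.smul_def])))
  d h := (LinearMap.prodMap (A.d h) (B.d h)).restrict fun x hx => by
    rw [mem_pullbackSub] at hx ⊢
    simp only [LinearMap.prodMap_apply, DGHom.map_d, hx]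
  d_d h h' x := Subtype.ext (Prod.ext (A.d_d h h' _) (B.d_d h h' _))
  d_act h σ x := Subtype.ext (Prod.ext (A.d_act h σ _) (B.d_act h σ _))
  d_one h := Subtype.ext (Prod.ext (A.d_one h) (B.d_one h))
  d_comp i hn hr hp' hq' hr' h₁ h₂ x y := Subtype.ext (Prod.ext
    ((A.d_comp i hn hr hp' hq' hr' h₁ h₂ _ _).trans (by simp [Units.smul_def]))
    ((B.d_comp i hn hr hp' hq' hr' h₁ h₂ _ _).trans (by simp [Units.smul_def])))
  pt := ⟨(A.pt, B.pt), by rw [mem_pullbackSub, UHom.map_pt, UHom.map_pt]⟩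
  d_pt h := Subtype.ext (Prod.ext (A.d_pt h) (B.d_pt h))

/-- The first projection of a pullback. -/
def UDGOperad.pullbackFst : UHom (UDGOperad.pullback f g) A where
  toFun n p := LinearMap.fst k _ _ ∘ₗ (pullbackSub f g n p).subtype
  map_act _ _ := rfl
  map_one := rfl
  map_comp _ _ _ _ _ := rfl
  map_d _ _ := rfl
  map_pt := rfl

/-- The second projection of a pullback. -/
def UDGOperad.pullbackSnd : UHom (UDGOperad.pullback f g) B where
  toFun n p := LinearMap.snd k _ _ ∘ₗ (pullbackSub f g n p).subtype
  map_act _ _ := rfl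
  map_one := rfl
  map_comp _ _ _ _ _ := rfl
  map_d _ _ := rfl
  map_pt := rfl

variable {f g}

/-- The universal property of a pullback. -/
def UHom.pullbackLift (a : UHom D A) (b : UHom D B) (h : f.comp a = g.comp b) :
    UHom D (UDGOperad.pullback f g) where
  toFun n p := ((a.toFun n p).prod (b.toFun n p)).codRestrict _ fun x =>
    congrArg (fun φ : UHom D C => φ.toFun n p x) h
  map_act σ x := Subtype.ext (Prod.ext (a.map_act σ x) (b.map_act σ x))
  map_one := Subtype.ext (Prod.ext a.map_one b.map_one)
  map_comp i hn hr x y := Subtype.ext (Prod.ext (a.map_comp i hn hr x y) (b.map_comp i hn hr x y))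
  map_d h x := Subtype.ext (Prod.ext (a.map_d h x) (b.map_d h x))
  map_pt := Subtype.ext (Prod.ext a.map_pt b.map_pt)

end Pullback

theorem UHom.map_castDeg {P Q : UDGOperad.{u} k} (f : UHom P Q) {n : ℕ} {p q : ℤ} (h : p = q)
    (x : P.X n p) : f.toFun n q (P.castDeg h x) = Q.castDeg h (f.toFun n p x) := by
  subst h; rfl

/-- The morphism `f[t,dt] : P[t,dt] → Q[t,dt]`. -/
def UHom.path {P Q : UDGOperad.{u} k} (f : UHom P Q) : UHom P.path Q.path :=
  have hcomp : ∀ {l m n : ℕ} {p q r : ℤ} (i : Fin l) (hn : n + 1 = l + m) (hr : p + q = r)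
      (x : P.X l p ⊗[k] k[X]) (y : P.X m q ⊗[k] k[X]),
      (f.toFun n r).rTensor k[X] (P.tcomp i hn hr x y)
        = Q.tcomp i hn hr ((f.toFun l p).rTensor k[X] x) ((f.toFun m q).rTensor k[X] y) := by
    intro l m n p q r i hn hr x y
    induction x with
    | zero => simp
    | add x₁ x₂ h₁ h₂ => simp only [map_add, LinearMap.add_apply, h₁, h₂]
    | tmul x a =>
      induction y with
      | zero => simp
      | add y₁ y₂ h₁ h₂ => simp only [map_add, h₁, h₂]
      | tmul y b => simp [f.map_comp]
  have hact : ∀ {n : ℕ} {p : ℤ} (σ : Equiv.Perm (Fin n)) (x : P.X n p ⊗[k] k[X]),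
      (f.toFun n p).rTensor k[X] ((P.act σ).rTensor k[X] x)
        = (Q.act σ).rTensor k[X] ((f.toFun n p).rTensor k[X] x) := by
    intro n p σ x
    induction x with
    | zero => simp
    | add x₁ x₂ h₁ h₂ => simp only [map_add, h₁, h₂]
    | tmul x a => simp [f.map_act]
  have htd : ∀ {n : ℕ} {p q : ℤ} (h : p + 1 = q) (x : P.X n p ⊗[k] k[X]),
      (f.toFun n q).rTensor k[X] (P.td h x) = Q.td h ((f.toFun n p).rTensor k[X] x) := by
    intro n p q h x
    induction x with
    | zero => simp
    | add x₁ x₂ h₁ h₂ => simp only [map_add, h₁, h₂]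
    | tmul x a => simp [DGOperad.td, f.map_d]
  have hder : ∀ {n : ℕ} {p q : ℤ} (h : p = q) (x : P.X n p ⊗[k] k[X]),
      (f.toFun n q).rTensor k[X] (P.tderiv h x) = Q.tderiv h ((f.toFun n p).rTensor k[X] x) := by
    intro n p q h x
    induction x with
    | zero => simp
    | add x₁ x₂ h₁ h₂ => simp only [map_add, h₁, h₂]
    | tmul x a => simp [GOperad.tderiv, UHom.map_castDeg]
  let T : ∀ n p, (P.X n p ⊗[k] k[X]) × (P.X n (p - 1) ⊗[k] k[X]) →ₗ[k]
      (Q.X n p ⊗[k] k[X]) × (Q.X n (p - 1) ⊗[k] k[X]) :=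
    fun n p => ((f.toFun n p).rTensor k[X]).prodMap ((f.toFun n (p - 1)).rTensor k[X])
  have hcomp₂ : ∀ {l m n : ℕ} {p q r : ℤ} (i : Fin l) (hn : n + 1 = l + m) (hr : p + q = r)
      (x : (P.X l p ⊗[k] k[X]) × (P.X l (p - 1) ⊗[k] k[X]))
      (y : (P.X m q ⊗[k] k[X]) × (P.X m (q - 1) ⊗[k] k[X])),
      (f.toFun n (r - 1)).rTensor k[X] (P.pathComp i hn hr x y).2
        = (Q.pathComp i hn hr (T l p x) (T m q y)).2 := by
    intro l m n p q r i hn hr x y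
    rw [P.pathComp_snd, Q.pathComp_snd, map_add, map_sign_smul, hcomp, hcomp]
    rfl
  have hd₂ : ∀ {n : ℕ} {p q : ℤ} (h : p + 1 = q)
      (x : (P.X n p ⊗[k] k[X]) × (P.X n (p - 1) ⊗[k] k[X])),
      (f.toFun n (q - 1)).rTensor k[X] (P.pathD h x).2 = (Q.pathD h (T n p x)).2 := by
    intro n p q h x
    rw [P.pathD_snd, Q.pathD_snd, map_add, map_sign_smul, hder, htd]
    rfl
  { toFun := T
    map_act := fun σ x => Prod.ext (hact σ x.1) (hact σ x.2)
    map_one := by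
      change ((f.toFun 1 0).rTensor k[X] (P.one ⊗ₜ 1), (f.toFun 1 (0 - 1)).rTensor k[X] 0) = _
      rw [LinearMap.rTensor_tmul, f.map_one, map_zero]
      rfl
    map_comp := fun i hn hr x y => Prod.ext (hcomp i hn hr x.1 y.1) (hcomp₂ i hn hr x y)
    map_d := fun h x => Prod.ext (htd h x.1) (hd₂ h x)
    map_pt := by
      change ((f.toFun 0 0).rTensor k[X] (P.pt ⊗ₜ 1), (f.toFun 0 (0 - 1)).rTensor k[X] 0) = _
      rw [LinearMap.rTensor_tmul, f.map_pt, map_zero]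
      rfl }

theorem evalPoly_rTensor {V W : Type u} [AddCommGroup V] [Module k V] [AddCommGroup W] [Module k W]
    (f : V →ₗ[k] W) (c : k) (x : V ⊗[k] k[X]) :
    evalPoly W c (f.rTensor k[X] x) = f (evalPoly V c x) := by
  induction x with
  | zero => simp
  | add x₁ x₂ h₁ h₂ => simp only [map_add, h₁, h₂]
  | tmul x a => simp

theorem UDGOperad.ev_comp_path {P Q : UDGOperad.{u} k} (f : UHom P Q) (c : k) :
    (Q.ev c).comp f.path = f.comp (P.ev c) := by
  ext n p x
  exact evalPoly_rTensor (f.toFun n p) c x.1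

/-- The inclusion `P → P[t,dt]` of the constant paths. -/
def UDGOperad.const (P : UDGOperad.{u} k) : UHom P P.path where
  toFun n p := LinearMap.inl k _ _ ∘ₗ (TensorProduct.mk k (P.X n p) k[X]).flip 1
  map_act σ x := by
    refine Prod.ext ?_ ?_
    · change (P.act σ x) ⊗ₜ 1 = (P.act σ).rTensor k[X] (x ⊗ₜ 1)
      rw [LinearMap.rTensor_tmul]
    · change 0 = (P.act σ).rTensor k[X] 0
      rw [map_zero]
  map_one := rfl
  map_comp i hn hr x y := by
    refine Prod.ext ?_ ?_
    · change (P.comp i hn hr x y) ⊗ₜ 1 = P.tcomp i hn hr (x ⊗ₜ 1) (y ⊗ₜ 1)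
      rw [P.tcomp_tmul, mul_one]
    · refine Eq.trans ?_ (P.pathComp_snd i hn hr (x ⊗ₜ 1, 0) (y ⊗ₜ 1, 0)).symm
      simp only [map_zero, LinearMap.zero_apply, smul_zero, add_zero]
      rfl
  map_d h x := by
    refine Prod.ext ?_ ?_
    · change (P.d h x) ⊗ₜ 1 = (P.d h).rTensor k[X] (x ⊗ₜ 1)
      rw [LinearMap.rTensor_tmul]
    · refine Eq.trans ?_ (P.pathD_snd h (x ⊗ₜ 1, 0)).symm
      simp only [GOperad.tderiv, TensorProduct.map_tmul, Polynomial.derivative_one, map_zero,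
        TensorProduct.tmul_zero, smul_zero, add_zero]
      rfl
  map_pt := rfl

theorem UDGOperad.ev_comp_const (P : UDGOperad.{u} k) (c : k) :
    (P.ev c).comp P.const = UHom.id P := by
  ext n p x
  change evalPoly _ c (x ⊗ₜ 1) = x
  simp

theorem UHom.path_comp_const {P Q : UDGOperad.{u} k} (f : UHom P Q) :
    f.path.comp P.const = Q.const.comp f := by
  ext n p x
  refine Prod.ext ?_ ?_
  · exact LinearMap.rTensor_tmul _ _ _ _
  · exact map_zero ((f.toFun n (p - 1)).rTensor k[X])

/-! ### Integration along paths -/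

/-- The primitive of a polynomial that vanishes at zero. -/
def primitive (k : Type u) [Field k] : k[X] →ₗ[k] k[X] :=
  Polynomial.lsum fun n => ((n + 1 : ℕ) : k)⁻¹ • Polynomial.monomial (n + 1)

theorem primitive_monomial (n : ℕ) (a : k) : primitive k (Polynomial.monomial n a)
    = Polynomial.monomial (n + 1) (((n + 1 : ℕ) : k)⁻¹ * a) := by
  rw [primitive, Polynomial.lsum_apply, Polynomial.sum_monomial_index _ _ (by simp),
    LinearMap.smul_apply, Polynomial.smul_monomial, smul_eq_mul]

theorem derivative_primitive [CharZero k] (f : k[X]) :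
    Polynomial.derivative (primitive k f) = f := by
  induction f using Polynomial.induction_on' with
  | add f g hf hg => rw [map_add, map_add, hf, hg]
  | monomial n a =>
    rw [primitive_monomial, Polynomial.derivative_monomial, Nat.add_sub_cancel]
    congr 1
    rw [mul_right_comm, inv_mul_cancel₀ (Nat.cast_ne_zero.2 n.succ_ne_zero), one_mul]

theorem primitive_derivative [CharZero k] (f : k[X]) :
    primitive k (Polynomial.derivative f) = f - Polynomial.C (f.eval 0) := by
  induction f using Polynomial.induction_on' with
  | add f g hf hg =>
    rw [map_add, map_add, hf, hg, Polynomial.eval_add, map_add]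
    abel
  | monomial n a =>
    rw [Polynomial.derivative_monomial, primitive_monomial]
    obtain _ | n := n
    · simp
    · have : ((n + 1 : ℕ) : k) ≠ 0 := Nat.cast_ne_zero.2 n.succ_ne_zero
      rw [Nat.add_sub_cancel, mul_comm a, inv_mul_cancel_left₀ this]
      simp

/-- Integration of polynomials with coefficients in `P`. -/
def GOperad.tint (P : GOperad k) {n : ℕ} {p q : ℤ} (h : p = q) :
    P.X n p ⊗[k] k[X] →ₗ[k] P.X n q ⊗[k] k[X] :=
  TensorProduct.map (P.castDeg h) (primitive k)

theorem GOperad.tderiv_tint [CharZero k] (P : GOperad k) {n : ℕ} {p q : ℤ} (h : p = q) (h' : q = p)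
    (x : P.X n p ⊗[k] k[X]) : P.tderiv h' (P.tint h x) = x := by
  subst h
  induction x with
  | zero => simp
  | add x₁ x₂ h₁ h₂ => simp only [map_add, h₁, h₂]
  | tmul x a => simp [GOperad.tderiv, GOperad.tint, GOperad.castDeg, derivative_primitive]

theorem GOperad.eq_of_tderiv_eq_zero [CharZero k] (P : GOperad k) {n : ℕ} {p q : ℤ} (h : p = q)
    (x : P.X n p ⊗[k] k[X]) (hx : P.tderiv h x = 0) (c : k) : x = evalPoly _ c x ⊗ₜ 1 := by
  subst h
  have key : ∀ x : P.X n p ⊗[k] k[X], P.tint rfl (P.tderiv rfl x) = x - evalPoly _ 0 x ⊗ₜ 1 := by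
    intro x
    induction x with
    | zero => simp
    | add x₁ x₂ h₁ h₂ =>
      simp only [map_add, h₁, h₂, TensorProduct.add_tmul]
      abel
    | tmul x a =>
      simp only [GOperad.tderiv, GOperad.tint, GOperad.castDeg, TensorProduct.map_tmul,
        LinearMap.id_apply, primitive_derivative, evalPoly_tmul, TensorProduct.tmul_sub]
      rw [TensorProduct.smul_tmul, Polynomial.smul_eq_C_mul, mul_one]
  have h := key x
  rw [hx, map_zero] at h
  have h' : x = evalPoly _ 0 x ⊗ₜ 1 := (sub_eq_zero.1 h.symm)
  rw [h']
  simp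

theorem rTensor_tint {P Q : UDGOperad.{u} k} (f : UHom P Q) {n : ℕ} {p q : ℤ} (h : p = q)
    (x : P.X n p ⊗[k] k[X]) :
    (f.toFun n q).rTensor k[X] (P.tint h x) = Q.tint h ((f.toFun n p).rTensor k[X] x) := by
  induction x with
  | zero => simp
  | add x₁ x₂ h₁ h₂ => simp only [map_add, h₁, h₂]
  | tmul x a => simp [GOperad.tint, UHom.map_castDeg]

/-- The Poincaré lemma for `k[t,dt]`: a cocycle of `P[t,dt]` differs from its value at `t = c` by
the differential of a family that vanishes at `t = c`. -/
theorem UDGOperad.exists_path_primitive [CharZero k] (P : UDGOperad.{u} k) (c : k) {n : ℕ} {p q : ℤ}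
    (h : p + 1 = q) (z : P.path.X n q) (hz : P.path.d (rfl : q + 1 = q + 1) z = 0) :
    ∃ g : P.path.X n p, (P.ev c).toFun n p g = 0 ∧
      z = P.const.toFun n q ((P.ev c).toFun n q z) + P.path.d h g ∧
      ∀ (Q : UDGOperad.{u} k) (f : UHom P Q), (f.path.toFun n q z).2 = 0 →
        f.path.toFun n p g = 0 := by
  let G₀ : P.X n p ⊗[k] k[X] := p.negOnePow • P.tint (show q - 1 = p by omega) z.2
  let G : P.X n p ⊗[k] k[X] := G₀ - evalPoly _ c G₀ ⊗ₜ 1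
  have hG : evalPoly _ c G = 0 := by simp [G]
  have hder : p.negOnePow • P.tderiv (show p = q - 1 by omega) G = z.2 := by
    have h1 : P.tderiv (show p = q - 1 by omega) (evalPoly _ c G₀ ⊗ₜ[k] (1 : k[X])) = 0 := by
      simp [GOperad.tderiv]
    rw [map_sub, h1, sub_zero, map_sign_smul, P.tderiv_tint, smul_smul, Int.units_mul_self,
      one_smul]
  let g : P.path.X n p := (G, 0)
  refine ⟨g, hG, ?_, ?_⟩
  · let y : P.path.X n q := z - P.path.d h g
    have hy2 : y.2 = 0 := by
      change z.2 - (P.pathD h (G, 0)).2 = 0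
      rw [P.pathD_snd]
      simp only [map_zero, add_zero]
      rw [hder, sub_self]
    have hyd : P.path.d (rfl : q + 1 = q + 1) y = 0 := by
      refine (map_sub _ _ _).trans ?_
      rw [hz, zero_sub, neg_eq_zero]
      exact P.path.d_d h rfl _
    have hy1 : P.tderiv (show q = q + 1 - 1 by omega) y.1 = 0 := by
      have h2 : q.negOnePow • P.tderiv (show q = q + 1 - 1 by omega) y.1
          + P.td (show q - 1 + 1 = q + 1 - 1 by omega) y.2 = 0 := congrArg Prod.snd hyd
      rw [hy2, map_zero, add_zero] at h2
      rcases Int.units_eq_one_or q.negOnePow with e | e <;> rw [e] at h2 <;> simpa using h2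
    have hyc : y = P.const.toFun n q ((P.ev c).toFun n q y) :=
      Prod.ext (P.eq_of_tderiv_eq_zero _ y.1 hy1 c) hy2
    have hev : (P.ev c).toFun n q y = (P.ev c).toFun n q z := by
      have h3 : (P.ev c).toFun n p g = 0 := hG
      rw [map_sub, (P.ev c).map_d, h3, map_zero, sub_zero]
    rw [hev] at hyc
    rw [← hyc]
    exact (sub_add_cancel _ _).symm
  · intro Q f hf
    have h0 : (f.toFun n p).rTensor k[X] G₀ = 0 := by
      have hf' : (f.toFun n (q - 1)).rTensor k[X] z.2 = 0 := hf
      rw [map_sign_smul, rTensor_tint, hf', map_zero, smul_zero]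
    refine Prod.ext ?_ (map_zero ((f.toFun n (p - 1)).rTensor k[X]))
    change (f.toFun n p).rTensor k[X] (G₀ - evalPoly _ c G₀ ⊗ₜ 1) = 0
    rw [map_sub, LinearMap.rTensor_tmul, ← evalPoly_rTensor, h0, map_zero, TensorProduct.zero_tmul,
      sub_zero]

/-! ### Quasi-isomorphisms and homotopies -/

section Quis

variable {P Q R : DGOperad.{u} k}

theorem DGHom.IsQuis.exists_eq_d {f : DGHom P Q} (hf : f.IsQuis) {n : ℕ} {p q : ℤ} (h : p + 1 = q)
    (x : P.X n q) (hx : P.d (rfl : q + 1 = q + 1) x = 0) (w : Q.X n p)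
    (hw : Q.d h w = f.toFun n q x) : ∃ y, P.d h y = x := by
  obtain rfl : p = q - 1 := by omega
  have h0 : f.mapH n q (Submodule.Quotient.mk ⟨x, hx⟩) = f.mapH n q 0 := by
    rw [map_zero]
    exact (Submodule.Quotient.mk_eq_zero _).2 ⟨w, hw⟩
  obtain ⟨y, hy⟩ := (Submodule.Quotient.mk_eq_zero _).1 ((hf n q).1 h0)
  exact ⟨y, hy⟩

theorem DGHom.IsQuis.exists_eq_add_d {f : DGHom P Q} (hf : f.IsQuis) {n : ℕ} {p q : ℤ}
    (h : p + 1 = q) (z : Q.X n q) (hz : Q.d (rfl : q + 1 = q + 1) z = 0) :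
    ∃ (x : P.X n q) (w : Q.X n p), P.d (rfl : q + 1 = q + 1) x = 0 ∧
      f.toFun n q x = z + Q.d h w := by
  obtain rfl : p = q - 1 := by omega
  obtain ⟨a, ha⟩ := (hf n q).2 (Submodule.Quotient.mk ⟨z, hz⟩)
  obtain ⟨⟨x, hx⟩, rfl⟩ := Submodule.Quotient.mk_surjective _ a
  obtain ⟨w, hw⟩ := (Submodule.Quotient.eq _).1 ha
  refine ⟨x, w, hx, ?_⟩
  change Q.d _ w = f.toFun n q x - z at hw
  rw [hw, add_sub_cancel]

/-- A morphism is a quasi-isomorphism if cocycles with exact image are exact, and all cocycles lift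
up to coboundaries. -/
theorem DGHom.isQuis_of {f : DGHom P Q}
    (h₁ : ∀ {n : ℕ} {p q : ℤ} (h : p + 1 = q) (x : P.X n q), P.d (rfl : q + 1 = q + 1) x = 0 →
      ∀ w : Q.X n p, Q.d h w = f.toFun n q x → ∃ y, P.d h y = x)
    (h₂ : ∀ {n : ℕ} {p q : ℤ} (h : p + 1 = q) (z : Q.X n q), Q.d (rfl : q + 1 = q + 1) z = 0 →
      ∃ (x : P.X n q) (w : Q.X n p), P.d (rfl : q + 1 = q + 1) x = 0 ∧
        f.toFun n q x = z + Q.d h w) : f.IsQuis := by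
  intro n q
  constructor
  · refine (injective_iff_map_eq_zero _).2 fun a ha => ?_
    obtain ⟨⟨x, hx⟩, rfl⟩ := Submodule.Quotient.mk_surjective _ a
    obtain ⟨w, hw⟩ := (Submodule.Quotient.mk_eq_zero _).1 ha
    obtain ⟨y, hy⟩ := h₁ _ x hx w hw
    exact (Submodule.Quotient.mk_eq_zero _).2 ⟨y, hy⟩
  · intro b
    obtain ⟨⟨z, hz⟩, rfl⟩ := Submodule.Quotient.mk_surjective _ b
    obtain ⟨x, w, hx, hw⟩ := h₂ (sub_add_cancel q 1) z hz
    refine ⟨Submodule.Quotient.mk ⟨x, hx⟩, (Submodule.Quotient.eq _).2 ⟨w, ?_⟩⟩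
    change Q.d _ w = f.toFun n q x - z
    rw [hw, add_sub_cancel_left]

end Quis

/-- Homotopic morphisms agree on cocycles up to coboundaries. -/
theorem UHom.Homotopic.exists_eq_add_d [CharZero k] {P Q : UDGOperad.{u} k} {f g : UHom P Q}
    (h : f.Homotopic g) {n : ℕ} {p q : ℤ} (hq : p + 1 = q) (x : P.X n q)
    (hx : P.d (rfl : q + 1 = q + 1) x = 0) :
    ∃ w : Q.X n p, g.toFun n q x = f.toFun n q x + Q.d hq w := by
  obtain ⟨H, rfl, rfl⟩ := h
  obtain ⟨w, -, hw, -⟩ := Q.exists_path_primitive 0 hq (H.toFun n q x) (by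
    rw [← H.map_d, hx, map_zero])
  refine ⟨(Q.ev 1).toFun n p w, ?_⟩
  change (Q.ev 1).toFun n q (H.toFun n q x) = (Q.ev 0).toFun n q (H.toFun n q x) + _
  rw [← (Q.ev 1).map_d]
  conv_lhs => rw [hw]
  rw [map_add]
  congr 1
  exact congrArg (fun φ : UHom Q Q => φ.toFun n q ((Q.ev 0).toFun n q (H.toFun n q x)))
    (Q.ev_comp_const 1)

/-- If `φ' ψ ≃ φ` and `φ`, `φ'` are quasi-isomorphisms, then so is `ψ`. -/
theorem UHom.isQuis_of_homotopic [CharZero k] {S S' P : UDGOperad.{u} k} {φ : UHom S P}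
    {φ' : UHom S' P} {ψ : UHom S S'} (hφ : φ.toDGHom.IsQuis) (hφ' : φ'.toDGHom.IsQuis)
    (h : (φ'.comp ψ).Homotopic φ) : ψ.toDGHom.IsQuis := by
  refine DGHom.isQuis_of ?_ ?_
  · intro n p q hq x hx w hw
    obtain ⟨v, hv⟩ := h.exists_eq_add_d hq x hx
    refine hφ.exists_eq_d hq x hx (φ'.toFun n p w + v) ?_
    rw [hv, map_add, ← φ'.map_d, hw]
    rfl
  · intro n p q hq z hz
    obtain ⟨x, w, hx, hw⟩ := hφ.exists_eq_add_d hq (φ'.toFun n q z) (by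
      rw [← φ'.map_d, hz, map_zero])
    obtain ⟨v, hv⟩ := h.exists_eq_add_d hq x hx
    obtain ⟨y, hy⟩ := hφ'.exists_eq_d hq (ψ.toFun n q x - z)
      (by rw [map_sub, ← ψ.map_d, hx, hz, map_zero, sub_zero]) (w - v) (by
        rw [map_sub, map_sub]
        have e : φ'.toFun n q (ψ.toFun n q x) = φ.toFun n q x - P.d hq v := by
          rw [hv, add_sub_cancel_right]; rfl
        rw [e, hw]
        abel)
    exact ⟨x, y, hx, by rw [hy, add_sub_cancel]⟩

/-! ### The trivial fibrations of the homotopy argument -/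

/-- The mapping path operad of `ρ : Q → P`, consisting of the pairs of an operation `y` of `Q` and
a path in `P` that starts at `ρ y`. -/
abbrev UHom.mappingPath {Q P : UDGOperad.{u} k} (ρ : UHom Q P) : UDGOperad.{u} k :=
  UDGOperad.pullback ρ (P.ev 0)

/-- The end point of the path. -/
abbrev UHom.endpoint {Q P : UDGOperad.{u} k} (ρ : UHom Q P) : UHom ρ.mappingPath P :=
  (P.ev 1).comp (UDGOperad.pullbackSnd ρ (P.ev 0))

/-- The inclusion of the pairs with a constant path. -/
def UHom.toMappingPath {Q P : UDGOperad.{u} k} (ρ : UHom Q P) : UHom Q ρ.mappingPath :=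
  UHom.pullbackLift (UHom.id Q) (P.const.comp ρ) (by
    ext n p x
    exact (congrArg (fun φ : UHom P P => φ.toFun n p (ρ.toFun n p x)) (P.ev_comp_const 0)).symm)

/-- A path with prescribed end points. -/
theorem UDGOperad.exists_path (P : UDGOperad.{u} k) {n : ℕ} {p : ℤ} (x y : P.X n p) :
    ∃ z : P.path.X n p, (P.ev 0).toFun n p z = x ∧ (P.ev 1).toFun n p z = y ∧
      ∀ (Q : UDGOperad.{u} k) (f : UHom P Q), f.toFun n p x = f.toFun n p y →
        f.path.toFun n p z = Q.const.toFun n p (f.toFun n p x) := by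
  refine ⟨(x ⊗ₜ (1 - Polynomial.X) + y ⊗ₜ Polynomial.X, 0), ?_, ?_, ?_⟩
  · change evalPoly _ 0 (x ⊗ₜ (1 - Polynomial.X) + y ⊗ₜ Polynomial.X) = x
    simp
  · change evalPoly _ 1 (x ⊗ₜ (1 - Polynomial.X) + y ⊗ₜ Polynomial.X) = y
    simp
  · intro Q f h
    refine Prod.ext ?_ (map_zero ((f.toFun n (p - 1)).rTensor k[X]))
    change (f.toFun n p).rTensor k[X] (x ⊗ₜ (1 - Polynomial.X) + y ⊗ₜ Polynomial.X)
      = f.toFun n p x ⊗ₜ 1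
    rw [map_add, LinearMap.rTensor_tmul, LinearMap.rTensor_tmul, ← h, ← TensorProduct.tmul_add,
      sub_add_cancel]

/-- If `ρ` is a quasi-isomorphism, then its mapping path operad is trivially fibered over the
target. -/
theorem UHom.isTrivialFibration_endpoint [CharZero k] {Q P : UDGOperad.{u} k} {ρ : UHom Q P}
    (hρ : ρ.toDGHom.IsQuis) : ρ.endpoint.IsTrivialFibration where
  surjective n p v := by
    obtain ⟨z, hz₀, hz₁, -⟩ := P.exists_path 0 v
    exact ⟨⟨(0, z), by rw [mem_pullbackSub, map_zero, hz₀]⟩, hz₁⟩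
  acyclic {n p q} h z hz hz' := by
    obtain ⟨⟨y, γ⟩, hyγ⟩ := z
    have hy : Q.d (rfl : q + 1 = q + 1) y = 0 := congrArg (fun z => z.1.1) hz
    have hγ : P.path.d (rfl : q + 1 = q + 1) γ = 0 := congrArg (fun z => z.1.2) hz
    have hγ1 : (P.ev 1).toFun n q γ = 0 := hz'
    have hγ0 : ρ.toFun n q y = (P.ev 0).toFun n q γ := hyγ
    obtain ⟨g, hg, hγg, -⟩ := P.exists_path_primitive 1 h γ hγ
    rw [hγ1, map_zero, zero_add] at hγg
    -- `ρ y` is the coboundary of the starting point of `g`.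
    have hu : P.d h ((P.ev 0).toFun n p g) = ρ.toFun n q y := by
      rw [hγ0, ← (P.ev 0).map_d, ← hγg]
    obtain ⟨x₀, hx₀⟩ := hρ.exists_eq_d h y hy _ hu
    obtain ⟨c, w, hc, hcw⟩ := hρ.exists_eq_add_d (sub_add_cancel p 1)
      ((P.ev 0).toFun n p g - ρ.toFun n p x₀) (by
        subst h
        rw [map_sub, hu, ← ρ.map_d, hx₀, sub_self])
    obtain ⟨b, hb₀, hb₁, -⟩ := P.exists_path w 0
    refine ⟨⟨(x₀ + c, g + P.path.d (sub_add_cancel p 1) b), ?_⟩, Subtype.ext (Prod.ext ?_ ?_), ?_⟩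
    · rw [mem_pullbackSub]
      change ρ.toFun n p (x₀ + c) = (P.ev 0).toFun n p (g + _)
      rw [map_add, map_add, (P.ev 0).map_d, hb₀, hcw]
      abel
    · change Q.d h (x₀ + c) = y
      subst h
      rw [map_add, hx₀, hc, add_zero]
    · change P.path.d h (g + P.path.d _ b) = γ
      rw [map_add, P.path.d_d, add_zero, ← hγg]
    · change (P.ev 1).toFun n p (g + P.path.d _ b) = 0
      rw [map_add, hg, (P.ev 1).map_d, hb₁, map_zero, add_zero]

section FibrePath

variable {M P : UDGOperad.{u} k} (π : UHom M P)

/-- The operad of paths in `M` that are constant over `P`. -/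
abbrev UHom.fibrePath : UDGOperad.{u} k := UDGOperad.pullback π.path P.const

/-- The end points of a path that is constant over `P`. -/
def UHom.fibreEnds : UHom π.fibrePath (UDGOperad.pullback π π) :=
  UHom.pullbackLift ((M.ev 0).comp (UDGOperad.pullbackFst π.path P.const))
    ((M.ev 1).comp (UDGOperad.pullbackFst π.path P.const)) (by
      ext n p z
      obtain ⟨⟨γ, c⟩, h⟩ := z
      have h' : π.path.toFun n p γ = P.const.toFun n p c := h
      have key : ∀ t : k, π.toFun n p ((M.ev t).toFun n p γ) = c := by
        intro t
        have e₁ := congrArg (fun φ : UHom M.path P => φ.toFun n p γ) (UDGOperad.ev_comp_path π t)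
        have e₂ := congrArg (fun φ : UHom P P => φ.toFun n p c) (P.ev_comp_const t)
        refine e₁.symm.trans (Eq.trans ?_ e₂)
        exact congrArg ((P.ev t).toFun n p) h'
      exact (key 0).trans (key 1).symm)

variable {π}

/-- The end points of the paths in the fibres of a trivial fibration form a trivial fibration. -/
theorem UHom.IsTrivialFibration.fibreEnds [CharZero k] (hπ : π.IsTrivialFibration) :
    π.fibreEnds.IsTrivialFibration where
  surjective n p v := by
    obtain ⟨⟨x, y⟩, h⟩ := v
    obtain ⟨z, hz₀, hz₁, hz⟩ := M.exists_path x y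
    exact ⟨⟨(z, π.toFun n p x), hz P π h⟩, Subtype.ext (Prod.ext hz₀ hz₁)⟩
  acyclic {n p q} h z hz hz' := by
    obtain ⟨⟨γ, c⟩, hγc⟩ := z
    have hγ : M.path.d (rfl : q + 1 = q + 1) γ = 0 := congrArg (fun z => z.1.1) hz
    have hγ0 : (M.ev 0).toFun n q γ = 0 := congrArg (fun z => z.1.1) hz'
    have hγ1 : (M.ev 1).toFun n q γ = 0 := congrArg (fun z => z.1.2) hz'
    have hπγ : π.path.toFun n q γ = P.const.toFun n q c := hγc
    have hc : c = 0 := by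
      have e₁ := congrArg (fun φ : UHom M.path P => φ.toFun n q γ) (UDGOperad.ev_comp_path π 0)
      have e₂ := congrArg (fun φ : UHom P P => φ.toFun n q c) (P.ev_comp_const 0)
      refine e₂.symm.trans ((congrArg ((P.ev 0).toFun n q) hπγ).symm.trans (e₁.trans ?_))
      change π.toFun n q ((M.ev 0).toFun n q γ) = 0
      rw [hγ0, map_zero]
    obtain ⟨g, hg, hγg, hgπ⟩ := M.exists_path_primitive 0 h γ hγ
    rw [hγ0, map_zero, zero_add] at hγg
    have hgπ := hgπ P π (by rw [hπγ]; rfl)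
    -- The end point of `g` is a cocycle in the kernel of `π`, hence a boundary `d v` there.
    have hπu : π.toFun n p ((M.ev 1).toFun n p g) = 0 := by
      have e₁ := congrArg (fun φ : UHom M.path P => φ.toFun n p g) (UDGOperad.ev_comp_path π 1)
      refine e₁.symm.trans ?_
      change (P.ev 1).toFun n p (π.path.toFun n p g) = 0
      rw [hgπ, map_zero]
    obtain ⟨v, hv, hπv⟩ := hπ.acyclic (sub_add_cancel p 1) ((M.ev 1).toFun n p g)
      (by subst h; rw [← (M.ev 1).map_d, ← hγg, hγ1]) hπu
    obtain ⟨b, hb₀, hb₁, hb⟩ := M.exists_path 0 v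
    have hbπ := hb P π (by rw [hπv, map_zero])
    rw [map_zero, map_zero] at hbπ
    refine ⟨⟨(g - M.path.d (sub_add_cancel p 1) b, 0), ?_⟩, Subtype.ext (Prod.ext ?_ ?_),
      Subtype.ext (Prod.ext ?_ ?_)⟩
    · rw [mem_pullbackSub]
      change π.path.toFun n p (g - _) = P.const.toFun n p 0
      rw [map_sub, hgπ, π.path.map_d, hbπ, map_zero, map_zero, sub_zero]
    · change M.path.d h (g - M.path.d _ b) = γ
      rw [map_sub, M.path.d_d, sub_zero, ← hγg]
    · change P.d h 0 = c
      rw [hc, map_zero]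
    · change (M.ev 0).toFun n p (g - M.path.d _ b) = 0
      rw [map_sub, hg, (M.ev 0).map_d, hb₀, map_zero, sub_zero]
    · change (M.ev 1).toFun n p (g - M.path.d _ b) = 0
      rw [map_sub, (M.ev 1).map_d, hb₁, hv, sub_self]

/-- The constant paths. -/
def UHom.toFibrePath (π : UHom M P) : UHom M π.fibrePath :=
  UHom.pullbackLift M.const π π.path_comp_const

end FibrePath

/-! ### Quasi-isomorphisms between Sullivan minimal operads -/

/-- A morphism `θ : Q → R` that is bijective in the arity of the generators has the right lifting
property with respect to a free extension. -/
theorem IsFreeExtension.exists_lift {n : ℕ} {E : GRep k n} {P P' Q R : GOperad.{u} k}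
    {ι : GHom P P'} {j : GenMap E P'} (h : IsFreeExtension ι j) (θ : GHom Q R)
    (hθ : ∀ p, Function.Bijective (θ.toFun n p)) (φ : GHom P Q) (ψ : GHom P' R)
    (hφψ : ∀ m p x, θ.toFun m p (φ.toFun m p x) = ψ.toFun m p (ι.toFun m p x)) :
    ∃ f : GHom P' Q, (∀ m p x, f.toFun m p (ι.toFun m p x) = φ.toFun m p x) ∧
      ∀ m p x, θ.toFun m p (f.toFun m p x) = ψ.toFun m p x := by
  let e p := LinearEquiv.ofBijective (θ.toFun n p) (hθ p)
  let g : GenMap E Q :=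
    { toFun := fun p => (e p).symm.toLinearMap ∘ₗ ψ.toFun n p ∘ₗ j.toFun p
      map_act := by
        intro p σ x
        apply (hθ p).1
        have he : ∀ y, θ.toFun n p ((e p).symm y) = y := fun y => (e p).apply_symm_apply y
        simp only [LinearMap.comp_apply, LinearEquiv.coe_coe, GHom.map_act, GenMap.map_act, he] }
  obtain ⟨f, ⟨h₁, h₂⟩, -⟩ := h Q φ g
  have hι : ∀ m p x, f.toFun m p (ι.toFun m p x) = φ.toFun m p x := fun m p x => by
    rw [← h₁]; rfl
  refine ⟨f, hι, fun m p x => ?_⟩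
  have key : θ.comp f = ψ := by
    refine h.hom_ext (fun m p x => ?_) (fun p x => ?_)
    · change θ.toFun m p (f.toFun m p (ι.toFun m p x)) = _
      rw [hι, hφψ]
    · change θ.toFun n p ((f.restrict j).toFun p x) = _
      rw [h₂]
      exact (e p).apply_symm_apply _
  rw [← key]
  rfl

/-- The stages are closed under the differential. -/
theorem Filtration.exists_incl_eq_d {S : UDGOperad.{u} k} (F : Filtration S) (s n : ℕ) (p : ℤ)
    (x : (F.G s).X n p) : ∃ x', (F.incl s).toFun n (p + 1) x' = S.d rfl ((F.incl s).toFun n p x) := by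
  induction s generalizing n p with
  | zero =>
    refine F.initial_cases (C := fun n p x => ∃ x', (F.incl 0).toFun n (p + 1) x'
      = S.d rfl ((F.incl 0).toFun n p x)) (fun n p => ⟨0, by simp only [map_zero]⟩)
      (fun c => ⟨0, ?_⟩) n p x
    rw [map_smul, (F.incl 0).map_one, map_smul, S.d_one, smul_zero, map_zero]
  | succ s ih =>
    let R : (F.G (s + 1)).Sub :=
      { carrier := fun n p => (LinearMap.range ((F.incl (s + 1)).toFun n (p + 1))).comap
          (S.d rfl ∘ₗ (F.incl (s + 1)).toFun n p)
        act_mem := by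
          rintro n p σ x ⟨x', hx⟩
          change _ = S.d rfl _ at hx
          exact ⟨(F.G (s + 1)).act σ x', by
            rw [LinearMap.comp_apply, GHom.map_act, GHom.map_act, hx, S.d_act]⟩
        one_mem := ⟨0, by rw [LinearMap.comp_apply, GHom.map_one, S.d_one, map_zero]⟩
        comp_mem := by
          rintro l m n p q r i hn hr x y ⟨x', hx⟩ ⟨y', hy⟩
          change _ = S.d rfl _ at hx hy
          have e₁ : p + 1 + q = r + 1 := by omega
          have e₂ : p + (q + 1) = r + 1 := by omega
          refine ⟨(F.G (s + 1)).comp i hn e₁ x' y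
            + p.negOnePow • (F.G (s + 1)).comp i hn e₂ x y', ?_⟩
          rw [LinearMap.comp_apply, map_add, map_sign_smul, GHom.map_comp, GHom.map_comp,
            GHom.map_comp, hx, hy, S.d_comp i hn hr rfl rfl rfl e₁ e₂] }
    refine (F.free s).mem_of_sub R (fun n p x => ?_) (fun p e => ?_) n p x
    · obtain ⟨x', hx⟩ := ih n p x
      exact ⟨(F.ι s).toFun _ _ x', by rw [LinearMap.comp_apply, F.incl_ι, F.incl_ι, hx]⟩
    · exact ⟨(F.ι s).toFun _ _ (F.attach s p e), by rw [LinearMap.comp_apply, F.incl_ι, F.d_inc]⟩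

/-- Minimality: in arity `s + 2`, the differential takes values in the stage `s`. -/
theorem Filtration.exists_incl_eq_d_of_arity {S : UDGOperad.{u} k} (F : Filtration S) {s : ℕ}
    {p q : ℤ} (h : p + 1 = q) (x : S.X (s + 2) p) :
    ∃ y, (F.incl s).toFun (s + 2) q y = S.d h x := by
  subst h
  obtain ⟨x, rfl⟩ := F.exists_incl_eq (s := s + 1) (by omega) le_rfl x
  obtain ⟨a, e, rfl⟩ := (F.free s).exists_eq_add (F.isReduced s) (by omega) x
  obtain ⟨a', ha⟩ := F.exists_incl_eq_d s _ _ a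
  exact ⟨a' + F.attach s p e, by rw [map_add, map_add, map_add, F.incl_ι, ha, F.d_inc]⟩

section Iso

variable {S S' : UDGOperad.{u} k} (F : Filtration S) (F' : Filtration S') {ρ : UHom S S'}

/-- If a quasi-isomorphism is an isomorphism on the stage `s`, then it is bijective in arity
`s + 2`: the generators in this arity are a cohomology group relative to the stage `s`. -/
theorem Filtration.bijective_of_stage {s : ℕ} (hρ : ρ.toDGHom.IsQuis)
    (h₁ : ∀ n p x, ρ.toFun n p ((F.incl s).toFun n p x) = 0 → x = 0)
    (h₂ : ∀ n p y, ∃ x, ρ.toFun n p ((F.incl s).toFun n p x) = (F'.incl s).toFun n p y) (p : ℤ) :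
    Function.Bijective (ρ.toFun (s + 2) p) := by
  -- Differentials in arity `s + 2` lie in the stage `s`, where `ρ` is injective.
  have hdd : ∀ {q r : ℤ} (h : q + 1 = r) (x : S.X (s + 2) q), S.d h x = 0 ↔
      ρ.toFun _ _ (S.d h x) = 0 := by
    intro q r h x
    refine ⟨fun h => by rw [h, map_zero], fun h0 => ?_⟩
    obtain ⟨a, ha⟩ := F.exists_incl_eq_d_of_arity h x
    rw [← ha] at h0 ⊢
    rw [h₁ _ _ a h0, map_zero]
  constructor
  · refine (injective_iff_map_eq_zero _).2 fun x hx => ?_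
    obtain ⟨y, rfl⟩ := hρ.exists_eq_d (sub_add_cancel p 1) x
      ((hdd _ _).2 (by rw [ρ.map_d, hx, map_zero])) 0 (by rw [map_zero, hx])
    exact (hdd _ _).2 hx
  · intro x'
    obtain ⟨a', ha'⟩ := F'.exists_incl_eq_d_of_arity rfl x'
    obtain ⟨a, ha⟩ := h₂ _ _ a'
    rw [ha'] at ha
    obtain ⟨y, hy⟩ := hρ.exists_eq_d rfl ((F.incl s).toFun _ _ a)
      ((hdd _ _).2 (by rw [ρ.map_d, ha, S'.d_d])) x' ha.symm
    obtain ⟨c, w, -, hcw⟩ := hρ.exists_eq_add_d (sub_add_cancel p 1) (x' - ρ.toFun _ _ y)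
      (by rw [map_sub, ← ρ.map_d, hy, ha, sub_self])
    obtain ⟨b', hb'⟩ := F'.exists_incl_eq_d_of_arity (sub_add_cancel p 1) w
    obtain ⟨b, hb⟩ := h₂ _ _ b'
    refine ⟨c + y - (F.incl s).toFun _ _ b, ?_⟩
    rw [map_sub, map_add, hb, hb', hcw]
    abel

/-- A quasi-isomorphism restricts to isomorphisms of the stages. -/
theorem Filtration.exists_stage_iso (hρ : ρ.toDGHom.IsQuis) (s : ℕ) :
    ∃ (f : GHom (F.G s) (F'.G s)) (g : GHom (F'.G s) (F.G s)),
      (∀ n p x, (F'.incl s).toFun n p (f.toFun n p x) = ρ.toFun n p ((F.incl s).toFun n p x)) ∧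
      (∀ n p y, ρ.toFun n p ((F.incl s).toFun n p (g.toFun n p y)) = (F'.incl s).toFun n p y) ∧
      ∀ n p x, g.toFun n p (f.toFun n p x) = x := by
  induction s with
  | zero =>
    obtain ⟨f⟩ := F.exists_hom (F'.G 0)
    obtain ⟨g⟩ := F'.exists_hom (F.G 0)
    refine ⟨f, g, F.initial_cases (fun n p => by simp only [map_zero]) fun c => ?_,
      F'.initial_cases (fun n p => by simp only [map_zero]) fun c => ?_,
      F.initial_cases (fun n p => by simp only [map_zero]) fun c => ?_⟩
    · simp only [map_smul, GHom.map_one]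
    · simp only [map_smul, GHom.map_one]
    · simp only [map_smul, GHom.map_one]
  | succ s ih =>
    obtain ⟨f, g, hf, hg, hgf⟩ := ih
    have hbij := F.bijective_of_stage F' hρ (s := s) (fun n p x hx => by
      have h0 : f.toFun n p x = 0 := F'.injective s n p (by rw [hf, hx, map_zero])
      rw [← hgf n p x, h0, map_zero]) (fun n p y => ⟨_, hg n p y⟩)
    have hF : ∀ p, Function.Bijective ((F.incl (s + 1)).toFun (s + 2) p) := fun p =>
      ⟨F.injective _ _ _, F.exists_incl_eq (by omega) le_rfl⟩
    have hF' : ∀ p, Function.Bijective ((F'.incl (s + 1)).toFun (s + 2) p) := fun p =>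
      ⟨F'.injective _ _ _, F'.exists_incl_eq (by omega) le_rfl⟩
    obtain ⟨f₁, hf₁ι, hf₁⟩ := (F.free s).exists_lift (F'.incl (s + 1)) hF' ((F'.ι s).comp f)
      (ρ.toGHom.comp (F.incl (s + 1))) (fun m p x => by
        change (F'.incl (s + 1)).toFun m p ((F'.ι s).toFun m p _)
          = ρ.toFun m p ((F.incl (s + 1)).toFun m p _)
        rw [F'.incl_ι, F.incl_ι, hf])
    obtain ⟨g₁, hg₁ι, hg₁⟩ := (F'.free s).exists_lift (ρ.toGHom.comp (F.incl (s + 1)))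
      (fun p => (hbij p).comp (hF p)) ((F.ι s).comp g) (F'.incl (s + 1)) (fun m p x => by
        change ρ.toFun m p ((F.incl (s + 1)).toFun m p ((F.ι s).toFun m p _))
          = (F'.incl (s + 1)).toFun m p _
        rw [F'.incl_ι, F.incl_ι, hg])
    refine ⟨f₁, g₁, hf₁, hg₁, ?_⟩
    have key : g₁.comp f₁ = GHom.id _ := by
      refine (F.free s).hom_ext (fun m p x => ?_) (fun p e => ?_)
      · change g₁.toFun m p (f₁.toFun m p ((F.ι s).toFun m p x)) = (F.ι s).toFun m p x
        rw [hf₁ι]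
        refine (hg₁ι _ _ _).trans ?_
        change (F.ι s).toFun m p (g.toFun m p (f.toFun m p x)) = _
        rw [hgf]
      · exact ((hbij p).comp (hF p)).1 ((hg₁ _ _ _).trans (hf₁ _ _ _))
    intro n p x
    exact congrArg (fun φ => GHom.toFun φ n p x) key

theorem UHom.isIso_of_bijective {P Q : UDGOperad.{u} k} {f : UHom P Q}
    (h : ∀ n p, Function.Bijective (f.toFun n p)) : f.IsIso := by
  let e n p := LinearEquiv.ofBijective (f.toFun n p) (h n p)
  have he : ∀ {n p} (y : Q.X n p), f.toFun n p ((e n p).symm y) = y :=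
    fun y => (e _ _).apply_symm_apply y
  let g : UHom Q P :=
    { toFun := fun n p => (e n p).symm.toLinearMap
      map_act := fun {n p} σ x => (h n p).1 (by
        simp only [LinearEquiv.coe_coe, f.map_act, he])
      map_one := (h _ _).1 (by simp only [LinearEquiv.coe_coe, f.map_one, he])
      map_comp := fun i hn hr x y => (h _ _).1 (by
        simp only [LinearEquiv.coe_coe, f.map_comp, he])
      map_d := fun hq x => (h _ _).1 (by simp only [LinearEquiv.coe_coe, f.map_d, he])
      map_pt := (h _ _).1 (by simp only [LinearEquiv.coe_coe, f.map_pt, he]) }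
  refine ⟨g, ?_, ?_⟩
  · ext n p x
    exact (e n p).symm_apply_apply x
  · ext n p x
    exact he x

/-- Quasi-isomorphisms between Sullivan minimal operads are isomorphisms. -/
theorem Filtration.isIso_of_isQuis (F : Filtration S) (F' : Filtration S')
    (hρ : ρ.toDGHom.IsQuis) : ρ.IsIso := by
  refine UHom.isIso_of_bijective fun n p => ?_
  rcases eq_or_ne n 0 with rfl | hn
  · constructor
    · refine (injective_iff_map_eq_zero _).2 fun x hx => ?_
      by_cases hp : p = 0
      · subst hp
        obtain ⟨y, rfl⟩ := hρ.exists_eq_d (neg_add_cancel 1) x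
          (F.nullary_eq_zero _ _ (by omega)) 0 (by rw [map_zero, hx])
        rw [F.nullary_eq_zero _ y (by omega), map_zero]
      · exact F.nullary_eq_zero p x hp
    · intro y
      by_cases hp : p = 0
      · subst hp
        obtain ⟨c, rfl⟩ := F'.nullary y
        exact ⟨c • S.pt, by rw [map_smul, ρ.map_pt]⟩
      · exact ⟨0, by rw [map_zero, F'.nullary_eq_zero p y hp]⟩
  · constructor
    · refine (injective_iff_map_eq_zero _).2 fun x hx => ?_
      obtain ⟨s, x, rfl⟩ := F.exhaustive n p x hn
      obtain ⟨f, g, hf, -, hgf⟩ := F.exists_stage_iso F' hρ s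
      have h0 : f.toFun n p x = 0 := F'.injective s n p (by rw [hf, hx, map_zero])
      rw [← hgf n p x, h0, map_zero, map_zero]
    · intro y
      obtain ⟨s, y, rfl⟩ := F'.exhaustive n p y hn
      obtain ⟨f, g, -, hg, -⟩ := F.exists_stage_iso F' hρ s
      exact ⟨_, hg n p y⟩

end Iso

/-! ### Uniqueness of minimal models -/

theorem UHom.map_isUnital {P Q : UDGOperad.{u} k} (f : UHom P Q) {m : P.X 2 0}
    (hm : P.IsUnital m) : Q.IsUnital (f.toFun 2 0 m) := by
  refine ⟨?_, ?_, ?_⟩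
  · rw [← f.map_d, hm.1, map_zero]
  · rw [← f.map_face, hm.2.1, f.map_one]
  · rw [← f.map_face, hm.2.2, f.map_one]

/-- Unital multiplications lift to minimal models, where the unit relations hold on the nose since
there are no coboundaries in arity one. -/
theorem Filtration.exists_isUnital {S P : UDGOperad.{u} k} (F : Filtration S) {φ : UHom S P}
    (hφ : φ.toDGHom.IsQuis) {m : P.X 2 0} (hm : P.IsUnital m) : ∃ m', S.IsUnital m' := by
  obtain ⟨m', w, hm', hw⟩ := hφ.exists_eq_add_d (neg_add_cancel 1) m hm.1
  have key : ∀ i : Fin 2, P.face i (show 1 + 1 = 2 from rfl) m = P.one →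
      S.face i (show 1 + 1 = 2 from rfl) m' = S.one := by
    intro i hi
    obtain ⟨c, hc⟩ := F.unary (S.face i (show 1 + 1 = 2 from rfl) m')
    have h1 : φ.toFun 1 0 (S.face i (show 1 + 1 = 2 from rfl) m' - S.one)
        = P.d (neg_add_cancel 1) (P.face i (show 1 + 1 = 2 from rfl) w) := by
      rw [map_sub, φ.map_face, hw, map_add, hi, φ.map_one, P.d_face, add_sub_cancel_left]
    obtain ⟨y, hy⟩ := hφ.exists_eq_d (neg_add_cancel 1)
      (S.face i (show 1 + 1 = 2 from rfl) m' - S.one)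
      (F.unary_eq_zero (by omega) _) _ h1.symm
    rw [F.unary_eq_zero (by omega) y, map_zero] at hy
    exact (sub_eq_zero.1 hy.symm)
  exact ⟨m', hm', key 0 hm.2.1, key 1 hm.2.2⟩

/-- Uniqueness of minimal models. The last two hypotheses hold if both distinguished nullary
operations vanish, and also if `S'` carries a unital multiplication and `S` is unitary. -/
theorem Filtration.exists_unique_up_to_homotopy [CharZero k] {P S S' : UDGOperad.{u} k}
    (F : Filtration S) (F' : Filtration S') {φ : UHom S P} {φ' : UHom S' P}
    (hφ : φ.toDGHom.IsQuis) (hφ' : φ'.toDGHom.IsQuis) (hpt : S.pt = 0 → S'.pt = 0)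
    (hS' : S.pt = 0 ∨ ∃ m, S'.IsUnital m) :
    ∃ ψ : UHom S S', ψ.IsIso ∧ (φ'.comp ψ).Homotopic φ ∧
      ∀ χ : UHom S S', (φ'.comp χ).Homotopic φ → χ.Homotopic ψ := by
  have transfer : ∀ {M N : UDGOperad.{u} k} (_ : UHom M N),
      (S.pt = 0 → M.pt = 0) → (S.pt = 0 ∨ ∃ m, M.IsUnital m) →
      (S.pt = 0 → N.pt = 0) ∧ (S.pt = 0 ∨ ∃ m, N.IsUnital m) := fun f h₁ h₂ =>
    ⟨fun h => by rw [← f.map_pt, h₁ h, map_zero], h₂.imp_right fun ⟨m, hm⟩ =>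
      ⟨_, f.map_isUnital hm⟩⟩
  -- The hypotheses of the lifting theorem pass from `S'` to `φ'.mappingPath` and its fibre paths.
  have hM := transfer φ'.toMappingPath hpt hS'
  have hπ := UHom.isTrivialFibration_endpoint hφ'
  have hL := transfer φ'.endpoint.toFibrePath hM.1 hM.2
  obtain ⟨f, hf⟩ := F.exists_lift hπ hM.1 hM.2 φ
  let fst := UDGOperad.pullbackFst φ' (P.ev 0)
  let snd := UDGOperad.pullbackSnd φ' (P.ev 0)
  have hψ : (φ'.comp (fst.comp f)).Homotopic φ := ⟨snd.comp f, by
    ext n p x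
    exact (f.toFun n p x).2.symm, hf⟩
  refine ⟨fst.comp f, F.isIso_of_isQuis F' (UHom.isQuis_of_homotopic hφ hφ' hψ), hψ, ?_⟩
  rintro χ ⟨H, hH₀, hH₁⟩
  -- Both `χ` and `ψ`, with their homotopies, are lifts of `φ` to the mapping path operad.
  let g : UHom S φ'.mappingPath := UHom.pullbackLift χ H hH₀.symm
  have hg : φ'.endpoint.comp g = φ := hH₁
  obtain ⟨K, hK⟩ := F.exists_lift hπ.fibreEnds hL.1 hL.2 (UHom.pullbackLift g f (hg.trans hf.symm))
  refine ⟨fst.path.comp ((UDGOperad.pullbackFst φ'.endpoint.path P.const).comp K), ?_, ?_⟩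
  · ext n p x
    have h₁ := congrArg (fun θ : UHom S (UDGOperad.pullback φ'.endpoint φ'.endpoint) =>
      (UDGOperad.pullbackFst φ'.endpoint φ'.endpoint).toFun n p (θ.toFun n p x)) hK
    refine Eq.trans (congrArg (fun θ : UHom _ S' => θ.toFun n p (K.toFun n p x).1.1)
      (UDGOperad.ev_comp_path fst 0)) ?_
    exact congrArg (fst.toFun n p) h₁
  · ext n p x
    have h₁ := congrArg (fun θ : UHom S (UDGOperad.pullback φ'.endpoint φ'.endpoint) =>
      (UDGOperad.pullbackSnd φ'.endpoint φ'.endpoint).toFun n p (θ.toFun n p x)) hK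
    refine Eq.trans (congrArg (fun θ : UHom _ S' => θ.toFun n p (K.toFun n p x).1.1)
      (UDGOperad.ev_comp_path fst 1)) ?_
    exact congrArg (fst.toFun n p) h₁

/-! ### Filtrations of Sullivan minimal operads -/

/-- A dg operad, with zero as distinguished nullary operation. -/
def DGOperad.toUDGOperad (P : DGOperad.{u} k) : UDGOperad k where
  toDGOperad := P
  pt := 0
  d_pt _ := map_zero _

/-- All morphisms preserve the distinguished nullary operation zero. -/
def DGHom.toUHom {P Q : DGOperad.{u} k} (f : DGHom P Q) :
    UHom P.toUDGOperad Q.toUDGOperad where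
  toDGHom := f
  map_pt := map_zero _

theorem DGHom.homotopic_iff {P Q : DGOperad.{u} k} {f g : DGHom P Q} :
    f.toUHom.Homotopic g.toUHom ↔ f.Homotopic g := by
  constructor
  · rintro ⟨H, h₀, h₁⟩
    exact ⟨H.toDGHom, congrArg UHom.toDGHom h₀, congrArg UHom.toDGHom h₁⟩
  · rintro ⟨H, h₀, h₁⟩
    refine ⟨{ toDGHom := H, map_pt := ?_ }, UHom.ext (congrArg (fun f => f.toFun) h₀),
      UHom.ext (congrArg (fun f => f.toFun) h₁)⟩
    refine (map_zero (H.toFun 0 0)).trans ?_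
    exact Prod.ext (TensorProduct.zero_tmul _ _).symm rfl

theorem DGHom.isIso_of_toUHom {P Q : DGOperad.{u} k} {f : DGHom P Q} (h : f.toUHom.IsIso) :
    f.IsIso := by
  obtain ⟨g, h₁, h₂⟩ := h
  exact ⟨g.toDGHom, congrArg UHom.toDGHom h₁, congrArg UHom.toDGHom h₂⟩

theorem DGOperad.IsInitial.one_ne_zero {P : DGOperad.{u} k}
    (h : Function.Bijective (fun c : k => c • P.one)) : P.one ≠ 0 := fun h0 =>
  _root_.one_ne_zero (h.1 (show (1 : k) • P.one = (0 : k) • P.one by rw [h0, smul_zero, smul_zero]))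

/-- The filtration of a non-unitary Sullivan minimal operad. -/
def MinimalPresentation.filtration {S : DGOperad.{u} k} (A : MinimalPresentation S) :
    Filtration S.toUDGOperad :=
  have red₀ : (A.stage 0).IsReduced :=
    ⟨fun p x => (A.initial.2 0 p (by simp)).elim _ _,
      fun x => (A.initial.1.2 x).imp fun _ h => h.symm,
      fun p x hp => (A.initial.2 1 p (by simpa using hp)).elim _ _⟩
  have red : ∀ s, (A.stage s).IsReduced := fun s => by
    induction s with
    | zero => exact red₀
    | succ s ih => exact (A.ext s).free.isReduced ih (by omega)
  have hS : ∀ p (x : S.X 0 p), x = 0 := fun p x => by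
    obtain ⟨s, y, rfl⟩ := A.exhaustive 0 p x
    rw [(red s).nullary p y, map_zero]
  have hι : ∀ s n p x, (A.incl (s + 1)).toFun n p ((A.ext s).ι.toFun n p x)
      = (A.incl s).toFun n p x := fun s n p x =>
    congrArg (fun φ : DGHom _ _ => φ.toFun n p x) (A.incl_comp s)
  { G := fun s => (A.stage s).toGOperad
    E := fun s => (A.ext s).E
    ι := fun s => (A.ext s).ι.toGHom
    inc := fun s => (A.ext s).inc
    free := fun s => (A.ext s).free
    incl := fun s => (A.incl s).toGHom
    incl_ι := hι
    injective := A.injective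
    exhaustive := fun n p x _ => A.exhaustive n p x
    reduced := red₀
    one_ne_zero := DGOperad.IsInitial.one_ne_zero A.initial.1
    eq_zero := fun n p x hn => (A.initial.2 n p (fun h => by
      have := congrArg Prod.fst h
      simp only at this
      omega)).elim _ _
    attach := fun s p => (A.ext s).attach rfl
    d_inc := fun s p e => by
      refine ((A.incl (s + 1)).map_d rfl _).symm.trans ?_
      rw [(A.ext s).d_inc, hι]
      rfl
    δ := fun s p i => 0
    face_inc := fun s p i e => by
      rw [UDGOperad.face_of_pt_eq_zero _ rfl, LinearMap.zero_apply, map_zero]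
    nullary := fun x => ⟨0, (hS 0 x).trans (zero_smul _ _).symm⟩
    nullary_eq_zero := fun p x _ => hS p x }

/-- The inclusion of the truncation. -/
def GOperad.truncIncl (P : GOperad.{u} k) : GHom P.trunc P where
  toFun n p := (P.truncSub n p).subtype
  map_act _ _ := rfl
  map_one := rfl
  map_comp _ _ _ _ _ := rfl

/-- The filtration of a unitary Sullivan minimal operad, by the truncations of its stages. -/
def UnitaryMinimalPresentation.filtration {S : UDGOperad.{u} k}
    (A : UnitaryMinimalPresentation S) : Filtration S :=
  have unit : ∀ s, (A.stage s).IsUnitary := fun s => by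
    obtain _ | s := s
    · exact A.initial.1
    · exact (A.ext s).unitary
  have hι : ∀ s n p x, (A.incl (s + 1)).toFun n p ((A.ext s).ι.toFun n p x)
      = (A.incl s).toFun n p x := fun s n p x =>
    congrArg (fun φ : UHom _ _ => φ.toFun n p x) (A.incl_comp s)
  { G := fun s => (A.stage s).trunc
    E := fun s => (A.ext s).E
    ι := fun s => (A.ext s).ι.toGHom.trunc
    inc := fun s => (A.ext s).inc.trunc (by omega)
    free := fun s => (A.ext s).free
    incl := fun s => (A.incl s).toGHom.comp (A.stage s).truncIncl
    incl_ι := fun s n p x => hι s n p x.1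
    injective := fun s n p => (A.injective s n p).comp Subtype.val_injective
    exhaustive := fun n p x hn => by
      obtain ⟨s, y, rfl⟩ := A.exhaustive n p x
      exact ⟨s, ⟨y, fun h => absurd h hn⟩, rfl⟩
    reduced :=
      ⟨fun p x => Subtype.ext (x.2 rfl),
        fun x => (A.initial.2.1.2 x.1).imp fun _ h => Subtype.ext h.symm,
        fun p x hp => Subtype.ext
          ((A.initial.2.2 1 p Nat.one_ne_zero (by simpa using hp)).elim _ _)⟩
    one_ne_zero := fun h => DGOperad.IsInitial.one_ne_zero A.initial.2.1 (congrArg Subtype.val h)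
    eq_zero := fun n p x hn => Subtype.ext ((A.initial.2.2 n p (by omega) (fun h => by
      have := congrArg Prod.fst h
      simp only at this
      omega)).elim _ _)
    attach := fun s p => ((A.ext s).attach rfl).codRestrict _ fun _ h => absurd h (by omega)
    d_inc := fun s p e => by
      refine ((A.incl (s + 1)).map_d rfl _).symm.trans ?_
      refine (congrArg ((A.incl (s + 1)).toFun _ _) ((A.ext s).d_inc rfl e)).trans (hι _ _ _ _)
    δ := fun s p i => ((A.ext s).δ i rfl).codRestrict _ fun _ h => absurd h (by omega)
    face_inc := fun s p i e => by
      refine ((A.incl (s + 1)).map_face i rfl _).symm.trans ?_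
      exact (congrArg ((A.incl (s + 1)).toFun _ _) ((A.ext s).face_inc i rfl e)).trans (hι _ _ _ _)
    nullary := fun x => by
      obtain ⟨s, y, rfl⟩ := A.exhaustive 0 0 x
      obtain ⟨c, rfl⟩ := (unit s).1.2 y
      exact ⟨c, by simp only [map_smul, (A.incl s).map_pt]⟩
    nullary_eq_zero := fun p x hp => by
      obtain ⟨s, y, rfl⟩ := A.exhaustive 0 p x
      rw [((unit s).2 p hp).elim y 0, map_zero] }

theorem UnitaryMinimalPresentation.pt_ne_zero {S : UDGOperad.{u} k}
    (A : UnitaryMinimalPresentation S) : S.pt ≠ 0 := by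
  rw [← (A.incl 0).map_pt]
  intro h
  have h0 : (A.stage 0).pt = 0 := A.injective 0 0 0 (h.trans (map_zero _).symm)
  exact one_ne_zero (A.initial.1.1.1
    (show (1 : k) • (A.stage 0).pt = (0 : k) • (A.stage 0).pt by rw [h0, smul_zero, smul_zero]))

end

theorem mainTheorem2 {k : Type u} [Field k] [CharZero k] :
    -- uniqueness of non-unitary Sullivan minimal models
    (∀ (P S S' : DGOperad.{u} k) (φ : DGHom S P) (φ' : DGHom S' P),
      φ.IsMinimalModel → φ'.IsMinimalModel →
      ∃ ψ : DGHom S S', ψ.IsIso ∧ (φ'.comp ψ).Homotopic φ ∧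
        ∀ χ : DGHom S S', (φ'.comp χ).Homotopic φ → χ.Homotopic ψ) ∧
    -- uniqueness of unitary Sullivan minimal models
    (∀ (P S S' : UDGOperad.{u} k) (φ : UHom S P) (φ' : UHom S' P),
      P.HasUnitaryMultiplication → φ.IsMinimalModel → φ'.IsMinimalModel →
      ∃ ψ : UHom S S', ψ.IsIso ∧ (φ'.comp ψ).Homotopic φ ∧
        ∀ χ : UHom S S', (φ'.comp χ).Homotopic φ → χ.Homotopic ψ) ∧
    -- quasi-isomorphisms between Sullivan minimal operads are isomorphisms
    (∀ (S S' : DGOperad.{u} k) (ρ : DGHom S S'),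
      S.IsSullivanMinimal → S'.IsSullivanMinimal → ρ.IsQuis → ρ.IsIso) ∧
    (∀ (S S' : UDGOperad.{u} k) (ρ : UHom S S'),
      S.IsSullivanMinimal → S'.IsSullivanMinimal → ρ.toDGHom.IsQuis → ρ.IsIso) := by
  refine ⟨?_, ?_, ?_, ?_⟩
  · rintro P S S' φ φ' ⟨⟨A⟩, hφ⟩ ⟨⟨A'⟩, hφ'⟩
    obtain ⟨ψ, h₁, h₂, h₃⟩ := A.filtration.exists_unique_up_to_homotopy A'.filtration
      (φ := φ.toUHom) (φ' := φ'.toUHom) hφ hφ' (fun _ => rfl) (Or.inl rfl)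
    exact ⟨ψ.toDGHom, DGHom.isIso_of_toUHom h₁, DGHom.homotopic_iff.1 h₂, fun χ hχ =>
      DGHom.homotopic_iff.1 (h₃ χ.toUHom (DGHom.homotopic_iff.2 hχ))⟩
  · rintro P S S' φ φ' ⟨m, hm, -, hm₀, hm₁⟩ ⟨⟨A⟩, hφ⟩ ⟨⟨A'⟩, hφ'⟩
    exact A.filtration.exists_unique_up_to_homotopy A'.filtration hφ hφ'
      (fun h => absurd h A.pt_ne_zero)
      (Or.inr (A'.filtration.exists_isUnital hφ' ⟨hm, hm₀, hm₁⟩))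
  · rintro S S' ρ ⟨A⟩ ⟨A'⟩ hρ
    exact DGHom.isIso_of_toUHom (A.filtration.isIso_of_isQuis A'.filtration (ρ := ρ.toUHom) hρ)
  · rintro S S' ρ ⟨A⟩ ⟨A'⟩ hρ
    exact A.filtration.isIso_of_isQuis A'.filtration hρ
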